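/- \textbf{Definitions.} Let $K$ be a field. An $\mathbb R$-filtration of a $K$-vector space $V$ is a decreasing family $(V_r)_{r\in\mathbb R}$ of subspaces of $V$; it is \emph{separated} if $\bigcap_r V_r=0$, \emph{exhaustive} if $\bigcup_r V_r=V$, and \emph{left continuous} if $V_r=\bigcap_{s<r}V_s$ for every $r$. The index of $x\in V$ is $\lambda(x)=\sup\{r\in\mathbb R : x\in V_r\}\in\mathbb R\cup\{\pm\infty\}$. If $V$ is non-zero of finite dimension $N$ and the filtration is separated and exhaustive, a basis $\mathbf e=(e_1,\dots,e_N)$ of $V$ has the probability measure $\nu_{\mathbf e}=\frac1N\sum_{i=1}^N\delta_{\lambda(e_i)}$ on $\mathbb R$; the basis is \emph{maximal} if $\nu_{\mathbf e}([r,+\infty[)\ge\nu_{\mathbf e'}([r,+\infty[)$ for every $r\in\mathbb R$ and every basis $\mathbf e'$ of $V$. The measure $\nu_V$ associated to the filtration is $\nu_{\mathbf e}$ for any maximal basis $\mathbf e$. For $\varepsilon>0$, $T_\varepsilon\nu$ denotes the direct image of $\nu$ by $x\mapsto\varepsilon x$. A sequence of Borel probability measures $\nu_n$ converges vaguely to $\nu$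 if $\int g\,\mathrm d\nu_n\to\int g\,\mathrm d\nu$ for every continuous $g:\mathbb R\to\mathbb R$ with compact support. The polygon of a Borel probability measure $\nu$ with bounded support is the function $P(\nu)(t)=\int_0^t\sup\{x\in\mathbb R : \nu(]x,+\infty[)>s\}\,\mathrm ds$ on $[0,1]$. Given a commutative graded $K$-algebra $B=\bigoplus_{n\ge0}B_n$, an $\mathbb R$-filtration $(B_{n,s})_{s\in\mathbb R}$ of each $B_n$, and $f:\mathbb Z_{\ge0}\to\mathbb R_{\ge0}$, one says that $B$ is \emph{$f$-pseudo-filtered} if, for all sufficiently large integers $n,m$ and all real $s,t$, \[B_{n,s}B_{m,t}\subset B_{n+m,\,s+t-f(n)-f(m)}.\] \textbf{Theorem.} Let $f:\mathbb Z_{\ge 0}\to\mathbb R_{\ge 0}$ be an increasing (i.e. non-decreasing) function such that $\sum_{\alpha\ge 0}f(2^\alpha)/2^\alpha<+\infty$. Let $B=\bigoplus_{n\ge0}B_n$ be a graded $K$-algebra which is an integral domain, of finite type over $K$ and generated as a $K$-algebra by $B_1$. Suppose that \begin{enumerate} \item[i)] the Krull dimension of $B$ is strictly positive; \item[ii)]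 each $B_n$ is equipped with an $\mathbb R$-filtration, which for $n\ge1$ is separated, exhaustive and left continuous, such that $B$ is $f$-pseudo-filtered; \item[iii)] $\displaystyle\limsup_{n\to+\infty}\ \sup_{0\ne a\in B_n}\frac{\lambda(a)}{n}<+\infty$. \end{enumerate} For every integer $n\ge1$ put $\nu_n=T_{1/n}\nu_{B_n}$. Then the $\nu_n$ ($n\ge1$) are Borel probability measures whose supports are uniformly bounded, and the sequence $(\nu_n)_{n\ge1}$ converges vaguely to a Borel probability measure $\nu$ on $\mathbb R$. Moreover the polygons $P(\nu_n)$ converge uniformly on $[0,1]$ to $P(\nu)$, which is a concave function on $[0,1]$. -/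

import Mathlib

open MeasureTheory Filter Topology
open scoped NNReal ENNReal

/-- A decreasing `ℝ`-filtration of a `K`-vector space `V`. -/
structure RFiltration (K V : Type*) [Field K] [AddCommGroup V] [Module K V] where
  /-- the subspace `F_r V` -/
  sub : ℝ → Submodule K V
  anti : Antitone sub

namespace RFiltration

variable {K V : Type*} [Field K] [AddCommGroup V] [Module K V]

/-- `⋂ r, F_r V = 0`. -/
def IsSeparated (F : RFiltration K V) : Prop := ⨅ r : ℝ, F.sub r = ⊥

/-- `⋃ r, F_r V = V`. -/
def IsExhaustive (F : RFiltration K V) : Prop := ⋃ r : ℝ, (F.sub r : Set V) = Set.univ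

/-- `F_r V = ⋂ s < r, F_s V` for all `r`. -/
def IsLeftContinuous (F : RFiltration K V) : Prop :=
  ∀ r : ℝ, F.sub r = ⨅ s : ℝ, ⨅ _ : s < r, F.sub s

/-- The index `λ(x) = sup {r | x ∈ F_r V}`, in `ℝ ∪ {±∞}` (the supremum of `∅` is `-∞`). -/
noncomputable def index (F : RFiltration K V) (x : V) : EReal :=
  sSup ((fun r : ℝ => (r : EReal)) '' {r : ℝ | x ∈ F.sub r})

/-- The measure `(1/n) ∑ i, δ_{λ(e i)}` of a basis `e` of an `n`-dimensional space. For a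
separated and exhaustive filtration every `λ(e i)` is a real number. -/
noncomputable def basisMeasure (F : RFiltration K V)
    (e : Module.Basis (Fin (Module.finrank K V)) K V) : Measure ℝ :=
  ((Module.finrank K V : ℝ≥0∞)⁻¹) • ∑ i, Measure.dirac (F.index (e i)).toReal

end RFiltration

/-- `ν₁` is on the right of `ν₂`: `ν₁ [r, +∞) ≥ ν₂ [r, +∞)` for every real `r`. -/
def IsOnTheRightOf (ν₁ ν₂ : Measure ℝ) : Prop :=
  ∀ r : ℝ, ν₂ (Set.Ici r) ≤ ν₁ (Set.Ici r)

namespace RFiltration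

variable {K V : Type*} [Field K] [AddCommGroup V] [Module K V]

/-- A basis is maximal if its measure is on the right of the measure of every basis. -/
def IsMaximalBasis (F : RFiltration K V)
    (e : Module.Basis (Fin (Module.finrank K V)) K V) : Prop :=
  ∀ e' : Module.Basis (Fin (Module.finrank K V)) K V,
    IsOnTheRightOf (F.basisMeasure e) (F.basisMeasure e')

open Classical in
/-- The measure `ν_V` associated to the filtration: the measure of a maximal basis. Two maximal
bases have the same measure, and a separated, exhaustive filtration of a finite-dimensional space
has a maximal basis. The measure of the zero space is zero. -/
noncomputable def measure (F : RFiltration K V) : Measure ℝ :=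
  if h : ∃ e : Module.Basis (Fin (Module.finrank K V)) K V, F.IsMaximalBasis e then
    F.basisMeasure h.choose
  else 0

end RFiltration

/-- The filtrations `F n` make the graded algebra `⨁ 𝓑 n` an `f`-pseudo-filtered graded algebra:
`B_{n,s} B_{m,t} ⊆ B_{n+m, s+t-f(n)-f(m)}` for all sufficiently large `n, m`. -/
def IsPseudoFiltered {K B : Type*} [Field K] [CommRing B] [Algebra K B]
    (𝓑 : ℕ → Submodule K B) [GradedAlgebra 𝓑] (f : ℕ → ℝ≥0)
    (F : ∀ n : ℕ, RFiltration K (𝓑 n)) : Prop :=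
  ∃ N : ℕ, ∀ n m : ℕ, N ≤ n → N ≤ m → ∀ s t : ℝ, ∀ a ∈ (F n).sub s, ∀ b ∈ (F m).sub t,
    (⟨(a : B) * (b : B), SetLike.mul_mem_graded a.2 b.2⟩ : 𝓑 (n + m)) ∈
      (F (n + m)).sub (s + t - f n - f m)

/-- `T_ε ν`, the direct image of `ν` by `x ↦ ε x`. -/
noncomputable def dilate (ε : ℝ) (ν : Measure ℝ) : Measure ℝ := ν.map (fun x => ε * x)

/-- Vague convergence of a sequence of measures on `ℝ`. -/
def TendstoVaguely (ν : ℕ → Measure ℝ) (μ : Measure ℝ) : Prop :=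
  ∀ g : ℝ → ℝ, Continuous g → HasCompactSupport g →
    Tendsto (fun n => ∫ x, g x ∂(ν n)) atTop (𝓝 (∫ x, g x ∂μ))

/-- The quasi-inverse `t ↦ sup {x | f x > t}`, meaningful for `0 < t < 1`. -/
noncomputable def quasiInverse (f : ℝ → ℝ) (t : ℝ) : ℝ := sSup {x : ℝ | t < f x}

/-- The polygon (concave function on `[0, 1]`) of a probability measure: the primitive, zero at the
origin, of the quasi-inverse of `x ↦ ν (x, +∞)`. -/
noncomputable def polygon (ν : Measure ℝ) (t : ℝ) : ℝ :=
  ∫ s in (0 : ℝ)..t, quasiInverse (fun x => ν.real (Set.Ioi x)) s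

/-! ### A valuation with distinct values on monomials, and subspaces of constant value -/

section MonomialValuation

universe u

open MvPolynomial
open scoped MonomialOrder

variable {K : Type*} [Field K] {σ : Type*} (o : MonomialOrder σ)

/-! For an adapted basis, the mass that `ν n` gives to `[t, ∞)` is the dimension of the step of
index `t * n` divided by `dim 𝓑 n` (`RFiltration.measure_Ici`). The theorem is thus about the growth
of dimensions, and these are counted by lattice points, in the manner of Okounkov bodies.

A Noether normalization of `B` and the lexicographic order give a valuation `w` on `B` taking
distinct values on monomials. As `K` is arbitrary, the residue field may exceed `K`, so a subspace
on which `w` is constant can have dimension above one; the rank of `B` over the polynomial ring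
still bounds that dimension (`Valuation.exists_finrank_le_of_isPureOn`). By integrality, a fixed
power of each `w b` is the value of a Laurent monomial. Its exponent is an additive integral index
of `b`, bounded linearly in the degree by Cayley–Hamilton (`exists_additive_index`).
`exists_lattice_index` then replaces the filtration by finite sets `T n t` in `ℤ ^ d`: up to a
bounded shift of degree, dimensions are `E` times cardinalities, where `E` is the largest dimension
of a subspace of constant value.

These sets are superadditive with error `f`. Adding copies of one point by repeated halving loses,
per copy, at most `n` times a defect tending to zero; this is where the dyadic series enters
(`dyadic_superadditive`). Points of index at least `t`, corrected by the defect and divided by their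
degree, have a bounded convex hull of volume `Φ t`. Every point of `T n (t * n)` lands in a slightly
larger hull, which bounds the count above (`eventually_ncard_lt`). Conversely, an integral point of
a large multiple of a polytope inscribed in the hull is a nonnegative integral combination of
finitely many known points plus a bounded remainder, which bounds the count below
(`eventually_lt_ncard`).

Dividing by the total volume gives a limiting tail profile `Ψ` with two-sided bounds
(`exists_isTailFunction_finrank`). The quantile functions then converge almost everywhere and are
uniformly bounded, so dominated convergence gives both vague convergence and uniform convergence of
their primitives, the polygons. -/

theorem MonomialOrder.eq_zero_or_degree_lt_mul {a b s t : MvPolynomial σ K} (hs : s ≠ 0)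
    (ht : t ≠ 0) (h : a = 0 ∨ o.degree a ≺[o] o.degree s) (h' : o.degree b ≼[o] o.degree t) :
    a * b = 0 ∨ o.degree (a * b) ≺[o] o.degree (s * t) := by
  rcases h with h | h
  · left; simp [h]
  · right
    rw [o.degree_mul hs ht, map_add]
    refine lt_of_le_of_lt o.degree_mul_le ?_
    rw [map_add]
    exact add_lt_add_of_lt_of_le h h'

theorem MonomialOrder.eq_zero_or_degree_lt_add {a b s : MvPolynomial σ K}
    (h : a = 0 ∨ o.degree a ≺[o] o.degree s) (h' : b = 0 ∨ o.degree b ≺[o] o.degree s) :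
    a + b = 0 ∨ o.degree (a + b) ≺[o] o.degree s := by
  rcases h with rfl | h
  · simpa using h'
  · rcases h' with rfl | h'
    · right; simpa using h
    · right
      exact lt_of_le_of_lt o.degree_add_le (max_lt h h')

theorem MonomialOrder.degree_mul_le_degree_mul {a b s t : MvPolynomial σ K} (hs : s ≠ 0)
    (ht : t ≠ 0) (h : o.degree a ≼[o] o.degree s) (h' : o.degree b ≼[o] o.degree t) :
    o.degree (a * b) ≼[o] o.degree (s * t) := by
  rw [o.degree_mul hs ht, map_add]
  refine le_trans o.degree_mul_le ?_
  rw [map_add]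
  exact add_le_add h h'

variable {L : Type*} [Field L]

/-- The ring of fractions `a / s` with `deg a ≤ deg s` for a monomial order. -/
def MonomialOrder.fractionSubring (g : MvPolynomial σ K →+* L) : Subring L where
  carrier := {z | ∃ a s, s ≠ 0 ∧ o.degree a ≼[o] o.degree s ∧ z * g s = g a}
  mul_mem' := by
    rintro z z' ⟨a, s, hs, h, e⟩ ⟨a', s', hs', h', e'⟩
    refine ⟨a * a', s * s', mul_ne_zero hs hs', o.degree_mul_le_degree_mul hs hs' h h', ?_⟩
    rw [map_mul, map_mul, ← e, ← e']; ring
  one_mem' := ⟨1, 1, one_ne_zero, le_rfl, by simp⟩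
  add_mem' := by
    rintro z z' ⟨a, s, hs, h, e⟩ ⟨a', s', hs', h', e'⟩
    refine ⟨a * s' + s * a', s * s', mul_ne_zero hs hs',
      le_trans o.degree_add_le (max_le (o.degree_mul_le_degree_mul hs hs' h le_rfl)
        (o.degree_mul_le_degree_mul hs hs' le_rfl h')), ?_⟩
    rw [map_add, map_mul, map_mul, map_mul, ← e, ← e']; ring
  zero_mem' := ⟨0, 1, one_ne_zero, by simp, by simp⟩
  neg_mem' := by
    rintro z ⟨a, s, hs, h, e⟩
    refine ⟨-1 * a, 1 * s, by simpa using hs, o.degree_mul_le_degree_mul one_ne_zero hs ?_ h, ?_⟩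
    · rw [show (-1 : MvPolynomial σ K) = C (-1) by simp, o.degree_C]; simp
    · simp [← e]

/-- The ideal of fractions `a / s` with `a = 0` or `deg a < deg s`. -/
def MonomialOrder.fractionIdeal (g : MvPolynomial σ K →+* L) : Ideal (o.fractionSubring g) where
  carrier := {z | ∃ a s, s ≠ 0 ∧ (a = 0 ∨ o.degree a ≺[o] o.degree s) ∧ (z : L) * g s = g a}
  add_mem' := by
    rintro z z' ⟨a, s, hs, h, e⟩ ⟨a', s', hs', h', e'⟩
    refine ⟨a * s' + a' * s, s * s', mul_ne_zero hs hs',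
      o.eq_zero_or_degree_lt_add (o.eq_zero_or_degree_lt_mul hs hs' h le_rfl)
        (mul_comm s s' ▸ o.eq_zero_or_degree_lt_mul hs' hs h' le_rfl), ?_⟩
    rw [map_add, map_mul, map_mul, map_mul, ← e, ← e']; push_cast; ring
  zero_mem' := ⟨0, 1, one_ne_zero, by simp, by simp⟩
  smul_mem' := by
    rintro c z ⟨a, s, hs, h, e⟩
    obtain ⟨a', s', hs', h', e'⟩ := c.2
    refine ⟨a * a', s * s', mul_ne_zero hs hs', o.eq_zero_or_degree_lt_mul hs hs' h h', ?_⟩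
    rw [map_mul, map_mul, ← e, ← e']; push_cast [smul_eq_mul]; ring

/-- A quotient of a smaller monomial by a larger one lies in `fractionIdeal`. That ideal is proper
because `1 = a / s` would force `a = s`. A valuation ring whose maximal ideal contains it therefore
orders monomials as `o` does. -/
theorem MonomialOrder.exists_valuationSubring (g : MvPolynomial σ K →+* L)
    (hg : Function.Injective g) :
    ∃ W : ValuationSubring L, (∀ c, W.valuation (g (C c)) ≤ 1) ∧
      ∀ α β, α ≺[o] β →
        W.valuation (g (monomial α 1)) < W.valuation (g (monomial β 1)) := by
  classical
  have hne : o.fractionIdeal g ≠ ⊤ := by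
    intro h
    obtain ⟨a, s, hs, h, e⟩ := (Ideal.eq_top_iff_one _).1 h
    have : s = a := hg (by simpa using e)
    subst this
    rcases h with h | h
    · exact hs h
    · exact lt_irrefl _ h
  obtain ⟨W, hW, hW'⟩ := Ideal.image_subset_nonunits_valuationSubring _ hne
  refine ⟨W, fun c => ?_, fun α β h => ?_⟩
  · rw [W.valuation_le_one_iff]
    exact hW ⟨C c, 1, one_ne_zero, by simp [o.degree_C], by simp⟩
  · have hβ : g (monomial β 1) ≠ 0 := by
      rw [map_ne_zero_iff _ hg]; simp
    have hlt : o.degree (monomial α (1 : K)) ≺[o] o.degree (monomial β (1 : K)) := by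
      simpa [o.degree_monomial] using h
    have e : g (monomial α 1) / g (monomial β 1) * g (monomial β 1) = g (monomial α 1) :=
      div_mul_cancel₀ _ hβ
    have hm : g (monomial α 1) / g (monomial β 1) ∈ o.fractionSubring g :=
      ⟨_, _, by simp, hlt.le, e⟩
    have : g (monomial α 1) / g (monomial β 1) ∈ W.nonunits :=
      hW' ⟨⟨_, hm⟩, ⟨_, _, by simp, Or.inr hlt, e⟩, rfl⟩
    rw [ValuationSubring.mem_nonunits_iff, map_div₀] at this
    rwa [div_lt_one₀ (zero_lt_iff.2 (by simpa using hβ))] at this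

/-- Constants have value at most one, and so do their inverses, hence exactly one. Distinctness on
monomials needs the totality of the lexicographic order. -/
theorem exists_valuation_monomial_injective {m : ℕ} {B : Type u} [CommRing B] [IsDomain B]
    [Algebra K B] (g : MvPolynomial (Fin m) K →ₐ[K] B) (hg : Function.Injective g) :
    ∃ (Γ : Type u) (_ : LinearOrderedCommGroupWithZero Γ) (w : Valuation B Γ),
      (∀ b, w b = 0 ↔ b = 0) ∧ (∀ c : K, c ≠ 0 → w (algebraMap K B c) = 1) ∧
      Function.Injective fun α => w (g (monomial α 1)) := by
  have hi := FaithfulSMul.algebraMap_injective B (FractionRing B)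
  obtain ⟨W, hW, hW'⟩ := MonomialOrder.lex.exists_valuationSubring
    ((algebraMap B (FractionRing B)).comp g.toRingHom) (hi.comp hg)
  refine ⟨W.ValueGroup, inferInstance, W.valuation.comap (algebraMap B (FractionRing B)),
    fun b => ?_, fun c hc => ?_, fun α β h => ?_⟩
  · simp
  · have h1 : ∀ c : K, W.valuation.comap (algebraMap B (FractionRing B)) (algebraMap K B c) ≤ 1 := by
      intro c
      have := hW c
      simpa [← MvPolynomial.algebraMap_eq] using this
    refine le_antisymm (h1 c) ?_
    by_contra hlt
    have h2 := mul_lt_mul'' (not_le.1 hlt) ((h1 c⁻¹).lt_or_eq.resolve_right ?_) zero_le zero_le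
    · rw [← map_mul, ← map_mul, mul_inv_cancel₀ hc] at h2
      simp at h2
    · intro h2
      have := congrArg (W.valuation.comap (algebraMap B (FractionRing B)))
        (congrArg (algebraMap K B) (mul_inv_cancel₀ hc))
      rw [map_mul, map_mul, h2, mul_one, map_one, map_one] at this
      exact hlt this.ge
  · by_contra hne
    rcases lt_trichotomy (MonomialOrder.lex.toSyn α) (MonomialOrder.lex.toSyn β) with h1 | h1 | h1
    · exact (hW' _ _ h1).ne h
    · exact hne (MonomialOrder.lex.toSyn.injective h1)
    · exact (hW' _ _ h1).ne' h

/-- A subspace all of whose nonzero elements have the same value. -/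
def Valuation.IsPureOn {B Γ : Type*} [CommRing B] [Algebra K B]
    [LinearOrderedCommGroupWithZero Γ] (w : Valuation B Γ) (C : Submodule K B) (γ : Γ) : Prop :=
  ∀ b ∈ C, b ≠ 0 → w b = γ

section

variable {m : ℕ} {B Γ : Type*} [CommRing B] [Algebra K B]
  [LinearOrderedCommGroupWithZero Γ] {w : Valuation B Γ}
  {g : MvPolynomial (Fin m) K →ₐ[K] B}

/-- Distinct monomials have distinct values and nonzero scalars have value one, so the largest term
of a polynomial is unique and cannot be cancelled. -/
theorem Valuation.exists_leading_monomial (hK : ∀ c : K, c ≠ 0 → w (algebraMap K B c) = 1)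
    (hinj : Function.Injective fun α => w (g (monomial α 1)))
    {a : MvPolynomial (Fin m) K} (ha : a ≠ 0) :
    ∃ α ∈ a.support, w (g a) = w (g (monomial α 1)) ∧
      ∀ β ∈ a.support, β ≠ α → w (g (monomial β 1)) < w (g (monomial α 1)) := by
  classical
  obtain ⟨α, hα, hmax⟩ := a.support.exists_max_image (fun α => w (g (monomial α 1)))
    (by simpa [Finset.nonempty_iff_ne_empty] using ha)
  have hlt : ∀ β ∈ a.support, β ≠ α → w (g (monomial β 1)) < w (g (monomial α 1)) :=
    fun β hβ hne => lt_of_le_of_ne (hmax β hβ) fun h => hne (hinj h)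
  have hc : ∀ β ∈ a.support, w (g (monomial β (a.coeff β))) = w (g (monomial β 1)) := by
    intro β hβ
    rw [show monomial β (a.coeff β) = C (a.coeff β) * monomial β 1 by simp [C_mul_monomial],
      map_mul, map_mul, ← MvPolynomial.algebraMap_eq, AlgHom.commutes,
      hK _ (mem_support_iff.1 hβ), one_mul]
  refine ⟨α, hα, ?_, hlt⟩
  conv_lhs => rw [a.as_sum, map_sum]
  rw [Valuation.map_sum_eq_of_lt w hα, hc α hα]
  intro β hβ
  simp only [Finset.mem_sdiff, Finset.mem_singleton] at hβ
  rw [hc α hα, hc β hβ.1]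
  exact hlt β hβ.1 hβ.2

/-- In a relation with polynomial coefficients, let `α` be the leading monomial of a coefficient of
largest value. Collecting the `α`-terms gives that monomial times a nonzero `K`-combination of the
`b i`; the combination lies in `C`, so the product has value exactly `μ * γ`. All remaining terms
have strictly smaller value, so the sum cannot vanish. -/
theorem Valuation.linearIndependent_of_isPureOn
    (hw : ∀ b, w b = 0 ↔ b = 0) (hK : ∀ c : K, c ≠ 0 → w (algebraMap K B c) = 1)
    (hinj : Function.Injective fun α => w (g (monomial α 1))) (hg : Function.Injective g)
    {C : Submodule K B} {γ : Γ} (hC : w.IsPureOn C γ) {ι : Type*} [Fintype ι] {b : ι → B}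
    (hb : LinearIndependent K b) (hbC : ∀ i, b i ∈ C) {a : ι → MvPolynomial (Fin m) K}
    (ha : ∑ i, g (a i) * b i = 0) (i : ι) : a i = 0 := by
  classical
  by_contra hne
  have hγ0 : ∀ j, w (b j) = γ := fun j => hC _ (hbC j) (hb.ne_zero j)
  obtain ⟨i₀, hi₀, hmax⟩ := (Finset.univ.filter fun i => a i ≠ 0).exists_max_image
    (fun i => w (g (a i))) ⟨i, by simpa using hne⟩
  simp only [Finset.mem_filter, Finset.mem_univ, true_and] at hi₀ hmax
  obtain ⟨α, hα, hwα, -⟩ := exists_leading_monomial hK hinj hi₀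
  set μ := w (g (monomial α 1)) with hμ
  have hμ0 : μ ≠ 0 := by
    rw [hμ, Ne, hw, map_eq_zero_iff _ hg]; simp
  have hrest : ∀ j, w (g (a j - monomial α ((a j).coeff α)) * b j) < μ * γ := by
    intro j
    rw [map_mul, hγ0 j]
    have hγ : γ ≠ 0 := by rw [← hγ0 j, Ne, hw]; exact hb.ne_zero j
    refine mul_lt_mul_of_pos_right ?_ (zero_lt_iff.2 hγ)
    by_cases hj : a j - monomial α ((a j).coeff α) = 0
    · rw [hj]; simpa using zero_lt_iff.2 hμ0
    obtain ⟨β, hβ, hwβ, -⟩ := exists_leading_monomial hK hinj hj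
    have hβα : β ≠ α := by
      rintro rfl
      simp at hβ
    have hβj : β ∈ (a j).support := by
      rw [mem_support_iff, coeff_sub, coeff_monomial, if_neg hβα.symm, sub_zero] at hβ
      exact mem_support_iff.2 hβ
    have haj : a j ≠ 0 := by rintro h; simp [h] at hβj
    obtain ⟨δ, hδ, hwδ, hδ'⟩ := exists_leading_monomial hK hinj haj
    rw [hwβ]
    -- After deletion of its `α`-term, the polynomial has a leading monomial `β ≠ α`; injectivity on
    -- monomials makes the inequality strict.
    refine lt_of_le_of_ne (le_trans ?_ ((hmax j haj).trans hwα.le)) fun h => hβα (hinj h)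
    rw [hwδ]
    by_cases h : β = δ
    · rw [h]
    · exact (hδ' β hβj h).le
  have hsum : w (∑ j, g (a j - monomial α ((a j).coeff α)) * b j) < μ * γ :=
    w.map_sum_lt (mul_ne_zero hμ0 (by rw [← hγ0 i, Ne, hw]; exact hb.ne_zero i)) fun j _ => hrest j
  have hsplit : ∑ j, g (a j - monomial α ((a j).coeff α)) * b j =
      -(g (monomial α 1) * ∑ j, (a j).coeff α • b j) := by
    rw [Finset.mul_sum, eq_neg_iff_add_eq_zero, ← Finset.sum_add_distrib, ← ha]
    refine Finset.sum_congr rfl fun j _ => ?_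
    rw [_root_.map_sub, show monomial α ((a j).coeff α) = MvPolynomial.C ((a j).coeff α) * monomial α 1 by
      simp [C_mul_monomial], map_mul, ← MvPolynomial.algebraMap_eq, AlgHom.commutes,
      Algebra.smul_def]
    ring
  rw [hsplit, Valuation.map_neg, map_mul, hC _ (C.sum_mem fun j _ => C.smul_mem _ (hbC j))] at hsum
  · exact lt_irrefl _ hsum
  · intro h0
    exact mem_support_iff.1 hα (Fintype.linearIndependent_iff.1 hb _ h0 i₀)

theorem Valuation.exists_finrank_le_of_isPureOn
    (hw : ∀ b, w b = 0 ↔ b = 0) (hK : ∀ c : K, c ≠ 0 → w (algebraMap K B c) = 1)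
    (hinj : Function.Injective fun α => w (g (monomial α 1))) (hg : Function.Injective g)
    (hfin : g.Finite) :
    ∃ r : ℕ, ∀ (C : Submodule K B) (γ : Γ), w.IsPureOn C γ → Module.finrank K C ≤ r := by
  let _ := g.toRingHom.toAlgebra
  have : Module.Finite (MvPolynomial (Fin m) K) B := hfin
  refine ⟨Module.finrank (MvPolynomial (Fin m) K) B, fun C γ hC => ?_⟩
  by_cases hfd : Module.Finite K C
  swap
  · rw [Module.finrank_of_not_finite hfd]; exact Nat.zero_le _
  have hli : LinearIndependent K fun i => (Module.finBasis K C i : B) :=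
    (Module.finBasis K C).linearIndependent.map' C.subtype (Submodule.ker_subtype C)
  have := LinearIndependent.fintype_card_le_finrank (R := MvPolynomial (Fin m) K)
    (b := fun i => (Module.finBasis K C i : B)) ?_
  · simpa using this
  · rw [Fintype.linearIndependent_iff]
    intro a ha i
    exact linearIndependent_of_isPureOn hw hK hinj hg hC hli (fun i => (Module.finBasis K C i).2)
      (by simp only [Algebra.smul_def] at ha; exact ha) i

end

end MonomialValuation

/-! ### Integral equations with coefficients of controlled degree -/

section IntegralEquations

open MvPolynomial

variable {K : Type*} [Field K] {σ : Type*}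

theorem Polynomial.totalDegree_coeff_mul_le {p q : Polynomial (MvPolynomial σ K)} {D E : ℕ}
    (hp : ∀ k, (p.coeff k).totalDegree ≤ D) (hq : ∀ k, (q.coeff k).totalDegree ≤ E) (k : ℕ) :
    ((p * q).coeff k).totalDegree ≤ D + E := by
  rw [Polynomial.coeff_mul]
  exact totalDegree_finsetSum_le fun i _ =>
    (totalDegree_mul _ _).trans (add_le_add (hp _) (hq _))

theorem Polynomial.totalDegree_coeff_prod_le {ι : Type*} (s : Finset ι)
    {p : ι → Polynomial (MvPolynomial σ K)} {D : ℕ}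
    (hp : ∀ i k, ((p i).coeff k).totalDegree ≤ D) (k : ℕ) :
    ((∏ i ∈ s, p i).coeff k).totalDegree ≤ s.card * D := by
  classical
  induction s using Finset.induction_on generalizing k with
  | empty =>
    rw [Finset.prod_empty, Polynomial.coeff_one]
    split_ifs <;> simp
  | insert a s ha ih =>
    rw [Finset.prod_insert ha, Finset.card_insert_of_notMem ha, add_mul, one_mul, add_comm]
    exact Polynomial.totalDegree_coeff_mul_le (hp a) ih k

theorem Matrix.totalDegree_charpoly_coeff_le {ι : Type*} [Fintype ι] [DecidableEq ι]
    {M : Matrix ι ι (MvPolynomial σ K)} {D : ℕ} (hM : ∀ i j, (M i j).totalDegree ≤ D) (k : ℕ) :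
    (M.charpoly.coeff k).totalDegree ≤ Fintype.card ι * D := by
  have hX : ∀ i j k, ((M.charmatrix i j).coeff k).totalDegree ≤ D := by
    intro i j k
    by_cases h : i = j
    · subst h
      rw [Matrix.charmatrix_apply_eq, Polynomial.coeff_sub, Polynomial.coeff_X,
        Polynomial.coeff_C]
      refine (totalDegree_sub _ _).trans (max_le ?_ ?_)
      · split_ifs <;> simp
      · split_ifs <;> simp [hM]
    · rw [Matrix.charmatrix_apply_ne _ _ _ h, Polynomial.coeff_neg, Polynomial.coeff_C,
        totalDegree_neg]
      split_ifs <;> simp [hM]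
  rw [Matrix.charpoly, Matrix.det_apply, Polynomial.finsetSum_coeff]
  refine totalDegree_finsetSum_le fun τ _ => ?_
  have h := Polynomial.totalDegree_coeff_prod_le Finset.univ
    (p := fun i => M.charmatrix (τ i) i) (fun i k => hX _ _ k) k
  rw [Polynomial.coeff_smul]
  rcases Int.units_eq_one_or (Equiv.Perm.sign τ) with h1 | h1 <;> rw [h1]
  · simpa using h
  · simpa using h

variable {B : Type*} [CommRing B] [Algebra K B] [Algebra (MvPolynomial σ K) B]
  [IsScalarTower K (MvPolynomial σ K) B]

/-- The elements of `B` whose multiplication is represented, on the generators `e`, by a matrix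
with entries of total degree at most `D`. -/
def representedDegreeLE {r : ℕ} (e : Fin r → B) (D : ℕ) : Submodule K B where
  carrier := {b | ∃ M : Matrix (Fin r) (Fin r) (MvPolynomial σ K),
    M.Represents e (Algebra.lmul (MvPolynomial σ K) B b) ∧ ∀ i j, (M i j).totalDegree ≤ D}
  add_mem' := by
    rintro b b' ⟨M, hM, hD⟩ ⟨M', hM', hD'⟩
    refine ⟨M + M', by rw [map_add]; exact hM.add hM', fun i j => ?_⟩
    exact (totalDegree_add _ _).trans (max_le (hD i j) (hD' i j))
  zero_mem' := ⟨0, by rw [map_zero]; exact Matrix.Represents.zero, by simp⟩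
  smul_mem' := by
    rintro c b ⟨M, hM, hD⟩
    refine ⟨(C c : MvPolynomial σ K) • M, ?_, fun i j => ?_⟩
    · have : c • b = (C c : MvPolynomial σ K) • b := by
        rw [← MvPolynomial.algebraMap_eq, algebraMap_smul]
      rw [this, map_smul]
      exact hM.smul _
    · rw [Matrix.smul_apply, smul_eq_mul]
      refine (totalDegree_mul _ _).trans ?_
      simpa using hD i j

theorem representedDegreeLE_mul {r : ℕ} (e : Fin r → B) (D E : ℕ) :
    representedDegreeLE (K := K) (σ := σ) e D * representedDegreeLE (K := K) (σ := σ) e E ≤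
      representedDegreeLE (K := K) (σ := σ) e (D + E) := by
  rw [Submodule.mul_le]
  rintro b ⟨M, hM, hD⟩ b' ⟨M', hM', hD'⟩
  refine ⟨M * M', by rw [map_mul]; exact hM.mul hM', fun i j => ?_⟩
  rw [Matrix.mul_apply]
  exact totalDegree_finsetSum_le fun k _ =>
    (totalDegree_mul _ _).trans (add_le_add (hD _ _) (hD' _ _))

theorem representedDegreeLE_mono {r : ℕ} (e : Fin r → B) {D E : ℕ} (h : D ≤ E) :
    representedDegreeLE (K := K) (σ := σ) e D ≤ representedDegreeLE (K := K) (σ := σ) e E := by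
  rintro b ⟨M, hM, hD⟩
  exact ⟨M, hM, fun i j => (hD i j).trans h⟩

theorem one_le_representedDegreeLE {r : ℕ} (e : Fin r → B) :
    1 ≤ representedDegreeLE (K := K) (σ := σ) e 0 := by
  rw [Submodule.one_le]
  refine ⟨1, by rw [map_one]; exact Matrix.Represents.one, fun i j => ?_⟩
  rw [Matrix.one_apply]
  split_ifs <;> simp

theorem exists_mem_representedDegreeLE {r : ℕ} {e : Fin r → B}
    (he : Submodule.span (MvPolynomial σ K) (Set.range e) = ⊤) (b : B) :
    ∃ D, b ∈ representedDegreeLE (K := K) (σ := σ) e D := by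
  obtain ⟨M, hM⟩ := Matrix.isRepresentation.toEnd_surjective (MvPolynomial σ K) e he
    (Algebra.lmul (MvPolynomial σ K) B b)
  have h := Matrix.isRepresentation.toEnd_represents (MvPolynomial σ K) e he M
  rw [hM] at h
  exact ⟨Finset.univ.sup fun p : Fin r × Fin r => (M.1 p.1 p.2).totalDegree, M.1, h, fun i j =>
    Finset.le_sup (f := fun p : Fin r × Fin r => (M.1 p.1 p.2).totalDegree)
      (Finset.mem_univ (i, j))⟩

/-- The characteristic polynomial of a matrix representing multiplication by `b` annihilates `b`,
and its coefficients are sums of products of at most `r` entries. -/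
theorem exists_monic_totalDegree_coeff_le_of_mem_representedDegreeLE {r : ℕ} {e : Fin r → B}
    (he : Submodule.span (MvPolynomial σ K) (Set.range e) = ⊤) {D : ℕ} {b : B}
    (hb : b ∈ representedDegreeLE (K := K) (σ := σ) e D) :
    ∃ p : Polynomial (MvPolynomial σ K), p.Monic ∧ p.natDegree ≤ r ∧
      (∀ k, (p.coeff k).totalDegree ≤ r * D) ∧ Polynomial.aeval b p = 0 := by
  obtain ⟨M, hM, hD⟩ := hb
  refine ⟨M.charpoly, M.charpoly_monic, ?_, fun k => ?_, ?_⟩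
  · nontriviality (MvPolynomial σ K)
    simp [Matrix.charpoly_natDegree_eq_dim]
  · simpa using Matrix.totalDegree_charpoly_coeff_le hD k
  · let M' : Matrix.isRepresentation (MvPolynomial σ K) e := ⟨M, _, hM⟩
    have h1 := Matrix.isRepresentation.eq_toEnd_of_represents (MvPolynomial σ K) e he M' hM
    have h2 : Polynomial.aeval M' M.charpoly = 0 := by
      apply Subtype.ext
      have := Polynomial.aeval_algHom_apply (Matrix.isRepresentation (MvPolynomial σ K) e).val
        M' M.charpoly
      rw [Subalgebra.coe_val] at this
      rw [← this]
      exact M.aeval_self_charpoly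
    have h3 := congrArg (Matrix.isRepresentation.toEnd (MvPolynomial σ K) e he) h2
    rw [← Polynomial.aeval_algHom_apply, h1, Polynomial.aeval_algHom_apply, map_zero] at h3
    simpa using congrArg (fun f : Module.End (MvPolynomial σ K) B => f 1) h3

/-- Matrix degrees add under multiplication, so elements of `V ^ n` are represented by matrices of
degree linear in `n`. The bound `r` on the degree of the equation is the number of module generators
and does not depend on `b` or `n`; this lets one exponent serve all elements later. -/
theorem exists_monic_totalDegree_coeff_le [Module.Finite (MvPolynomial σ K) B]
    {V : Submodule K B} (hV : V.FG) :
    ∃ r c : ℕ, (∀ b : B, ∃ p : Polynomial (MvPolynomial σ K), p.Monic ∧ p.natDegree ≤ r ∧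
      Polynomial.aeval b p = 0) ∧ ∀ n : ℕ, ∀ b ∈ V ^ n, ∃ p : Polynomial (MvPolynomial σ K), p.Monic ∧
      p.natDegree ≤ r ∧ (∀ k, (p.coeff k).totalDegree ≤ c * n) ∧ Polynomial.aeval b p = 0 := by
  obtain ⟨r, e, he⟩ := Module.Finite.exists_fin (R := MvPolynomial σ K) (M := B)
  obtain ⟨S, rfl⟩ := hV
  choose D hD using exists_mem_representedDegreeLE (K := K) (σ := σ) he
  set d := S.sup D with hd
  have hSd : Submodule.span K (S : Set B) ≤ representedDegreeLE (K := K) (σ := σ) e d := by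
    rw [Submodule.span_le]
    intro s hs
    exact representedDegreeLE_mono e (Finset.le_sup (f := D) hs) (hD s)
  have hpow : ∀ n : ℕ, Submodule.span K (S : Set B) ^ n ≤
      representedDegreeLE (K := K) (σ := σ) e (d * n) := by
    intro n
    induction n with
    | zero => simpa using one_le_representedDegreeLE (K := K) (σ := σ) e
    | succ n ih =>
      rw [pow_succ, mul_add, mul_one]
      exact (mul_le_mul' ih hSd).trans (representedDegreeLE_mul e _ _)
  refine ⟨r, r * d, fun b => ?_, fun n b hb => ?_⟩
  · obtain ⟨p, h1, h2, -, h3⟩ :=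
      exists_monic_totalDegree_coeff_le_of_mem_representedDegreeLE he (hD b)
    exact ⟨p, h1, h2, h3⟩
  rw [mul_assoc]
  exact exists_monic_totalDegree_coeff_le_of_mem_representedDegreeLE he (hpow n hb)

end IntegralEquations

/-! ### From values to integral vectors -/

section ValueIndex

open MvPolynomial

variable {K : Type*} [Field K] {m : ℕ} {B Γ : Type*} [CommRing B] [Algebra K B]
  [LinearOrderedCommGroupWithZero Γ] {w : Valuation B Γ}
  {g : MvPolynomial (Fin m) K →ₐ[K] B}

/-- The value of the Laurent monomial with exponent `z`. -/
noncomputable def laurentValue (w : Valuation B Γ) (g : MvPolynomial (Fin m) K →ₐ[K] B)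
    (z : Fin m → ℤ) : Γ :=
  ∏ i, w (g (X i)) ^ z i

theorem laurentValue_natCast (α : Fin m →₀ ℕ) :
    laurentValue w g (fun i => (α i : ℤ)) = w (g (monomial α 1)) := by
  rw [monomial_eq, C_1, one_mul, Finsupp.prod_fintype _ _ (by simp), map_prod, map_prod]
  simp [laurentValue]

section

variable (hX : ∀ i, w (g (X i)) ≠ 0)
include hX

theorem laurentValue_add (z z' : Fin m → ℤ) :
    laurentValue w g (z + z') = laurentValue w g z * laurentValue w g z' := by
  rw [laurentValue, laurentValue, laurentValue, ← Finset.prod_mul_distrib]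
  exact Finset.prod_congr rfl fun i _ => zpow_add₀ (hX i) _ _

theorem laurentValue_ne_zero (z : Fin m → ℤ) : laurentValue w g z ≠ 0 :=
  Finset.prod_ne_zero_iff.2 fun i _ => zpow_ne_zero _ (hX i)

omit hX in
theorem laurentValue_nsmul (n : ℕ) (z : Fin m → ℤ) :
    laurentValue w g (n • z) = laurentValue w g z ^ n := by
  rw [laurentValue, laurentValue, ← Finset.prod_pow]
  refine Finset.prod_congr rfl fun i _ => ?_
  rw [Pi.smul_apply, nsmul_eq_mul, mul_comm, zpow_mul, zpow_natCast]

/-- Clearing negative exponents reduces the claim to injectivity on ordinary monomials. -/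
theorem laurentValue_injective (hinj : Function.Injective fun α => w (g (monomial α 1))) :
    Function.Injective (laurentValue w g) := by
  intro z z' h
  let α : Fin m →₀ ℕ := Finsupp.equivFunOnFinite.symm fun i => (z i).toNat + (-z' i).toNat
  let β : Fin m →₀ ℕ := Finsupp.equivFunOnFinite.symm fun i => (z' i).toNat + (-z i).toNat
  have key : z + (fun i => (β i : ℤ)) = z' + fun i => (α i : ℤ) := by
    funext i
    simp only [α, β, Pi.add_apply, Finsupp.equivFunOnFinite_symm_apply_apply]
    omega
  have h2 := congrArg (laurentValue w g) key
  rw [laurentValue_add hX, laurentValue_add hX, h, laurentValue_natCast, laurentValue_natCast] at h2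
  have h3 : β = α := hinj (mul_left_cancel₀ (laurentValue_ne_zero hX z') h2)
  rw [h3] at key
  exact add_right_cancel key

end

/-- In a vanishing sum the largest value is attained at least twice. Comparing two such terms of the
integral equation expresses `w b ^ (k - j)` as a quotient of values of two leading monomials. -/
theorem exists_pow_eq_laurentValue (hw : ∀ b, w b = 0 ↔ b = 0)
    (hK : ∀ c : K, c ≠ 0 → w (algebraMap K B c) = 1)
    (hinj : Function.Injective fun α => w (g (monomial α 1))) (hg : Function.Injective g)
    {b : B} (hb : b ≠ 0) {p : Polynomial (MvPolynomial (Fin m) K)} (hp : p.Monic)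
    (hpb : p.eval₂ g.toRingHom b = 0) {D : ℕ} (hD : ∀ k, (p.coeff k).totalDegree ≤ D) :
    ∃ k : ℕ, 0 < k ∧ k ≤ p.natDegree ∧ ∃ z : Fin m → ℤ, (∀ i, |z i| ≤ D) ∧
      w b ^ k = laurentValue w g z := by
  classical
  have hX : ∀ i, w (g (X i)) ≠ 0 := fun i => by
    rw [Ne, hw, map_eq_zero_iff _ hg]; exact X_ne_zero i
  have hb0 : w b ≠ 0 := by rwa [Ne, hw]
  have ht0 : ∀ k ∈ p.support, w (g (p.coeff k) * b ^ k) ≠ 0 := by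
    intro k hk
    rw [map_mul, map_pow]
    refine mul_ne_zero ?_ (pow_ne_zero _ hb0)
    rw [Ne, hw, map_eq_zero_iff _ hg]
    exact Polynomial.mem_support_iff.1 hk
  have hsum : ∑ k ∈ p.support, g (p.coeff k) * b ^ k = 0 := by
    rw [Polynomial.eval₂_eq_sum, Polynomial.sum_def] at hpb
    exact hpb
  obtain ⟨k, hk, hmax⟩ := p.support.exists_max_image (fun k => w (g (p.coeff k) * b ^ k))
    (Polynomial.nonempty_support_iff.2 hp.ne_zero)
  obtain ⟨j, hj, hjk, hval⟩ : ∃ j ∈ p.support, j ≠ k ∧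
      w (g (p.coeff j) * b ^ j) = w (g (p.coeff k) * b ^ k) := by
    by_contra! hcon
    have := Valuation.map_sum_eq_of_lt w (f := fun k => g (p.coeff k) * b ^ k) hk (by
      intro i hi
      simp only [Finset.mem_sdiff, Finset.mem_singleton] at hi
      exact lt_of_le_of_ne (hmax i hi.1) (hcon i hi.1 hi.2))
    rw [hsum, map_zero] at this
    exact ht0 k hk this.symm
  have main : ∀ j ∈ p.support, ∀ k ∈ p.support, j < k →
      w (g (p.coeff j) * b ^ j) = w (g (p.coeff k) * b ^ k) →
      ∃ k : ℕ, 0 < k ∧ k ≤ p.natDegree ∧ ∃ z : Fin m → ℤ, (∀ i, |z i| ≤ D) ∧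
      w b ^ k = laurentValue w g z := by
    intro j hj k hk hjk hval
    obtain ⟨α, hα, hwα, -⟩ :=
      Valuation.exists_leading_monomial hK hinj (Polynomial.mem_support_iff.1 hj)
    obtain ⟨β, hβ, hwβ, -⟩ :=
      Valuation.exists_leading_monomial hK hinj (Polynomial.mem_support_iff.1 hk)
    have hle : ∀ (γ : Fin m →₀ ℕ) (l : ℕ), γ ∈ (p.coeff l).support → ∀ i, γ i ≤ D := by
      intro γ l hγ i
      refine le_trans ?_ ((le_totalDegree hγ).trans (hD l))
      by_cases h0 : γ i = 0
      · rw [h0]; exact Nat.zero_le _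
      · exact Finset.single_le_sum (f := γ) (fun _ _ => Nat.zero_le _) (Finsupp.mem_support_iff.2 h0)
    refine ⟨k - j, Nat.sub_pos_of_lt hjk, (Nat.sub_le _ _).trans
      (Polynomial.le_natDegree_of_mem_supp k hk), fun i => (α i : ℤ) - β i, fun i => ?_, ?_⟩
    · have h1 := hle α j hα i
      have h2 := hle β k hβ i
      rw [abs_le]; constructor <;> dsimp only <;> omega
    · rw [map_mul, map_mul, map_pow, map_pow, hwα, hwβ, ← laurentValue_natCast,
        ← laurentValue_natCast] at hval
      have hadd : (fun i => (α i : ℤ)) = (fun i => (α i : ℤ) - β i) + fun i => (β i : ℤ) := by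
        funext i; simp
      rw [hadd, laurentValue_add hX, ← Nat.sub_add_cancel hjk.le, pow_add] at hval
      have hβ0 := laurentValue_ne_zero hX fun i => (β i : ℤ)
      have h4 : (laurentValue w g (fun i => (β i : ℤ)) * w b ^ j) *
          laurentValue w g (fun i => (α i : ℤ) - β i) =
          (laurentValue w g (fun i => (β i : ℤ)) * w b ^ j) * w b ^ (k - j) := by
        rw [mul_comm _ (laurentValue w g (fun i => (α i : ℤ) - β i)), ← mul_assoc, hval]
        simp only [mul_assoc, mul_comm, mul_left_comm]
      exact (mul_left_cancel₀ (mul_ne_zero hβ0 (pow_ne_zero _ hb0)) h4).symm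
  rcases lt_or_gt_of_ne hjk with h | h
  · exact main j hj k hk h hval
  · exact main k hk j hj h hval.symm

/-- Raising to the power `r!` makes the exponent uniform. Injectivity of `laurentValue` makes the
resulting vector unique, hence additive. Nothing is lost, as taking a positive power is injective on
values. -/
theorem exists_additive_index [IsDomain B] (hw : ∀ b, w b = 0 ↔ b = 0)
    (hK : ∀ c : K, c ≠ 0 → w (algebraMap K B c) = 1)
    (hinj : Function.Injective fun α => w (g (monomial α 1))) (hg : Function.Injective g)
    (hfin : g.Finite) {V : Submodule K B} (hV : V.FG) :
    ∃ (φ : B → Fin m → ℤ) (c : ℕ),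
      (∀ b b', b ≠ 0 → b' ≠ 0 → φ (b * b') = φ b + φ b') ∧
      (∀ b b', b ≠ 0 → b' ≠ 0 → (φ b = φ b' ↔ w b = w b')) ∧
      ∀ n : ℕ, ∀ b ∈ V ^ n, b ≠ 0 → ∀ i, |φ b i| ≤ (c * n : ℕ) := by
  classical
  let _ := g.toRingHom.toAlgebra
  have : Module.Finite (MvPolynomial (Fin m) K) B := hfin
  have : IsScalarTower K (MvPolynomial (Fin m) K) B :=
    IsScalarTower.of_algebraMap_eq fun c => (g.commutes c).symm
  have hX : ∀ i, w (g (X i)) ≠ 0 := fun i => by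
    rw [Ne, hw, map_eq_zero_iff _ hg]; exact X_ne_zero i
  obtain ⟨r, c, hall, hbd⟩ := exists_monic_totalDegree_coeff_le (σ := Fin m) hV
  have key : ∀ b : B, b ≠ 0 → ∀ (p : Polynomial (MvPolynomial (Fin m) K)) (D : ℕ), p.Monic →
      p.natDegree ≤ r → (∀ k, (p.coeff k).totalDegree ≤ D) → Polynomial.aeval b p = 0 →
      ∃ z : Fin m → ℤ, (∀ i, |z i| ≤ (r.factorial * D : ℕ)) ∧
        w b ^ r.factorial = laurentValue w g z := by
    intro b hb p D hp hr hD hpb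
    obtain ⟨k, hk0, hk, z, hz, he⟩ := exists_pow_eq_laurentValue hw hK hinj hg hb hp hpb hD
    obtain ⟨q, hq⟩ := Nat.dvd_factorial hk0 (hk.trans hr)
    refine ⟨q • z, fun i => ?_, ?_⟩
    · have hq' : q ≤ r.factorial := by rw [hq]; exact Nat.le_mul_of_pos_left q hk0
      rw [Pi.smul_apply, nsmul_eq_mul, abs_mul, Nat.abs_cast]
      push_cast
      exact mul_le_mul (by exact_mod_cast hq') (hz i) (abs_nonneg _) (by positivity)
    · rw [laurentValue_nsmul, ← he, ← pow_mul, ← hq]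
  have hex : ∀ b : B, ∃ z : Fin m → ℤ, b ≠ 0 → w b ^ r.factorial = laurentValue w g z := by
    intro b
    by_cases hb : b = 0
    · exact ⟨0, fun h => absurd hb h⟩
    obtain ⟨p, hp, hr, hpb⟩ := hall b
    obtain ⟨z, -, hz⟩ := key b hb p (p.support.sup fun k => (p.coeff k).totalDegree) hp hr
      (fun k => by
        by_cases h : k ∈ p.support
        · exact Finset.le_sup (f := fun k => (p.coeff k).totalDegree) h
        · rw [Polynomial.notMem_support_iff.1 h]; simp) hpb
    exact ⟨z, fun _ => hz⟩
  choose φ hφ using hex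
  have hψ := laurentValue_injective hX hinj
  refine ⟨φ, r.factorial * c, fun b b' hb hb' => ?_, fun b b' hb hb' => ?_, fun n b hb hb0 i => ?_⟩
  · apply hψ
    rw [← hφ _ (mul_ne_zero hb hb'), laurentValue_add hX, ← hφ b hb, ← hφ b' hb', map_mul, mul_pow]
  · rw [← hψ.eq_iff, ← hφ b hb, ← hφ b' hb',
      pow_left_inj₀ zero_le zero_le r.factorial_ne_zero]
  · obtain ⟨p, hp, hr, hD, hpb⟩ := hbd n b hb
    obtain ⟨z, hz, he⟩ := key b hb0 p (c * n) hp hr hD hpb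
    have : φ b = z := hψ (by rw [← hφ b hb0, he])
    rw [this, mul_assoc]
    exact hz i

/-- Smith normal form: coordinates on a subgroup of `ℤ ^ m` bounded by the ambient coordinates. -/
theorem exists_bounded_coordinates (Λ : Submodule ℤ (Fin m → ℤ)) :
    ∃ (d : ℕ) (e : Λ ≃+ (Fin d → ℤ)) (c : ℕ), ∀ (z : Λ) (D : ℕ), (∀ i, |z.1 i| ≤ D) →
      ∀ j, |e z j| ≤ (c * D : ℕ) := by
  obtain ⟨d, snf⟩ := Λ.smithNormalForm (Pi.basisFun ℤ (Fin m))
  have h0 : ∀ j, snf.a j ≠ 0 := fun j h => snf.bN.ne_zero j (by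
    apply Subtype.ext
    rw [snf.snf, h]; simp)
  -- Sum of the absolute values of the entries of the relevant change of coordinates, a crude
  -- operator bound.
  let c : ℕ := ∑ j : Fin d, ∑ i : Fin m, (snf.bM.repr (Pi.single i 1) (snf.f j)).natAbs
  refine ⟨d, snf.bN.equivFun.toAddEquiv, c, fun z D hz j => ?_⟩
  have h1 : snf.a j * snf.bN.repr z j = snf.bM.repr z.1 (snf.f j) := by
    have := snf.repr_apply_embedding_eq_repr_smul (m := z) (i := j)
    rw [this, map_smul, Finsupp.smul_apply, smul_eq_mul]
  have h2 : snf.bM.repr z.1 (snf.f j) =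
      ∑ i, z.1 i * snf.bM.repr (Pi.single i 1) (snf.f j) := by
    conv_lhs => rw [← Finset.univ_sum_single z.1, map_sum, Finsupp.finsetSum_apply]
    refine Finset.sum_congr rfl fun i _ => ?_
    rw [show Pi.single i (z.1 i) = z.1 i • Pi.single (M := fun _ => ℤ) i 1 by
      rw [← Pi.single_smul, smul_eq_mul, mul_one], map_smul, Finsupp.smul_apply, smul_eq_mul]
  -- The invariant factor is a nonzero integer, so dividing by it cannot increase the absolute
  -- value.
  have h3 : |snf.bN.repr z j| ≤ |snf.bM.repr z.1 (snf.f j)| := by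
    rw [← h1, abs_mul]
    exact le_mul_of_one_le_left (abs_nonneg _) (Int.one_le_abs (h0 j))
  refine h3.trans ?_
  rw [h2]
  refine (Finset.abs_sum_le_sum_abs _ _).trans ?_
  have h4 : ∑ i, |z.1 i * snf.bM.repr (Pi.single i 1) (snf.f j)| ≤
      ∑ i, (D : ℤ) * (snf.bM.repr (Pi.single i 1) (snf.f j)).natAbs := by
    refine Finset.sum_le_sum fun i _ => ?_
    rw [abs_mul, Int.natCast_natAbs]
    exact mul_le_mul_of_nonneg_right (hz i) (abs_nonneg _)
  refine h4.trans ?_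
  rw [← Finset.mul_sum, mul_comm c D]
  rw [Nat.cast_mul, ← Nat.cast_sum]
  refine mul_le_mul_of_nonneg_left (Nat.cast_le.2 ?_) (by positivity)
  exact Finset.single_le_sum
    (f := fun j : Fin d => ∑ i : Fin m, (snf.bM.repr (Pi.single i 1) (snf.f j)).natAbs)
    (fun _ _ => Nat.zero_le _) (Finset.mem_univ j)

end ValueIndex

/-! ### Graded algebras generated in degree one -/

section GradedGeneration

variable {K B : Type*} [Field K] [CommRing B] [Algebra K B]
  (𝓑 : ℕ → Submodule K B) [GradedAlgebra 𝓑]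

theorem pow_le_graded {V : Submodule K B} (hV : V ≤ 𝓑 1) (n : ℕ) : V ^ n ≤ 𝓑 n := by
  induction n with
  | zero => simpa [Submodule.one_le] using SetLike.GradedOne.one_mem
  | succ n ih =>
    rw [pow_succ, Submodule.mul_le]
    exact fun a ha b hb => SetLike.mul_mem_graded (ih ha) (hV hb)

/-- The subspace of elements whose `n`-th component belongs to `V ^ n`. -/
def componentsInPow (V : Submodule K B) : Submodule K B where
  carrier := {b | ∀ n, (DirectSum.decompose 𝓑 b n : B) ∈ V ^ n}
  add_mem' := fun {a b} ha hb n => by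
    rw [DirectSum.decompose_add]
    exact (V ^ n).add_mem (ha n) (hb n)
  zero_mem' := fun n => by simp
  smul_mem' := fun c a ha n => by
    rw [DirectSum.decompose_smul]
    exact (V ^ n).smul_mem c (ha n)

theorem pow_le_componentsInPow {V : Submodule K B} (hV : V ≤ 𝓑 1) (n : ℕ) :
    V ^ n ≤ componentsInPow 𝓑 V := by
  intro b hb k
  by_cases h : n = k
  · subst h
    rwa [DirectSum.decompose_of_mem_same 𝓑 (pow_le_graded 𝓑 hV n hb)]
  · rw [DirectSum.decompose_of_mem_ne 𝓑 (pow_le_graded 𝓑 hV n hb) h]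
    exact zero_mem _

/-- The elements all of whose components lie in the corresponding powers of `V` are stable under
sums and products and contain `V` and the scalars, so they exhaust the algebra. -/
theorem graded_eq_pow {V : Submodule K B} (hV : V ≤ 𝓑 1)
    (hgen : Algebra.adjoin K (V : Set B) = ⊤) (n : ℕ) : 𝓑 n = V ^ n := by
  classical
  refine le_antisymm (fun b hb => ?_) (pow_le_graded 𝓑 hV n)
  have key : b ∈ componentsInPow 𝓑 V := by
    clear hb
    have hb' : b ∈ Algebra.adjoin K (V : Set B) := hgen ▸ Algebra.mem_top
    induction hb' using Algebra.adjoin_induction with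
    | mem x hx => exact pow_le_componentsInPow 𝓑 hV 1 (by simpa using hx)
    | algebraMap r =>
      exact pow_le_componentsInPow 𝓑 hV 0 (by simp)
    | add x y _ _ hx hy => exact add_mem hx hy
    | mul x y _ _ hx hy =>
      rw [← DirectSum.sum_support_decompose 𝓑 x, ← DirectSum.sum_support_decompose 𝓑 y,
        Finset.sum_mul_sum]
      refine sum_mem fun i _ => sum_mem fun j _ => pow_le_componentsInPow 𝓑 hV (i + j) ?_
      rw [pow_add]
      exact Submodule.mul_mem_mul (hx i) (hy j)
  have := key n
  rwa [DirectSum.decompose_of_mem_same 𝓑 hb] at this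

theorem Algebra.exists_finset_subset_mem_adjoin {s : Set B} {b : B} (hb : b ∈ Algebra.adjoin K s) :
    ∃ u : Finset B, (u : Set B) ⊆ s ∧ b ∈ Algebra.adjoin K (u : Set B) := by
  classical
  induction hb using Algebra.adjoin_induction with
  | mem x hx => exact ⟨{x}, by simpa using hx, Algebra.subset_adjoin (by simp)⟩
  | algebraMap r => exact ⟨∅, by simp, algebraMap_mem _ r⟩
  | add x y _ _ hx hy =>
    obtain ⟨u, hu, hxu⟩ := hx
    obtain ⟨v, hv, hyv⟩ := hy
    exact ⟨u ∪ v, by simp [hu, hv], add_mem (Algebra.adjoin_mono (by simp) hxu)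
      (Algebra.adjoin_mono (by simp) hyv)⟩
  | mul x y _ _ hx hy =>
    obtain ⟨u, hu, hxu⟩ := hx
    obtain ⟨v, hv, hyv⟩ := hy
    exact ⟨u ∪ v, by simp [hu, hv], mul_mem (Algebra.adjoin_mono (by simp) hxu)
      (Algebra.adjoin_mono (by simp) hyv)⟩

/-- Finitely many elements of `𝓑 1` already generate the algebra. Their span may be used as `V` in
`graded_eq_pow`, and degree one then equals this span. -/
theorem fg_graded_one (hft : Algebra.FiniteType K B)
    (hgen : Algebra.adjoin K (𝓑 1 : Set B) = ⊤) : (𝓑 1).FG := by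
  classical
  obtain ⟨t, ht⟩ := hft.out
  have h : ∀ b : B, ∃ u : Finset B, (u : Set B) ⊆ 𝓑 1 ∧ b ∈ Algebra.adjoin K (u : Set B) :=
    fun b => Algebra.exists_finset_subset_mem_adjoin (hgen ▸ Algebra.mem_top)
  choose u hu hbu using h
  have hle : Submodule.span K ((t.biUnion u : Finset B) : Set B) ≤ 𝓑 1 := by
    rw [Submodule.span_le]
    intro x hx
    simp only [Finset.coe_biUnion, Set.mem_iUnion] at hx
    obtain ⟨b, _, hx⟩ := hx
    exact hu b hx
  have hadj : Algebra.adjoin K (Submodule.span K ((t.biUnion u : Finset B) : Set B) : Set B) = ⊤ := by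
    rw [eq_top_iff, ← ht, Algebra.adjoin_le_iff]
    intro b hb
    refine Algebra.adjoin_mono ?_ (hbu b)
    exact (Finset.coe_subset.2 (Finset.subset_biUnion_of_mem u hb)).trans Submodule.subset_span
  have := graded_eq_pow 𝓑 hle hadj 1
  rw [pow_one] at this
  rw [this]
  exact ⟨_, rfl⟩

theorem finite_graded (hft : Algebra.FiniteType K B)
    (hgen : Algebra.adjoin K (𝓑 1 : Set B) = ⊤) (n : ℕ) : Module.Finite K (𝓑 n) := by
  rw [Module.Finite.iff_fg, graded_eq_pow 𝓑 le_rfl hgen n]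
  exact (fg_graded_one 𝓑 hft hgen).pow n

end GradedGeneration

/-! ### Dimension against number of values -/

section PureSubspaces

variable {K B Γ : Type*} [Field K] [CommRing B] [Algebra K B]
  [LinearOrderedCommGroupWithZero Γ] {w : Valuation B Γ}

namespace Valuation

/-- The set of values of the nonzero elements of a subspace. -/
def valuesOn (w : Valuation B Γ) (W : Submodule K B) : Set Γ := w '' {b | b ∈ W ∧ b ≠ 0}

theorem isPureOn_span_singleton (hK : ∀ c : K, c ≠ 0 → w (algebraMap K B c) = 1) (b : B) :
    w.IsPureOn (Submodule.span K {b}) (w b) := by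
  intro x hx hx0
  obtain ⟨c, rfl⟩ := Submodule.mem_span_singleton.1 hx
  have hc : c ≠ 0 := by rintro rfl; simp at hx0
  rw [Algebra.smul_def, map_mul, hK c hc, one_mul]

/-- The elements of a subspace with value smaller than a given one. -/
def ltSubspace (w : Valuation B Γ) (hK : ∀ c : K, c ≠ 0 → w (algebraMap K B c) = 1)
    (W : Submodule K B) {γ : Γ} (hγ : γ ≠ 0) : Submodule K B where
  carrier := {b | b ∈ W ∧ w b < γ}
  add_mem' := fun ha hb => ⟨W.add_mem ha.1 hb.1, w.map_add_lt ha.2 hb.2⟩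
  zero_mem' := ⟨W.zero_mem, by simpa using zero_lt_iff.2 hγ⟩
  smul_mem' := fun c b hb => ⟨W.smul_mem c hb.1, by
    by_cases hc : c = 0
    · simpa [hc] using zero_lt_iff.2 hγ
    · rw [Algebra.smul_def, map_mul, hK c hc, one_mul]; exact hb.2⟩

/-- Subspaces of constant value, for distinct values, are in direct sum: adding the one of largest
value, that value dominates and does not occur in the earlier sum. -/
theorem mul_card_le_finrank [IsDomain B] {W : Submodule K B} [Module.Finite K W] {E : ℕ}
    (T : Finset Γ)
    (hT : ∀ γ ∈ T, ∃ C ≤ W, w.IsPureOn C γ ∧ E ≤ Module.finrank K C) :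
    E * T.card ≤ Module.finrank K W := by
  classical
  suffices h : ∃ U ≤ W, (∀ b ∈ U, b ≠ 0 → w b ∈ T) ∧ E * T.card ≤ Module.finrank K U by
    obtain ⟨U, hU, -, h⟩ := h
    exact h.trans (Submodule.finrank_mono hU)
  induction T using Finset.induction_on_max with
  | empty => exact ⟨⊥, bot_le, by simp, by simp⟩
  | insert γ T hmax ih =>
    obtain ⟨U, hU, hUT, hUE⟩ := ih fun δ hδ => hT δ (Finset.mem_insert_of_mem hδ)
    obtain ⟨C, hC, hCγ, hCE⟩ := hT γ (Finset.mem_insert_self _ _)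
    have : Module.Finite K U := Submodule.finiteDimensional_of_le hU
    have : Module.Finite K C := Submodule.finiteDimensional_of_le hC
    refine ⟨U ⊔ C, sup_le hU hC, ?_, ?_⟩
    · intro b hb hb0
      obtain ⟨u, hu, c, hc, rfl⟩ := Submodule.mem_sup.1 hb
      by_cases hc0 : c = 0
      · subst hc0
        rw [add_zero] at hb0 ⊢
        exact Finset.mem_insert_of_mem (hUT u hu hb0)
      · by_cases hu0 : u = 0
        · subst hu0
          rw [zero_add, hCγ c hc hc0]
          exact Finset.mem_insert_self _ _
        · have hlt : w u < w c := by
            rw [hCγ c hc hc0]; exact hmax _ (hUT u hu hu0)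
          rw [w.map_add_eq_of_lt_right hlt, hCγ c hc hc0]
          exact Finset.mem_insert_self _ _
    · have hinf : U ⊓ C = ⊥ := by
        rw [eq_bot_iff]
        rintro b ⟨hbU, hbC⟩
        by_contra hb0
        exact (hmax _ (hUT b hbU hb0)).ne (hCγ b hbC hb0)
      have := Submodule.finrank_sup_add_finrank_inf_eq U C
      rw [hinf, finrank_bot, add_zero] at this
      rw [this, Finset.card_insert_of_notMem fun h => lt_irrefl _ (hmax γ h), mul_add, mul_one]
      exact add_le_add hUE hCE

theorem finite_valuesOn [IsDomain B] (hK : ∀ c : K, c ≠ 0 → w (algebraMap K B c) = 1)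
    (W : Submodule K B) [Module.Finite K W] : (w.valuesOn W).Finite := by
  by_contra hinf
  obtain ⟨T, hT, hcard⟩ := Set.Infinite.exists_subset_card_eq hinf (Module.finrank K W + 1)
  have := mul_card_le_finrank (w := w) (W := W) (E := 1) T (fun γ hγ => by
    obtain ⟨b, ⟨hb, hb0⟩, rfl⟩ := hT hγ
    refine ⟨Submodule.span K {b}, ?_, isPureOn_span_singleton hK b, (finrank_span_singleton hb0).ge⟩
    simpa [Submodule.span_le] using hb)
  omega

/-- The largest value is peeled off. A complement of the elements of smaller value has constant
value `γ`, so it accounts for at most `E` dimensions. -/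
theorem finrank_le_mul_card (hw : ∀ b, w b = 0 ↔ b = 0)
    (hK : ∀ c : K, c ≠ 0 → w (algebraMap K B c) = 1) {E : ℕ}
    (T : Finset Γ) (W : Submodule K B) [Module.Finite K W]
    (hE : ∀ C ≤ W, ∀ γ, w.IsPureOn C γ → Module.finrank K C ≤ E)
    (hT : ∀ b ∈ W, b ≠ 0 → w b ∈ T) : Module.finrank K W ≤ E * T.card := by
  classical
  induction T using Finset.induction_on_max generalizing W with
  | empty =>
    have : W = ⊥ := by
      rw [eq_bot_iff]
      intro b hb
      by_contra hb0
      simpa using hT b hb hb0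
    simp [this]
  | insert γ T hmax ih =>
    rw [Finset.card_insert_of_notMem fun h => lt_irrefl _ (hmax γ h), mul_add, mul_one]
    by_cases hγ : γ = 0
    · refine (ih W hE fun b hb hb0 => ?_).trans (Nat.le_add_right _ _)
      refine (Finset.mem_insert.1 (hT b hb hb0)).resolve_left fun h => ?_
      rw [hγ, hw] at h
      exact hb0 h
    set W' := w.ltSubspace hK W hγ with hW'
    have hle : W' ≤ W := fun b hb => hb.1
    obtain ⟨C', hC'⟩ := Submodule.exists_isCompl (W'.submoduleOf W)
    have : Module.Finite K W' := Submodule.finiteDimensional_of_le hle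
    have h1 := Submodule.finrank_add_eq_of_isCompl hC'
    have h2 : Module.finrank K (W'.submoduleOf W) = Module.finrank K W' :=
      (Submodule.submoduleOfEquivOfLe hle).finrank_eq
    have h3 : Module.finrank K (C'.map W.subtype) = Module.finrank K C' :=
      (Submodule.equivMapOfInjective W.subtype W.subtype_injective C').finrank_eq.symm
    have h4 : Module.finrank K (C'.map W.subtype) ≤ E := by
      refine hE _ (Submodule.map_subtype_le _ _) γ ?_
      rintro _ ⟨b, hb, rfl⟩ hb0
      rw [Submodule.subtype_apply] at hb0 ⊢
      have hmem := Finset.mem_insert.1 (hT b.1 b.2 hb0)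
      refine hmem.resolve_right fun h => ?_
      have : b ∈ W'.submoduleOf W ⊓ C' := ⟨⟨b.2, hmax _ h⟩, hb⟩
      rw [hC'.inf_eq_bot, Submodule.mem_bot] at this
      exact hb0 (by simp [this])
    have h5 := ih W' (fun C hC => hE C (hC.trans hle)) fun b hb hb0 =>
      (Finset.mem_insert.1 (hT b (hle hb) hb0)).resolve_left hb.2.ne
    omega

theorem IsPureOn.map_mulLeft {C : Submodule K B} {γ : Γ} (hC : w.IsPureOn C γ) (b : B) :
    w.IsPureOn (C.map (LinearMap.mulLeft K b)) (w b * γ) := by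
  rintro _ ⟨c, hc, rfl⟩ h0
  rw [LinearMap.mulLeft_apply] at h0 ⊢
  rw [map_mul, hC c hc (right_ne_zero_of_mul h0)]

end Valuation

theorem finrank_map_mulLeft [IsDomain B] (C : Submodule K B) {b : B} (hb : b ≠ 0) :
    Module.finrank K (C.map (LinearMap.mulLeft K b)) = Module.finrank K C :=
  (Submodule.equivMapOfInjective (LinearMap.mulLeft K b) (mul_right_injective₀ hb) C).finrank_eq.symm

end PureSubspaces

/-! ### Encoding the filtration by finite sets of lattice points -/

section LatticeIndex

universe u v

theorem Set.ncard_image_eq_ncard_image {α β γ : Type*} {S : Set α} {f : α → β} {g : α → γ}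
    (h : ∀ a ∈ S, ∀ b ∈ S, f a = f b ↔ g a = g b) : (f '' S).ncard = (g '' S).ncard := by
  refine Set.ncard_congr (fun y hy => g hy.choose) (fun y hy => ⟨_, hy.choose_spec.1, rfl⟩) ?_ ?_
  · intro y z hy hz hyz
    rw [← hy.choose_spec.2, ← hz.choose_spec.2]
    exact (h _ hy.choose_spec.1 _ hz.choose_spec.1).2 hyz
  · rintro _ ⟨a, ha, rfl⟩
    have hy : f a ∈ f '' S := ⟨a, ha, rfl⟩
    exact ⟨f a, hy, (h _ hy.choose_spec.1 _ ha).1 hy.choose_spec.2⟩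

variable {K : Type v} {B : Type u} [Field K] [CommRing B] [IsDomain B] [Algebra K B]
  (𝓑 : ℕ → Submodule K B) [GradedAlgebra 𝓑]

/-- The group of differences of values of homogeneous elements of the same degree. -/
def differenceGroup {m : ℕ} (φ : B → Fin m → ℤ)
    (hφ : ∀ b b', b ≠ 0 → b' ≠ 0 → φ (b * b') = φ b + φ b') : AddSubgroup (Fin m → ℤ) where
  carrier := {z | ∃ n, ∃ b ∈ 𝓑 n, ∃ b' ∈ 𝓑 n, b ≠ 0 ∧ b' ≠ 0 ∧ z = φ b - φ b'}
  add_mem' := by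
    rintro _ _ ⟨n, b, hb, b', hb', h0, h0', rfl⟩ ⟨k, c, hc, c', hc', i0, i0', rfl⟩
    refine ⟨n + k, b * c, SetLike.mul_mem_graded hb hc, b' * c', SetLike.mul_mem_graded hb' hc',
      mul_ne_zero h0 i0, mul_ne_zero h0' i0', ?_⟩
    rw [hφ _ _ h0 i0, hφ _ _ h0' i0']; abel
  zero_mem' := ⟨0, 1, SetLike.GradedOne.one_mem, 1, SetLike.GradedOne.one_mem,
    one_ne_zero, one_ne_zero, (sub_self _).symm⟩
  neg_mem' := by
    rintro _ ⟨n, b, hb, b', hb', h0, h0', rfl⟩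
    exact ⟨n, b', hb', b, hb, h0', h0, (neg_sub _ _)⟩

/-- The index is measured relative to `x ^ n`, so it lies in the group of differences, and
multiplication by `x` raises the degree without moving the index. Coordinates on that group make the
differences fill all of `ℤ ^ d`, which later gives the convex body nonempty interior. -/
theorem exists_graded_index (hft : Algebra.FiniteType K B)
    (hgen : Algebra.adjoin K (𝓑 1 : Set B) = ⊤) {x : B} (hx : x ∈ 𝓑 1) (hx0 : x ≠ 0) :
    ∃ (Γ : Type u) (_ : LinearOrderedCommGroupWithZero Γ) (w : Valuation B Γ) (r d c : ℕ)
      (u : ℕ → B → Fin d → ℤ),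
      (∀ b, w b = 0 ↔ b = 0) ∧ (∀ c : K, c ≠ 0 → w (algebraMap K B c) = 1) ∧
      (∀ (C : Submodule K B) (γ : Γ), w.IsPureOn C γ → Module.finrank K C ≤ r) ∧
      (∀ n, ∀ b ∈ 𝓑 n, ∀ b' ∈ 𝓑 n, b ≠ 0 → b' ≠ 0 → (u n b = u n b' ↔ w b = w b')) ∧
      (∀ n k, ∀ b ∈ 𝓑 n, ∀ b' ∈ 𝓑 k, b ≠ 0 → b' ≠ 0 → u (n + k) (b * b') = u n b + u k b') ∧
      (∀ n, u n (x ^ n) = 0) ∧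
      (∀ n, ∀ b ∈ 𝓑 n, b ≠ 0 → ∀ i, |u n b i| ≤ (c * n : ℕ)) ∧
      ∀ z, ∃ n, ∃ b ∈ 𝓑 n, ∃ b' ∈ 𝓑 n, b ≠ 0 ∧ b' ≠ 0 ∧ z = u n b - u n b' := by
  classical
  obtain ⟨m, g, hg, hfin⟩ := exists_finite_inj_algHom_of_fg K B
  obtain ⟨Γ, _, w, hw, hK, hinj⟩ := exists_valuation_monomial_injective g hg
  obtain ⟨r, hr⟩ := Valuation.exists_finrank_le_of_isPureOn hw hK hinj hg hfin
  obtain ⟨φ, c, hφ, hφw, hφc⟩ :=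
    exists_additive_index hw hK hinj hg hfin (fg_graded_one 𝓑 hft hgen)
  obtain ⟨d, e, c', he⟩ :=
    exists_bounded_coordinates (AddSubgroup.toIntSubmodule (differenceGroup 𝓑 φ hφ))
  have hφ1 : φ 1 = 0 := by
    have := hφ 1 1 one_ne_zero one_ne_zero
    rwa [mul_one, left_eq_add] at this
  have hφx : ∀ n : ℕ, φ (x ^ n) = n • φ x := by
    intro n
    induction n with
    | zero => simpa using hφ1
    | succ n ih => rw [pow_succ, hφ _ _ (pow_ne_zero _ hx0) hx0, ih, succ_nsmul]
  have hxn : ∀ n, x ^ n ∈ 𝓑 n := fun n => by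
    simpa using SetLike.pow_mem_graded n hx
  have hmem : ∀ n, ∀ b ∈ 𝓑 n, b ≠ 0 →
      φ b - φ (x ^ n) ∈ AddSubgroup.toIntSubmodule (differenceGroup 𝓑 φ hφ) :=
    fun n b hb hb0 => ⟨n, b, hb, x ^ n, hxn n, hb0, pow_ne_zero _ hx0, rfl⟩
  let u : ℕ → B → Fin d → ℤ := fun n b =>
    if h : φ b - φ (x ^ n) ∈ AddSubgroup.toIntSubmodule (differenceGroup 𝓑 φ hφ) then
      e ⟨_, h⟩ else 0
  have hu : ∀ n b (hb : b ∈ 𝓑 n) (hb0 : b ≠ 0), u n b = e ⟨_, hmem n b hb hb0⟩ :=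
    fun n b hb hb0 => dif_pos _
  -- The factor `2 * c` bounds a difference of two vectors each bounded by `c * n`; `c'` is the cost
  -- of changing coordinates.
  refine ⟨Γ, inferInstance, w, r, d, c' * (2 * c), u, hw, hK, hr, ?_, ?_, ?_, ?_, ?_⟩
  · intro n b hb b' hb' h0 h0'
    rw [hu n b hb h0, hu n b' hb' h0', e.injective.eq_iff, Subtype.mk.injEq, sub_left_inj]
    exact hφw b b' h0 h0'
  · intro n k b hb b' hb' h0 h0'
    rw [hu n b hb h0, hu k b' hb' h0', hu _ _ (SetLike.mul_mem_graded hb hb') (mul_ne_zero h0 h0'),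
      ← map_add]
    congr 1
    apply Subtype.ext
    simp only [Submodule.coe_add]
    rw [hφ _ _ h0 h0', hφx, hφx, hφx, add_nsmul]; abel
  · intro n
    rw [hu n _ (hxn n) (pow_ne_zero _ hx0)]
    convert map_zero e
    exact sub_self _
  · intro n b hb hb0 i
    rw [hu n b hb hb0, mul_assoc]
    refine he _ (2 * c * n) (fun j => ?_) i
    have hpow := graded_eq_pow 𝓑 le_rfl hgen n
    have h1 := hφc n b (hpow ▸ hb) hb0 j
    have h2 := hφc n (x ^ n) (hpow ▸ hxn n) (pow_ne_zero _ hx0) j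
    refine (abs_sub _ _).trans ?_
    push_cast at h1 h2 ⊢
    linarith
  · intro z
    obtain ⟨n, b, hb, b', hb', h0, h0', h⟩ := (e.symm z).2
    refine ⟨n, b, hb, b', hb', h0, h0', ?_⟩
    rw [hu n b hb h0, hu n b' hb' h0', ← map_sub, ← e.symm_apply_eq]
    apply Subtype.ext
    rw [h]
    simp

theorem exists_lattice_index (hft : Algebra.FiniteType K B)
    (hgen : Algebra.adjoin K (𝓑 1 : Set B) = ⊤) {x : B} (hx : x ∈ 𝓑 1) (hx0 : x ≠ 0)
    (W : ℕ → ℝ → Submodule K B) (N : ℕ) (f : ℕ → ℝ≥0) (hW : ∀ n t, W n t ≤ 𝓑 n)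
    (hanti : ∀ n, Antitone (W n))
    (hmul : ∀ n m, N ≤ n → N ≤ m → ∀ s t, ∀ a ∈ W n s, ∀ b ∈ W m t,
      a * b ∈ W (n + m) (s + t - f n - f m))
    (hex : ∀ n, N ≤ n → ∃ t, W n t = 𝓑 n) :
    ∃ (d : ℕ) (T : ℕ → ℝ → Set (Fin d → ℤ)) (c E n₀ : ℕ) (t₀ : ℝ), 0 < E ∧ N ≤ n₀ ∧
      (∀ n t, (T n t).Finite) ∧ (∀ n, Antitone (T n)) ∧
      (∀ n m, N ≤ n → N ≤ m → ∀ s t, ∀ a ∈ T n s, ∀ b ∈ T m t,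
        a + b ∈ T (n + m) (s + t - f n - f m)) ∧
      (∀ n t, ∀ z ∈ T n t, ∀ i, |z i| ≤ (c * n : ℕ)) ∧
      (∀ z, ∃ n, N ≤ n ∧ ∃ t, ∃ a ∈ T n t, ∃ b ∈ T n t, z = a - b) ∧
      (∀ n, N ≤ n → ∀ t, ∀ z ∈ T n t, ∃ s, z ∈ T (n + 1) s) ∧
      (∀ n, N ≤ n → ∃ t, 0 ∈ T n t) ∧
      (∀ n s t, W n s ≤ W n t → T n s ⊆ T n t) ∧ (∀ n t, W n t = ⊥ → T n t = ∅) ∧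
      (∀ n t, Module.finrank K (W n t) ≤ E * (T n t).ncard) ∧
      ∀ n t, N ≤ n →
        E * (T n t).ncard ≤ Module.finrank K (W (n + n₀) (t + t₀ - f n - f n₀)) := by
  classical
  obtain ⟨Γ, _, w, r, d, c, u, hw, hK, hr, huw, hadd, hux, hbox, hdiff⟩ :=
    exists_graded_index 𝓑 hft hgen hx hx0
  have hfd : ∀ n, Module.Finite K (𝓑 n) := finite_graded 𝓑 hft hgen
  have hfdW : ∀ n t, Module.Finite K (W n t) := fun n t =>
    Submodule.finiteDimensional_of_le (hW n t)
  have hxn : ∀ n, x ^ n ∈ 𝓑 n := fun n => by simpa using SetLike.pow_mem_graded n hx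
  have hxn0 : ∀ n : ℕ, x ^ n ≠ 0 := fun n => pow_ne_zero _ hx0
  -- Only degrees at least `N` are allowed, so that the optimal subspace can be multiplied within
  -- the filtration.
  let P : Set ℕ := {k | ∃ n, N ≤ n ∧ ∃ C ≤ 𝓑 n, ∃ γ, w.IsPureOn C γ ∧ Module.finrank K C = k}
  have hPb : BddAbove P := ⟨r, by rintro _ ⟨n, -, C, -, γ, hC, rfl⟩; exact hr C γ hC⟩
  have hP1 : 1 ∈ P := ⟨N, le_rfl, Submodule.span K {x ^ N},
    by simpa [Submodule.span_le] using hxn N, _, Valuation.isPureOn_span_singleton hK _,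
    finrank_span_singleton (hxn0 N)⟩
  obtain ⟨n₀, hn₀, C₀, hC₀, γ₀, hpure, hE⟩ := Nat.sSup_mem ⟨1, hP1⟩ hPb
  set E := sSup P with hEdef
  have hE1 : 0 < E := le_csSup hPb hP1
  -- Multiplication by `x ^ N` moves any subspace to an allowed degree without changing its
  -- dimension, so `E` is optimal in every degree.
  have hEmax : ∀ n, ∀ C ≤ 𝓑 n, ∀ γ, w.IsPureOn C γ → Module.finrank K C ≤ E := by
    intro n C hC γ hCγ
    rw [← finrank_map_mulLeft C (hxn0 N)]
    refine le_csSup hPb ⟨N + n, Nat.le_add_right _ _, _, ?_, _, hCγ.map_mulLeft (x ^ N), rfl⟩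
    rintro _ ⟨b, hb, rfl⟩
    exact SetLike.mul_mem_graded (hxn N) (hC hb)
  obtain ⟨t₀, ht₀⟩ := hex n₀ hn₀
  let T : ℕ → ℝ → Set (Fin d → ℤ) := fun n t => u n '' {b | b ∈ W n t ∧ b ≠ 0}
  have hcard : ∀ n t, (T n t).ncard = (w.valuesOn (W n t)).ncard := fun n t =>
    Set.ncard_image_eq_ncard_image fun a ha b hb =>
      huw n a (hW n t ha.1) b (hW n t hb.1) ha.2 hb.2
  have hsub : ∀ n s t, W n s ≤ W n t → T n s ⊆ T n t := fun n s t h =>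
    Set.image_mono fun b hb => ⟨h hb.1, hb.2⟩
  have hvfin : ∀ n t, (w.valuesOn (W n t)).Finite := fun n t => Valuation.finite_valuesOn hK _
  refine ⟨d, T, c, E, n₀, t₀, hE1, hn₀, ?_, fun n s t h => hsub n t s (hanti n h), ?_, ?_, ?_, ?_,
    ?_, hsub, ?_, ?_, ?_⟩
  · intro n t
    refine (Set.Finite.pi' (fun _ : Fin d => Set.finite_Icc (-((c * n : ℕ) : ℤ)) (c * n : ℕ))).subset ?_
    rintro _ ⟨b, ⟨hb, hb0⟩, rfl⟩ i
    exact abs_le.1 (hbox n b (hW n t hb) hb0 i)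
  · rintro n m hn hm s t _ ⟨a, ⟨ha, ha0⟩, rfl⟩ _ ⟨b, ⟨hb, hb0⟩, rfl⟩
    exact ⟨a * b, ⟨hmul n m hn hm s t a ha b hb, mul_ne_zero ha0 hb0⟩,
      hadd n m a (hW _ _ ha) b (hW _ _ hb) ha0 hb0⟩
  · rintro n t _ ⟨b, ⟨hb, hb0⟩, rfl⟩
    exact hbox n b (hW _ _ hb) hb0
  · intro z
    obtain ⟨n, b, hb, b', hb', h0, h0', rfl⟩ := hdiff z
    obtain ⟨t, ht⟩ := hex (n + N) (Nat.le_add_left _ _)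
    refine ⟨n + N, Nat.le_add_left _ _, t, _, ⟨b * x ^ N, ⟨?_, mul_ne_zero h0 (hxn0 N)⟩, rfl⟩,
      _, ⟨b' * x ^ N, ⟨?_, mul_ne_zero h0' (hxn0 N)⟩, rfl⟩, ?_⟩
    · rw [ht]; exact SetLike.mul_mem_graded hb (hxn N)
    · rw [ht]; exact SetLike.mul_mem_graded hb' (hxn N)
    · rw [hadd n N b hb _ (hxn N) h0 (hxn0 N), hadd n N b' hb' _ (hxn N) h0' (hxn0 N)]
      simp
  · rintro n hn t _ ⟨b, ⟨hb, hb0⟩, rfl⟩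
    obtain ⟨s, hs⟩ := hex (n + 1) (hn.trans (Nat.le_succ n))
    refine ⟨s, b * x ^ 1, ⟨?_, mul_ne_zero hb0 (hxn0 1)⟩, ?_⟩
    · rw [hs]; exact SetLike.mul_mem_graded (hW _ _ hb) (hxn 1)
    · rw [hadd n 1 b (hW _ _ hb) _ (hxn 1) hb0 (hxn0 1), hux, add_zero]
  · intro n hn
    obtain ⟨t, ht⟩ := hex n hn
    exact ⟨t, x ^ n, ⟨ht ▸ hxn n, hxn0 n⟩, hux n⟩
  · intro n t h
    rw [Set.eq_empty_iff_forall_notMem]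
    rintro _ ⟨b, ⟨hb, hb0⟩, rfl⟩
    rw [h, Submodule.mem_bot] at hb
    exact hb0 hb
  · intro n t
    rw [hcard, Set.ncard_eq_toFinset_card _ (hvfin n t)]
    refine Valuation.finrank_le_mul_card hw hK _ _ (fun C hC => hEmax n C (hC.trans (hW n t))) ?_
    intro b hb hb0
    simpa using ⟨b, ⟨hb, hb0⟩, rfl⟩
  · intro n t hn
    have hγ₀ : γ₀ ≠ 0 := by
      obtain ⟨y, hy, hy0⟩ := Submodule.exists_mem_ne_zero_of_ne_bot (p := C₀) (by
        rintro rfl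
        rw [finrank_bot] at hE
        omega)
      rw [← hpure y hy hy0, Ne, hw]
      exact hy0
    rw [hcard, Set.ncard_eq_toFinset_card _ (hvfin n t),
      ← Finset.card_image_of_injective _ (mul_left_injective₀ hγ₀)]
    -- Each value of `W n t` has a representative `b`, and `b * C₀` is a subspace of constant value
    -- and dimension `E` in degree `n + n₀`.
    refine Valuation.mul_card_le_finrank (w := w) _ fun γ hγ => ?_
    obtain ⟨δ, hδ, rfl⟩ := Finset.mem_image.1 hγ
    obtain ⟨b, ⟨hb, hb0⟩, rfl⟩ := (Set.Finite.mem_toFinset _).1 hδ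
    refine ⟨_, ?_, hpure.map_mulLeft b, ?_⟩
    · rintro _ ⟨y, hy, rfl⟩
      exact hmul n n₀ hn hn₀ t t₀ b hb y (ht₀ ▸ hC₀ hy)
    · rw [finrank_map_mulLeft C₀ hb0, hE]

end LatticeIndex

/-! ### The cost of repeated dyadic addition -/

section DyadicDefect

/-- The defect `2 ∑ f(2^i n) / (2^i n)`, which bounds the average loss in repeated dyadic sums. -/
noncomputable def dyadicDefect (f : ℕ → ℝ≥0) (n : ℕ) : ℝ :=
  2 * (∑' i : ℕ, (f (2 ^ i * n) : ℝ) / 2 ^ i) / n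

variable {f : ℕ → ℝ≥0}

theorem dyadicDefect_nonneg (n : ℕ) : 0 ≤ dyadicDefect f n := by
  unfold dyadicDefect
  have : 0 ≤ ∑' i : ℕ, (f (2 ^ i * n) : ℝ) / 2 ^ i := tsum_nonneg fun i => by positivity
  positivity

theorem dyadic_term_le (hf : Monotone f) {n a : ℕ} (ha : n ≤ 2 ^ a) (i : ℕ) :
    (f (2 ^ i * n) : ℝ) / 2 ^ i ≤ 2 ^ a * ((f (2 ^ (i + a)) : ℝ) / 2 ^ (i + a)) := by
  have h1 : (f (2 ^ i * n) : ℝ) ≤ f (2 ^ (i + a)) := by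
    rw [pow_add]
    exact_mod_cast hf (Nat.mul_le_mul_left _ ha)
  calc (f (2 ^ i * n) : ℝ) / 2 ^ i ≤ (f (2 ^ (i + a)) : ℝ) / 2 ^ i := by gcongr
    _ = _ := by rw [pow_add (2 : ℝ)]; field_simp

theorem summable_dyadic (hf : Monotone f) (hsum : Summable fun i : ℕ => f (2 ^ i) / 2 ^ i) (n : ℕ) :
    Summable fun i : ℕ => (f (2 ^ i * n) : ℝ) / 2 ^ i := by
  have hs : Summable fun i : ℕ => (f (2 ^ i) : ℝ) / 2 ^ i := by
    have := NNReal.summable_coe.2 hsum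
    simpa using this
  refine Summable.of_nonneg_of_le (fun i => by positivity)
    (fun i => dyadic_term_le hf (Nat.le_pow_clog one_lt_two n) i) ?_
  exact ((summable_nat_add_iff (Nat.clog 2 n)).2 hs).mul_left _

/-- Replacing `n` by the next power of two costs a factor at most two, and bounds the defect by four
times a tail of the convergent series. -/
theorem tendsto_dyadicDefect (hf : Monotone f) (hsum : Summable fun i : ℕ => f (2 ^ i) / 2 ^ i) :
    Tendsto (dyadicDefect f) atTop (𝓝 0) := by
  have hs : Summable fun i : ℕ => (f (2 ^ i) : ℝ) / 2 ^ i := by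
    have := NNReal.summable_coe.2 hsum
    simpa using this
  have hclog : Tendsto (Nat.clog 2) atTop atTop :=
    tendsto_atTop_mono (fun n => Nat.log_le_clog 2 n)
      (tendsto_atTop.2 fun b => by
        filter_upwards [eventually_ge_atTop (2 ^ b)] with n hn
        exact Nat.le_log_of_pow_le one_lt_two hn)
  have htail : Tendsto (fun n : ℕ => 4 * ∑' i : ℕ, (f (2 ^ (i + Nat.clog 2 n)) : ℝ) /
      2 ^ (i + Nat.clog 2 n)) atTop (𝓝 0) := by
    have h1 := (tendsto_sum_nat_add fun i : ℕ => (f (2 ^ i) : ℝ) / 2 ^ i).comp hclog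
    simpa using h1.const_mul 4
  refine squeeze_zero' (Eventually.of_forall fun n => dyadicDefect_nonneg n) ?_ htail
  filter_upwards [eventually_ge_atTop 2] with n hn
  set a := Nat.clog 2 n with ha
  have hn0 : (0 : ℝ) < n := by positivity
  have hle : ∑' i : ℕ, (f (2 ^ i * n) : ℝ) / 2 ^ i ≤
      2 ^ a * ∑' i : ℕ, (f (2 ^ (i + a)) : ℝ) / 2 ^ (i + a) := by
    rw [← tsum_mul_left]
    exact (summable_dyadic hf hsum n).tsum_le_tsum
      (fun i => dyadic_term_le hf (Nat.le_pow_clog one_lt_two n) i)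
      (((summable_nat_add_iff a).2 hs).mul_left _)
  have h2a : (2 : ℝ) ^ a ≤ 2 * n := by
    have h3 := Nat.pow_pred_clog_lt_self one_lt_two (show 1 < n by omega)
    have h4 : 0 < a := Nat.clog_pos one_lt_two hn
    have h5 : 2 ^ a = 2 * 2 ^ a.pred := by
      rw [← pow_succ', ← Nat.succ_eq_add_one, Nat.succ_pred_eq_of_pos h4]
    exact_mod_cast h5.le.trans (Nat.mul_le_mul_left 2 h3.le)
  have hnn : 0 ≤ ∑' i : ℕ, (f (2 ^ (i + a)) : ℝ) / 2 ^ (i + a) :=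
    tsum_nonneg fun i => by positivity
  rw [dyadicDefect, div_le_iff₀ hn0]
  nlinarith [mul_le_mul_of_nonneg_right h2a hnn]

theorem le_dyadicDefect (hf : Monotone f) (hsum : Summable fun i : ℕ => f (2 ^ i) / 2 ^ i)
    {n : ℕ} (hn : 0 < n) : 2 * (f n : ℝ) ≤ n * dyadicDefect f n := by
  have h := (summable_dyadic hf hsum n).le_tsum 0 fun i _ => by positivity
  rw [dyadicDefect, mul_div_cancel₀ _ (by positivity)]
  simpa using h

theorem tendsto_div_self_of_dyadic (hf : Monotone f)
    (hsum : Summable fun i : ℕ => f (2 ^ i) / 2 ^ i) :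
    Tendsto (fun n : ℕ => (f n : ℝ) / n) atTop (𝓝 0) := by
  refine squeeze_zero' (Eventually.of_forall fun n => by positivity) ?_
    (tendsto_dyadicDefect hf hsum)
  filter_upwards [eventually_gt_atTop 0] with n hn
  rw [div_le_iff₀ (by positivity)]
  have := le_dyadicDefect hf hsum hn
  nlinarith [(f n).coe_nonneg]

/-- Repeated dyadic addition of copies of one element loses at most `n * dyadicDefect f n` for
each copy. -/
theorem dyadic_superadditive (hf : Monotone f) (hsum : Summable fun i : ℕ => f (2 ^ i) / 2 ^ i)
    {n : ℕ} (hn : 0 < n) {Q : ℕ → ℝ → Prop} (hanti : ∀ k s t, s ≤ t → Q k t → Q k s)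
    (hadd : ∀ k l, 0 < k → 0 < l → ∀ s t, Q k s → Q l t →
      Q (k + l) (s + t - f (k * n) - f (l * n)))
    {s : ℝ} (h1 : Q 1 s) {k : ℕ} (hk : 0 < k) : Q k (k * (s - n * dyadicDefect f n)) := by
  let S : ℕ → ℝ := fun j => ∑ i ∈ Finset.range j, 2 * ((f (2 ^ i * n) : ℝ) / 2 ^ i)
  have hS : Monotone S := fun i j hij =>
    Finset.sum_le_sum_of_subset_of_nonneg (Finset.range_mono hij) fun _ _ _ => by positivity
  -- Halve `k` into its floor and ceiling halves. With `j` the number of halvings of the larger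
  -- half, the last addition loses at most `2 * f (2 ^ j * n)`. Since `2 ^ j ≤ k`, this is one term
  -- of `S` per copy.
  have key : ∀ k : ℕ, 0 < k → Q k (k * (s - S (Nat.clog 2 k))) := by
    intro k
    induction k using Nat.strong_induction_on with
    | _ k ih =>
      intro hk
      rcases Nat.lt_or_ge k 2 with h2 | h2
      · obtain rfl : k = 1 := by omega
        simpa [S] using h1
      · have hb := ih ((k + 1) / 2) (by omega) (by omega)
        have ha := ih (k / 2) (by omega) (by omega)
        have hclog : Nat.clog 2 k = Nat.clog 2 ((k + 1) / 2) + 1 := by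
          rw [Nat.clog_of_two_le one_lt_two h2, show k + 2 - 1 = k + 1 by omega]
        set j := Nat.clog 2 ((k + 1) / 2) with hj
        have hbj : (k + 1) / 2 ≤ 2 ^ j := Nat.le_pow_clog one_lt_two _
        have haj : k / 2 ≤ 2 ^ j := le_trans (by omega) hbj
        have hSa : S (Nat.clog 2 (k / 2)) ≤ S j := hS (Nat.clog_mono_right 2 (by omega))
        have hab : k / 2 + (k + 1) / 2 = k := by omega
        have := hadd _ _ (by omega) (by omega) _ _ ha hb
        rw [hab] at this
        refine hanti _ _ _ ?_ this
        have hab' : ((k / 2 : ℕ) : ℝ) + ((k + 1) / 2 : ℕ) = k := by exact_mod_cast hab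
        have hfa : (f (k / 2 * n) : ℝ) ≤ f (2 ^ j * n) := by
          exact_mod_cast hf (Nat.mul_le_mul_right n haj)
        have hfb : (f ((k + 1) / 2 * n) : ℝ) ≤ f (2 ^ j * n) := by
          exact_mod_cast hf (Nat.mul_le_mul_right n hbj)
        have hkj : (2 : ℝ) ^ j ≤ k := by
          have h3 := Nat.pow_pred_clog_lt_self one_lt_two (show 1 < k by omega)
          rw [hclog, Nat.pred_succ] at h3
          exact_mod_cast h3.le
        have hstep : (f (2 ^ j * n) : ℝ) ≤ k * ((f (2 ^ j * n) : ℝ) / 2 ^ j) := by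
          rw [← mul_div_assoc, le_div_iff₀ (by positivity), mul_comm]
          exact mul_le_mul_of_nonneg_right hkj (by positivity)
        have hSj : S (Nat.clog 2 k) = S j + 2 * ((f (2 ^ j * n) : ℝ) / 2 ^ j) := by
          rw [hclog]; exact Finset.sum_range_succ _ _
        rw [hSj, ← hab'] at *
        have h0 := mul_le_mul_of_nonneg_left hSa (Nat.cast_nonneg (α := ℝ) (k / 2))
        nlinarith
  refine hanti _ _ _ (mul_le_mul_of_nonneg_left ?_ (Nat.cast_nonneg k)) (key k hk)
  have hn0 : (n : ℝ) ≠ 0 := by positivity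
  have : S (Nat.clog 2 k) ≤ n * dyadicDefect f n := by
    rw [dyadicDefect, mul_div_cancel₀ _ hn0]
    simp only [S]
    rw [← Finset.mul_sum]
    gcongr
    exact (summable_dyadic hf hsum n).sum_le_tsum _ fun i _ => by positivity
  linarith

end DyadicDefect

/-! ### Counting lattice points in dilated convex bodies -/

section LatticeCount

open Bornology

variable {d : ℕ}

/-- The integral points `z` with `z / n ∈ s`. -/
def latticePoints (s : Set (Fin d → ℝ)) (n : ℕ) : Set (Fin d → ℤ) :=
  {z | (n : ℝ)⁻¹ • (fun i => (z i : ℝ)) ∈ s}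

theorem finite_latticePoints {s : Set (Fin d → ℝ)} (hs : IsBounded s) {n : ℕ} (hn : 0 < n) :
    (latticePoints s n).Finite := by
  obtain ⟨R, hR⟩ := hs.exists_norm_le
  refine (Set.Finite.pi' (fun _ : Fin d => Set.finite_Icc (-⌈n * R⌉) ⌈n * R⌉)).subset ?_
  intro z hz i
  have h1 := (norm_le_pi_norm _ i).trans (hR _ hz)
  have hn' : (0 : ℝ) < n := by positivity
  rw [Pi.smul_apply, smul_eq_mul, norm_mul, norm_inv, Real.norm_natCast, inv_mul_le_iff₀ hn',
    Real.norm_eq_abs] at h1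
  have h2 : |z i| ≤ ⌈(n : ℝ) * R⌉ := by
    have := h1.trans (Int.le_ceil _)
    exact_mod_cast this
  exact abs_le.1 h2

theorem tendsto_ncard_latticePoints {s : Set (Fin d → ℝ)} (hs : IsBounded s) (hc : Convex ℝ s)
    (hcl : IsClosed s) :
    Tendsto (fun n : ℕ => ((latticePoints s n).ncard : ℝ) / n ^ d) atTop
      (𝓝 (volume.real s)) := by
  have h := tendsto_card_div_pow_atTop_volume s hs hcl.measurableSet (hc.addHaar_frontier volume)
  rw [Fintype.card_fin] at h
  refine h.congr' ?_
  filter_upwards [eventually_gt_atTop 0] with n hn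
  have hn' : (n : ℝ) ≠ 0 := by positivity
  congr 2
  have hinj : Function.Injective fun z : Fin d → ℤ => (n : ℝ)⁻¹ • (fun i => (z i : ℝ)) := by
    intro z z' h
    have h1 := smul_right_injective (Fin d → ℝ) (inv_ne_zero hn') h
    funext i
    exact_mod_cast congrFun h1 i
  rw [← Set.ncard_image_of_injective _ hinj, Nat.card_coe_set_eq]
  congr 1
  ext p
  simp only [Set.mem_inter_iff, Set.mem_image, latticePoints, Set.mem_ofPred_eq,
    Set.mem_inv_smul_set_iff₀ hn', SetLike.mem_coe]
  rw [Module.Basis.mem_span_iff_repr_mem]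
  simp only [Pi.basisFun_repr, Set.mem_range, algebraMap_int_eq, eq_intCast]
  constructor
  · rintro ⟨hp, h⟩
    choose z hz using h
    have : (n : ℝ)⁻¹ • (fun i => (z i : ℝ)) = p := by
      rw [inv_smul_eq_iff₀ hn']
      funext i
      exact hz i
    exact ⟨z, this ▸ hp, this⟩
  · rintro ⟨z, hz, rfl⟩
    exact ⟨hz, fun i => ⟨z i, by rw [smul_inv_smul₀ hn']⟩⟩

end LatticeCount

/-! ### Asymptotic cardinality of a superadditive family -/

/-- A family of finite sets of lattice points, superadditive up to `f`, as produced by a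
pseudo-filtered graded algebra. -/
structure IsSuperadditiveFamily {d : ℕ} (T : ℕ → ℝ → Set (Fin d → ℤ)) (f : ℕ → ℝ≥0) (N c : ℕ)
    (A : ℝ) : Prop where
  one_le : 1 ≤ N
  monotone : Monotone f
  summable : Summable fun i : ℕ => f (2 ^ i) / 2 ^ i
  anti : ∀ n, Antitone (T n)
  add : ∀ n m, N ≤ n → N ≤ m → ∀ s t, ∀ a ∈ T n s, ∀ b ∈ T m t,
    a + b ∈ T (n + m) (s + t - f n - f m)
  box : ∀ n t, ∀ z ∈ T n t, ∀ i, |z i| ≤ (c * n : ℕ)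
  gen : ∀ z, ∃ n, N ≤ n ∧ ∃ t, ∃ a ∈ T n t, ∃ b ∈ T n t, z = a - b
  succ : ∀ n, N ≤ n → ∀ t, ∀ z ∈ T n t, ∃ s, z ∈ T (n + 1) s
  zero : ∀ n, N ≤ n → ∃ t, 0 ∈ T n t
  full : ∀ n, N ≤ n → ∀ t, T n t ⊆ T n (-(A * n))
  empty : ∀ n, N ≤ n → ∀ t, A * n < t → T n t = ∅

namespace IsSuperadditiveFamily

open Bornology

variable {d : ℕ} {T : ℕ → ℝ → Set (Fin d → ℤ)} {f : ℕ → ℝ≥0} {N c : ℕ} {A : ℝ}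

/-- The normalized points of index at least `t`, up to the dyadic defect. -/
def points (T : ℕ → ℝ → Set (Fin d → ℤ)) (f : ℕ → ℝ≥0) (N : ℕ) (t : ℝ) : Set (Fin d → ℝ) :=
  {p | ∃ n, N ≤ n ∧ ∃ z ∈ T n ((t + dyadicDefect f n) * n),
    p = (n : ℝ)⁻¹ • (fun i => (z i : ℝ))}

/-- The volume of the convex hull of the normalized points of index at least `t`. -/
noncomputable def hullVolume (T : ℕ → ℝ → Set (Fin d → ℤ)) (f : ℕ → ℝ≥0) (N : ℕ) (t : ℝ) : ℝ :=
  volume.real (convexHull ℝ (points T f N t))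

variable (h : IsSuperadditiveFamily T f N c A)
include h

theorem points_anti : Antitone (points T f N) := by
  rintro s t hst p ⟨n, hn, z, hz, rfl⟩
  exact ⟨n, hn, z, h.anti n (by gcongr) hz, rfl⟩

theorem points_subset (t : ℝ) : points T f N t ⊆ Metric.closedBall 0 c := by
  rintro p ⟨n, hn, z, hz, rfl⟩
  have hn' : (0 : ℝ) < n := by exact_mod_cast h.one_le.trans hn
  rw [mem_closedBall_zero_iff, pi_norm_le_iff_of_nonneg (by positivity)]
  intro i
  rw [Pi.smul_apply, smul_eq_mul, norm_mul, norm_inv, Real.norm_natCast, inv_mul_le_iff₀ hn',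
    Real.norm_eq_abs]
  have := h.box n _ z hz i
  rw [mul_comm c n] at this
  exact_mod_cast this

theorem hull_subset (t : ℝ) : convexHull ℝ (points T f N t) ⊆ Metric.closedBall 0 c :=
  convexHull_min (h.points_subset t) (convex_closedBall _ _)

theorem hull_isBounded (t : ℝ) : IsBounded (convexHull ℝ (points T f N t)) :=
  Metric.isBounded_closedBall.subset (h.hull_subset t)

theorem hullVolume_anti : Antitone (hullVolume T f N) := by
  intro s t hst
  exact measureReal_mono (convexHull_mono (h.points_anti hst))
    (h.hull_isBounded s).measure_lt_top.ne

theorem hullVolume_eq_zero {t : ℝ} (ht : A < t) : hullVolume T f N t = 0 := by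
  have : points T f N t = ∅ := by
    rw [Set.eq_empty_iff_forall_notMem]
    rintro p ⟨n, hn, z, hz, rfl⟩
    have hn' : (0 : ℝ) < n := by exact_mod_cast h.one_le.trans hn
    rw [h.empty n hn] at hz
    · exact hz
    · have := dyadicDefect_nonneg (f := f) n
      gcongr
      linarith
  simp [hullVolume, this]

theorem exists_points_const : ∃ t₀ : ℝ, t₀ ≤ A ∧ ∀ t ≤ t₀, points T f N t =
    {p | ∃ n, N ≤ n ∧ ∃ s, ∃ z ∈ T n s, p = (n : ℝ)⁻¹ • (fun i => (z i : ℝ))} := by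
  obtain ⟨D, hD⟩ := (tendsto_dyadicDefect h.monotone h.summable).bddAbove_range
  refine ⟨min (-A - D) A, min_le_right _ _, fun t ht => Set.Subset.antisymm ?_ ?_⟩
  · rintro p ⟨n, hn, z, hz, rfl⟩
    exact ⟨n, hn, _, z, hz, rfl⟩
  · rintro p ⟨n, hn, s, z, hz, rfl⟩
    refine ⟨n, hn, z, h.anti n ?_ (h.full n hn s hz), rfl⟩
    rw [← neg_mul]
    have h1 : dyadicDefect f n ≤ D := hD ⟨n, rfl⟩
    have h2 := ht.trans (min_le_left _ _)
    gcongr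
    linarith

/-- At very low levels the hull contains zero and, up to scaling, vectors whose differences give the
standard basis; it therefore has nonempty interior and positive volume. -/
theorem exists_hullVolume_const : ∃ (t₀ V : ℝ), t₀ ≤ A ∧ 0 < V ∧
    ∀ t ≤ t₀, hullVolume T f N t = V := by
  obtain ⟨t₀, ht₀A, ht₀⟩ := h.exists_points_const
  refine ⟨t₀, hullVolume T f N t₀, ht₀A, ?_, fun t ht => by
    rw [hullVolume, hullVolume, ht₀ t ht, ht₀ t₀ le_rfl]⟩
  rw [hullVolume, measureReal_def]
  refine ENNReal.toReal_pos ?_ (h.hull_isBounded _).measure_lt_top.ne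
  rw [← pos_iff_ne_zero]
  refine Measure.measure_pos_of_nonempty_interior _ ?_
  rw [interior_convexHull_nonempty_iff_affineSpan_eq_top]
  have h0 : (0 : Fin d → ℝ) ∈ points T f N t₀ := by
    rw [ht₀ t₀ le_rfl]
    obtain ⟨t, ht⟩ := h.zero N le_rfl
    exact ⟨N, le_rfl, t, 0, ht, by ext; simp⟩
  rw [AffineSubspace.affineSpan_eq_top_iff_vectorSpan_eq_top_of_nonempty ℝ _ _ ⟨0, h0⟩,
    vectorSpan_eq_span_vsub_set_right ℝ h0, eq_top_iff, ← (Pi.basisFun ℝ (Fin d)).span_eq,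
    Submodule.span_le]
  rintro _ ⟨i, rfl⟩
  obtain ⟨n, hn, t, a, ha, b, hb, hab⟩ := h.gen (Pi.single i 1)
  have hn' : (n : ℝ) ≠ 0 := by
    have := h.one_le.trans hn
    positivity
  have hmem : ∀ a ∈ T n t, (fun i => (a i : ℝ)) ∈
      Submodule.span ℝ ((fun x => x -ᵥ (0 : Fin d → ℝ)) '' points T f N t₀) := by
    intro a ha
    rw [← smul_inv_smul₀ hn' fun i => (a i : ℝ)]
    refine Submodule.smul_mem _ _ (Submodule.subset_span
      ⟨(n : ℝ)⁻¹ • (fun i => (a i : ℝ)), ?_, sub_zero _⟩)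
    rw [ht₀ t₀ le_rfl]
    exact ⟨n, hn, t, a, ha, rfl⟩
  have := Submodule.sub_mem _ (hmem a ha) (hmem b hb)
  convert! this using 1
  funext j
  have := congrFun hab j
  simp only [Pi.basisFun_apply, Pi.sub_apply] at this ⊢
  rw [← Int.cast_sub, ← this]
  by_cases hij : j = i
  · subst hij; simp
  · simp [Pi.single_eq_of_ne hij]

/-- Once the defect is below `t - s`, points of index `t * n` qualify for level `s`. The closure has
the same volume, since a convex set has null frontier, and being closed it is measurable for the
lattice point count. -/
theorem eventually_ncard_lt {s t ε : ℝ} (hst : s < t) (hε : 0 < ε) :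
    ∀ᶠ n : ℕ in atTop, ((T n (t * n)).ncard : ℝ) / n ^ d < hullVolume T f N s + ε := by
  set Cs := closure (convexHull ℝ (points T f N s)) with hCs
  have hconv := convex_convexHull ℝ (points T f N s)
  have hbdd : IsBounded Cs := (h.hull_isBounded s).closure
  have hvol : volume.real Cs = hullVolume T f N s :=
    measureReal_congr (closure_ae_eq_of_null_frontier (hconv.addHaar_frontier volume))
  have hlim := tendsto_ncard_latticePoints hbdd hconv.closure isClosed_closure
  rw [hvol] at hlim
  filter_upwards [hlim.eventually_lt_const (lt_add_of_pos_right _ hε),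
    (tendsto_dyadicDefect h.monotone h.summable).eventually_lt_const (sub_pos.2 hst),
    eventually_ge_atTop N] with n h1 h2 hn
  refine lt_of_le_of_lt ?_ h1
  have hn' := h.one_le.trans hn
  refine div_le_div_of_nonneg_right (Nat.cast_le.2 ?_) (by positivity)
  refine Set.ncard_le_ncard (fun z hz => ?_) (finite_latticePoints hbdd hn')
  refine subset_closure (subset_convexHull ℝ _ ⟨n, hn, z, h.anti n ?_ hz, rfl⟩)
  gcongr
  linarith

theorem mem_add_level {n : ℕ} (hn : N ≤ n) {t : ℝ} {z : Fin d → ℤ} (hz : z ∈ T n t) (k : ℕ) :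
    z ∈ T (n + k) (-(A * (n + k : ℕ))) := by
  induction k with
  | zero => exact h.full n hn t hz
  | succ k ih =>
    obtain ⟨s, hs⟩ := h.succ (n + k) (by omega) _ z ih
    exact h.full _ (by omega) s hs

/-- The semigroup of all lattice points of the family. -/
def semigroup : AddSubmonoid (Fin d → ℤ) where
  carrier := {z | ∃ n, N ≤ n ∧ ∃ t, z ∈ T n t}
  add_mem' := by
    rintro a b ⟨n, hn, s, ha⟩ ⟨m, hm, t, hb⟩
    exact ⟨n + m, by omega, _, h.add n m hn hm s t a ha b hb⟩
  zero_mem' := by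
    obtain ⟨t, ht⟩ := h.zero N le_rfl
    exact ⟨N, le_rfl, t, ht⟩

/-- One translation places a whole box in the family in every large degree. Each `z` is a difference
`a z - b z`; taking `c₀` as the sum of all the `b z` leaves `c₀ + z` a sum of members of the
semigroup. -/
theorem exists_shift (R : ℕ) : ∃ (c₀ : Fin d → ℤ) (n₁ : ℕ), N ≤ n₁ ∧ ∀ z : Fin d → ℤ,
    (∀ i, |z i| ≤ R) → ∀ n, n₁ ≤ n → c₀ + z ∈ T n (-(A * n)) := by
  classical
  have hfin : {z : Fin d → ℤ | ∀ i, |z i| ≤ R}.Finite := by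
    refine (Set.Finite.pi' (fun _ : Fin d => Set.finite_Icc (-(R : ℤ)) R)).subset ?_
    exact fun z hz i => abs_le.1 (hz i)
  have hgen : ∀ z : Fin d → ℤ, ∃ a ∈ h.semigroup, ∃ b ∈ h.semigroup, z = a - b := by
    intro z
    obtain ⟨n, hn, t, a, ha, b, hb, rfl⟩ := h.gen z
    exact ⟨a, ⟨n, hn, t, ha⟩, b, ⟨n, hn, t, hb⟩, rfl⟩
  choose a ha b hb hab using hgen
  let c₀ := ∑ z ∈ hfin.toFinset, b z
  have hmem : ∀ z ∈ hfin.toFinset, c₀ + z ∈ h.semigroup := by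
    intro z hz
    have : c₀ + z = a z + ∑ z' ∈ hfin.toFinset.erase z, b z' := by
      simp only [c₀]
      rw [← Finset.add_sum_erase _ _ hz]
      rw [← eq_sub_iff_add_eq.1 (hab z)]
      abel
    rw [this]
    exact add_mem (ha z) (sum_mem fun z' _ => hb z')
  have hlev : ∀ z, ∃ n, z ∈ hfin.toFinset → N ≤ n ∧ ∃ t, c₀ + z ∈ T n t := by
    intro z
    by_cases hz : z ∈ hfin.toFinset
    · obtain ⟨n, hn, t, ht⟩ := hmem z hz
      exact ⟨n, fun _ => ⟨hn, t, ht⟩⟩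
    · exact ⟨0, fun h => absurd h hz⟩
  choose lev hlev using hlev
  refine ⟨c₀, max N (hfin.toFinset.sup lev), le_max_left _ _, fun z hz n hn => ?_⟩
  have hz' : z ∈ hfin.toFinset := by simpa using hz
  obtain ⟨h1, t, h2⟩ := hlev z hz'
  have h3 : lev z ≤ n := (Finset.le_sup (f := lev) hz').trans ((le_max_right _ _).trans hn)
  obtain ⟨k, rfl⟩ := Nat.exists_eq_add_of_le h3
  exact h.mem_add_level h1 h2 k

theorem nsmul_mem {n : ℕ} (hn : N ≤ n) {t : ℝ} {z : Fin d → ℤ}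
    (hz : z ∈ T n ((t + dyadicDefect f n) * n)) {k : ℕ} (hk : 0 < k) :
    k • z ∈ T (k * n) (t * (k * n : ℕ)) := by
  have hle : ∀ k : ℕ, 0 < k → N ≤ k * n := fun k hk =>
    hn.trans (Nat.le_mul_of_pos_left n hk)
  have := dyadic_superadditive h.monotone h.summable (h.one_le.trans hn)
    (Q := fun k s => k • z ∈ T (k * n) s) (fun k s t hst ht => h.anti _ hst ht)
    (fun k l hk hl s t hs ht => by
      rw [add_mul, add_smul]
      exact h.add _ _ (hle k hk) (hle l hl) s t _ hs _ ht)
    (s := (t + dyadicDefect f n) * n) (by simpa using hz) hk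
  refine h.anti _ (le_of_eq ?_) this
  push_cast; ring

/-- The threshold defining `points` already pays for the multiplicities. Only the additions between
blocks are charged, at most `2 * f M` each, so the loss does not grow with the number of copies. -/
theorem add_sum_nsmul_mem {ι : Type*} (G : Finset ι) {n k : ι → ℕ} {z : ι → Fin d → ℤ} {t : ℝ}
    (hn : ∀ p ∈ G, N ≤ n p) (hz : ∀ p ∈ G, z p ∈ T (n p) ((t + dyadicDefect f (n p)) * n p))
    {n₀ : ℕ} (hn₀ : N ≤ n₀) {s : ℝ} {z₀ : Fin d → ℤ} (hz₀ : z₀ ∈ T n₀ s) {M : ℕ}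
    (hM : n₀ + ∑ p ∈ G, k p * n p ≤ M) :
    z₀ + ∑ p ∈ G, k p • z p ∈ T (n₀ + ∑ p ∈ G, k p * n p)
      (s + t * (∑ p ∈ G, k p * n p : ℕ) - 2 * G.card * f M) := by
  classical
  induction G using Finset.induction_on with
  | empty => simpa using hz₀
  | insert p G hp ih =>
    rw [Finset.sum_insert hp] at hM
    have ih' := ih (fun q hq => hn q (Finset.mem_insert_of_mem hq))
      (fun q hq => hz q (Finset.mem_insert_of_mem hq)) (by omega)
    rw [Finset.sum_insert hp, Finset.sum_insert hp, Finset.card_insert_of_notMem hp]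
    rcases Nat.eq_zero_or_pos (k p) with hk | hk
    · rw [hk, zero_smul, zero_mul, zero_add, zero_add]
      refine h.anti _ ?_ ih'
      push_cast
      nlinarith [(f M).coe_nonneg]
    · have hblock := h.nsmul_mem (hn p (Finset.mem_insert_self _ _))
        (hz p (Finset.mem_insert_self _ _)) hk
      have hle : N ≤ k p * n p :=
        (hn p (Finset.mem_insert_self _ _)).trans (Nat.le_mul_of_pos_left _ hk)
      have := h.add _ _ (by omega) hle _ _ _ ih' _ hblock
      have hf1 : (f (n₀ + ∑ p ∈ G, k p * n p) : ℝ) ≤ f M := by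
        exact_mod_cast h.monotone (by omega)
      have hf2 : (f (k p * n p) : ℝ) ≤ f M := by
        exact_mod_cast h.monotone (by omega)
      rw [show n₀ + (k p * n p + ∑ p ∈ G, k p * n p) = n₀ + ∑ p ∈ G, k p * n p + k p * n p by ring,
        show z₀ + (k p • z p + ∑ p ∈ G, k p • z p) = z₀ + ∑ p ∈ G, k p • z p + k p • z p by abel]
      refine h.anti _ ?_ this
      push_cast
      nlinarith

theorem finite (n : ℕ) (t : ℝ) : (T n t).Finite := by
  refine (Set.Finite.pi' (fun _ : Fin d => Set.finite_Icc (-((c * n : ℕ) : ℤ)) (c * n : ℕ))).subset ?_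
  exact fun z hz i => abs_le.1 (h.box n t z hz i)

omit h in
theorem countable_points (t : ℝ) : (points T f N t).Countable := by
  refine (Set.countable_range fun q : ℕ × (Fin d → ℤ) =>
    (q.1 : ℝ)⁻¹ • (fun i => (q.2 i : ℝ))).mono ?_
  rintro p ⟨n, hn, z, hz, rfl⟩
  exact ⟨(n, z), rfl⟩

/-- The hull is a directed union of hulls of finite subsets, indexed by a countable set, so its
volume is the supremum of theirs. -/
theorem exists_finset_volume_gt (t : ℝ) {ε : ℝ} (hε : 0 < ε) :
    ∃ F : Finset (Fin d → ℝ), (F : Set (Fin d → ℝ)) ⊆ points T f N t ∧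
      hullVolume T f N t - ε < volume.real (convexHull ℝ (F : Set (Fin d → ℝ))) := by
  classical
  by_contra! hcon
  have : Countable (points T f N t) := (countable_points t).to_subtype
  let S : Finset (points T f N t) → Set (Fin d → ℝ) := fun G =>
    convexHull ℝ ((G.map (Function.Embedding.subtype _) : Finset (Fin d → ℝ)) : Set (Fin d → ℝ))
  have hsub : ∀ G : Finset (points T f N t),
      ((G.map (Function.Embedding.subtype _) : Finset (Fin d → ℝ)) : Set (Fin d → ℝ)) ⊆
        points T f N t := by
    intro G p hp
    simp only [Finset.coe_map, Function.Embedding.subtype_apply, Set.mem_image] at hp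
    obtain ⟨q, -, rfl⟩ := hp
    exact q.2
  have hunion : convexHull ℝ (points T f N t) = ⋃ G, S G := by
    refine Set.Subset.antisymm ?_ (Set.iUnion_subset fun G => convexHull_mono (hsub G))
    rw [convexHull_eq_union_convexHull_finite_subsets]
    refine Set.iUnion₂_subset fun F hF => ?_
    refine Set.subset_iUnion_of_subset (F.subtype (· ∈ points T f N t)) ?_
    simp only [S]
    rw [Finset.subtype_map_of_mem hF]
  have hdir : Directed (· ⊆ ·) S := directed_of_isDirected_le fun G G' hG =>
    convexHull_mono (Finset.coe_subset.2 (Finset.map_subset_map.2 hG))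
  have hmeas := hdir.measure_iUnion (μ := volume)
  rw [← hunion] at hmeas
  have hfin : ∀ G, volume (S G) ≠ ⊤ := fun G =>
    ((h.hull_isBounded t).subset (convexHull_mono (hsub G))).measure_lt_top.ne
  have h0 : 0 ≤ hullVolume T f N t - ε := le_trans measureReal_nonneg (hcon ∅ (by simp))
  have hle : volume (convexHull ℝ (points T f N t)) ≤ ENNReal.ofReal (hullVolume T f N t - ε) := by
    rw [hmeas]
    refine iSup_le fun G => ?_
    rw [← ENNReal.ofReal_toReal (hfin G)]
    exact ENNReal.ofReal_le_ofReal (hcon _ (hsub G))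
  have := ENNReal.toReal_mono ENNReal.ofReal_ne_top hle
  rw [ENNReal.toReal_ofReal h0] at this
  have h2 : hullVolume T f N t ≤ hullVolume T f N t - ε := this
  linarith

/-- An integral point of `k` times the polytope is a real combination of the `z p`. Rounding the
coefficients down leaves a remainder and a degree deficit bounded independently of `k`. Both are
supplied by `exists_shift`, after translation by `c₀`. -/
theorem eventually_ncard_latticePoints_le {s t : ℝ} (hst : s < t) {F : Finset (Fin d → ℝ)}
    (hF : (F : Set (Fin d → ℝ)) ⊆ points T f N t) :
    ∃ n₁ : ℕ, ∀ᶠ k : ℕ in atTop,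
      (latticePoints (convexHull ℝ (F : Set (Fin d → ℝ))) k).ncard ≤
        (T (k + n₁) (s * (k + n₁ : ℕ))).ncard := by
  classical
  have hch : ∀ p : Fin d → ℝ, ∃ (n : ℕ) (z : Fin d → ℤ), p ∈ F → N ≤ n ∧
      z ∈ T n ((t + dyadicDefect f n) * n) ∧ p = (n : ℝ)⁻¹ • (fun i => (z i : ℝ)) := by
    intro p
    by_cases hp : p ∈ F
    · obtain ⟨n, hn, z, hz, rfl⟩ := hF hp
      exact ⟨n, z, fun _ => ⟨hn, hz, rfl⟩⟩
    · exact ⟨0, 0, fun h => absurd h hp⟩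
  choose lev z hlz using hch
  let R : ℕ := ∑ p ∈ F, c * lev p
  obtain ⟨c₀, n₁, hn₁, hshift⟩ := h.exists_shift R
  let Q : ℕ := n₁ + ∑ p ∈ F, lev p
  refine ⟨n₁, ?_⟩
  -- The gap between `s` and `t` must absorb the fixed cost of the remainder summand, of degree at
  -- most `Q`, and the sublinear loss of finitely many additions.
  have hev : ∀ᶠ n : ℕ in atTop, |A + t| * Q + 2 * F.card * f n ≤ (t - s) * n := by
    have h1 := (tendsto_div_self_of_dyadic h.monotone h.summable).const_mul (2 * (F.card : ℝ))
    have h2 := (tendsto_const_div_atTop_nhds_zero_nat (|A + t| * Q)).add h1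
    rw [mul_zero, add_zero] at h2
    filter_upwards [h2.eventually_lt_const (sub_pos.2 hst), eventually_gt_atTop 0] with n hn hn0
    have hn0' : (0 : ℝ) < n := by positivity
    rw [← mul_div_assoc, ← add_div, div_lt_iff₀ hn0'] at hn
    exact hn.le
  filter_upwards [(tendsto_add_atTop_nat n₁).eventually hev, eventually_gt_atTop 0] with k hk hk0
  refine Set.ncard_le_ncard_of_injOn (fun y => c₀ + y) ?_ (add_right_injective c₀).injOn
    (h.finite _ _)
  intro y hy
  have hk0' : (k : ℝ) ≠ 0 := by positivity
  obtain ⟨w, hw0, hw1, hwy⟩ := (Finset.mem_convexHull' (R := ℝ)).1 hy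
  have hlev0 : ∀ p ∈ F, (lev p : ℝ) ≠ 0 := fun p hp => by
    have := h.one_le.trans (hlz p hp).1
    positivity
  let μ : (Fin d → ℝ) → ℝ := fun p => k * w p / lev p
  have hμ0 : ∀ p ∈ F, 0 ≤ μ p := fun p hp => by
    have := hw0 p hp
    positivity
  have hμsum : ∑ p ∈ F, μ p * lev p = k := by
    rw [Finset.sum_congr rfl fun p hp => div_mul_cancel₀ _ (hlev0 p hp), ← Finset.mul_sum, hw1,
      mul_one]
  have hμy : ∀ i, (y i : ℝ) = ∑ p ∈ F, μ p * z p i := by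
    intro i
    have h1 : (fun i => (y i : ℝ)) = (k : ℝ) • ∑ p ∈ F, w p • p := by
      rw [hwy, smul_inv_smul₀ hk0']
    have h2 := congrFun h1 i
    rw [h2, Pi.smul_apply, Finset.sum_apply, smul_eq_mul, Finset.mul_sum]
    refine Finset.sum_congr rfl fun p hp => ?_
    have h3 := congrFun (hlz p hp).2.2 i
    rw [Pi.smul_apply, smul_eq_mul, h3, Pi.smul_apply, smul_eq_mul]
    simp only [μ]
    ring
  let κ : (Fin d → ℝ) → ℕ := fun p => ⌊μ p⌋₊
  have hκle : ∀ p ∈ F, (κ p : ℝ) ≤ μ p := fun p hp => Nat.floor_le (hμ0 p hp)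
  have hκlt : ∀ p, μ p < κ p + 1 := fun p => Nat.lt_floor_add_one _
  set rem : Fin d → ℤ := y - ∑ p ∈ F, κ p • z p with hrem
  have hremR : ∀ i, |rem i| ≤ R := by
    intro i
    have h1 : (rem i : ℝ) = ∑ p ∈ F, (μ p - κ p) * z p i := by
      rw [hrem]
      simp only [Pi.sub_apply, Finset.sum_apply, Pi.smul_apply]
      simp only [nsmul_eq_mul, Int.cast_sub, Int.cast_sum, Int.cast_mul, Int.cast_natCast,
        sub_mul, Finset.sum_sub_distrib]
      rw [hμy i]
    have h2 : |(rem i : ℝ)| ≤ R := by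
      rw [h1]
      refine (Finset.abs_sum_le_sum_abs _ _).trans ?_
      simp only [R, Nat.cast_sum]
      refine Finset.sum_le_sum fun p hp => ?_
      rw [abs_mul]
      have h3 : |μ p - κ p| ≤ 1 := by
        rw [abs_le]
        constructor <;> linarith [hκle p hp, hκlt p]
      have h4 : |(z p i : ℝ)| ≤ (c * lev p : ℕ) := by
        exact_mod_cast h.box _ _ _ (hlz p hp).2.1 i
      calc _ ≤ 1 * |(z p i : ℝ)| := by gcongr
        _ ≤ _ := by rwa [one_mul]
    exact_mod_cast h2
  have hsum_le : ∑ p ∈ F, κ p * lev p ≤ k := by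
    have : (∑ p ∈ F, (κ p : ℝ) * lev p) ≤ k := by
      rw [← hμsum]
      exact Finset.sum_le_sum fun p hp => mul_le_mul_of_nonneg_right (hκle p hp) (by positivity)
    exact_mod_cast this
  have hle_sum : k ≤ ∑ p ∈ F, κ p * lev p + ∑ p ∈ F, lev p := by
    have : (k : ℝ) ≤ (∑ p ∈ F, (κ p : ℝ) * lev p) + ∑ p ∈ F, (lev p : ℝ) := by
      rw [← hμsum, ← Finset.sum_add_distrib]
      refine Finset.sum_le_sum fun p hp => ?_
      rw [← add_one_mul]
      exact mul_le_mul_of_nonneg_right (hκlt p).le (by positivity)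
    exact_mod_cast this
  obtain ⟨l, hl⟩ := Nat.exists_eq_add_of_le hsum_le
  have hlQ : l ≤ ∑ p ∈ F, lev p := by omega
  have hstart := hshift rem hremR (n₁ + l) (Nat.le_add_right _ _)
  have htot : n₁ + l + ∑ p ∈ F, κ p * lev p = k + n₁ := by omega
  have := h.add_sum_nsmul_mem F (k := κ) (fun p hp => (hlz p hp).1) (fun p hp => (hlz p hp).2.1)
    (by omega : N ≤ n₁ + l) hstart htot.le
  rw [htot, show c₀ + rem + ∑ p ∈ F, κ p • z p = c₀ + y by rw [hrem]; abel] at this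
  refine h.anti _ ?_ this
  have e1 : ((∑ p ∈ F, κ p * lev p : ℕ) : ℝ) = (k + n₁ : ℕ) - (n₁ + l : ℕ) := by
    rw [← htot]; push_cast; ring
  rw [e1]
  have e2 : ((n₁ + l : ℕ) : ℝ) ≤ Q := by
    exact_mod_cast Nat.add_le_add_left hlQ n₁
  have e3 : (A + t) * (n₁ + l : ℕ) ≤ |A + t| * Q :=
    mul_le_mul (le_abs_self _) e2 (by positivity) (abs_nonneg _)
  nlinarith

theorem eventually_lt_ncard {s t ε : ℝ} (hst : s < t) (hε : 0 < ε) :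
    ∀ᶠ n : ℕ in atTop, hullVolume T f N t - ε < ((T n (s * n)).ncard : ℝ) / n ^ d := by
  obtain ⟨F, hF, hvol⟩ := h.exists_finset_volume_gt t hε
  obtain ⟨n₁, hn₁⟩ := h.eventually_ncard_latticePoints_le hst hF
  have hlim := tendsto_ncard_latticePoints ((h.hull_isBounded t).subset (convexHull_mono hF))
    (convex_convexHull ℝ _) (F.finite_toSet.isClosed_convexHull ℝ)
  have hratio : Tendsto (fun k : ℕ => ((k : ℝ) / (k + n₁ : ℕ)) ^ d) atTop (𝓝 1) := by
    have := (tendsto_natCast_div_add_atTop (n₁ : ℝ)).pow d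
    simpa using this
  have hprod := hlim.mul hratio
  rw [mul_one] at hprod
  have hev : ∀ᶠ k : ℕ in atTop, hullVolume T f N t - ε <
      ((T (k + n₁) (s * (k + n₁ : ℕ))).ncard : ℝ) / (k + n₁ : ℕ) ^ d := by
    filter_upwards [hn₁, hprod.eventually_const_lt hvol, eventually_gt_atTop 0] with k h1 h2 hk
    refine h2.trans_le ?_
    have hk' : (k : ℝ) ≠ 0 := by positivity
    rw [div_pow, div_mul_div_cancel₀ (pow_ne_zero d hk')]
    refine div_le_div_of_nonneg_right (Nat.cast_le.2 h1) (by positivity)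
  obtain ⟨a, ha⟩ := eventually_atTop.1 hev
  filter_upwards [eventually_ge_atTop (a + n₁)] with n hn
  have := ha (n - n₁) (by omega)
  rwa [Nat.sub_add_cancel (by omega)] at this

end IsSuperadditiveFamily

/-! ### Bases adapted to a chain of subspaces -/

section AdaptedBasis

variable {K V : Type*} [Field K] [AddCommGroup V] [Module K V]

/-- A chain of subspaces of a finite-dimensional space has an adapted linearly independent set. -/
theorem exists_linearIndepOn_adapted [FiniteDimensional K V] {𝒞 : Set (Submodule K V)}
    (h𝒞 : IsChain (· ≤ ·) 𝒞) {W : Submodule K V} (hW : W ∈ 𝒞) :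
    ∃ s : Set V, s ⊆ W ∧ LinearIndepOn K id s ∧
      ∀ W' ∈ 𝒞, W' ≤ W → Submodule.span K (s ∩ W') = W' := by
  induction hk : Module.finrank K W using Nat.strong_induction_on generalizing W with
  | _ k ih =>
    have hext : ∀ s₀ : Set V, s₀ ⊆ W → LinearIndepOn K id s₀ →
        (∀ W' ∈ 𝒞, W' < W → W' ≤ Submodule.span K (s₀ ∩ W')) →
        ∃ s : Set V, s ⊆ W ∧ LinearIndepOn K id s ∧
          ∀ W' ∈ 𝒞, W' ≤ W → Submodule.span K (s ∩ W') = W' := by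
      intro s₀ hs₀ hli hsp
      obtain ⟨s, hs₀s, hsW, hWs, hs⟩ := exists_linearIndepOn_id_extension hli hs₀
      refine ⟨s, hs₀s, hs, fun W' hW' hle => le_antisymm ?_ ?_⟩
      · rw [Submodule.span_le]; exact Set.inter_subset_right
      · rcases hle.eq_or_lt with rfl | hlt
        · rw [Set.inter_eq_left.2 hs₀s]; exact hWs
        · exact (hsp W' hW' hlt).trans
            (Submodule.span_mono (Set.inter_subset_inter_left _ hsW))
    by_cases hex : ∃ W₁ ∈ 𝒞, W₁ < W
    · let P : Set (Submodule K V) := {W₁ | W₁ ∈ 𝒞 ∧ W₁ < W}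
      have hP : P.Nonempty := hex
      obtain ⟨W₁, ⟨hW₁, hlt⟩, hmax⟩ := (wellFounded_gt (α := Submodule K V)).has_min P hP
      obtain ⟨s₀, hs₀, hli, hsp⟩ := ih _ (hk ▸ Submodule.finrank_lt_finrank_of_lt hlt) hW₁ rfl
      refine hext s₀ (hs₀.trans hlt.le) hli fun W' hW' hlt' => ?_
      refine (hsp W' hW' ?_).ge
      rcases h𝒞.total hW' hW₁ with h | h
      · exact h
      · exact (h.lt_or_eq.resolve_left (hmax W' ⟨hW', hlt'⟩)).ge
    · push Not at hex
      exact hext ∅ (Set.empty_subset _) (linearIndepOn_empty K id)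
        fun W' hW' hlt => absurd hlt (hex W' hW')

end AdaptedBasis

/-! ### Filtrations, adapted bases and their measures -/

namespace RFiltration

variable {K V : Type*} [Field K] [AddCommGroup V] [Module K V] {F : RFiltration K V}

theorem IsExhaustive.exists_mem (hF : F.IsExhaustive) (x : V) : ∃ r, x ∈ F.sub r := by
  have : x ∈ ⋃ r : ℝ, (F.sub r : Set V) := hF ▸ Set.mem_univ x
  simpa using this

theorem IsSeparated.exists_notMem (hF : F.IsSeparated) {x : V} (hx : x ≠ 0) :
    ∃ r, x ∉ F.sub r := by
  by_contra! h
  have : x ∈ ⨅ r : ℝ, F.sub r := Submodule.mem_iInf _ |>.2 h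
  rw [hF] at this
  exact hx (by simpa using this)

theorem mem_sub_iff_le_index (hl : F.IsLeftContinuous) (x : V) (r : ℝ) :
    x ∈ F.sub r ↔ (r : EReal) ≤ F.index x := by
  refine ⟨fun h => le_sSup ⟨r, h, rfl⟩, fun h => ?_⟩
  rw [hl r]
  simp only [Submodule.mem_iInf]
  intro s hsr
  have : (s : EReal) < F.index x := lt_of_lt_of_le (EReal.coe_lt_coe_iff.2 hsr) h
  obtain ⟨_, ⟨t, ht, rfl⟩, hst⟩ := lt_sSup_iff.1 this
  exact F.anti (EReal.coe_lt_coe_iff.1 hst).le ht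

theorem mem_sub_iff (hs : F.IsSeparated) (he : F.IsExhaustive)
    (hl : F.IsLeftContinuous) {x : V} (hx : x ≠ 0) (r : ℝ) :
    x ∈ F.sub r ↔ r ≤ (F.index x).toReal := by
  rw [mem_sub_iff_le_index hl]
  obtain ⟨a, ha⟩ := he.exists_mem x
  obtain ⟨b, hb⟩ := hs.exists_notMem hx
  rw [mem_sub_iff_le_index hl] at ha hb
  have hbot : F.index x ≠ ⊥ := fun h => by simp [h] at ha
  have htop : F.index x ≠ ⊤ := fun h => by simp [h] at hb
  conv_lhs => rw [← EReal.coe_toReal htop hbot]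
  exact EReal.coe_le_coe_iff

theorem IsSeparated.exists_sub_eq_bot [FiniteDimensional K V] (hF : F.IsSeparated) :
    ∃ r, F.sub r = ⊥ := by
  obtain ⟨_, ⟨r, rfl⟩, hmin⟩ :=
    (wellFounded_lt (α := Submodule K V)).has_min (Set.range F.sub) (Set.range_nonempty _)
  refine ⟨r, le_antisymm ?_ bot_le⟩
  rw [← hF]
  refine le_iInf fun s => ?_
  have h1 := F.anti (le_max_left r s)
  rw [← h1.lt_or_eq.resolve_left (hmin _ ⟨_, rfl⟩)]
  exact F.anti (le_max_right r s)

theorem IsExhaustive.exists_sub_eq_top [FiniteDimensional K V] (hF : F.IsExhaustive) :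
    ∃ r, F.sub r = ⊤ := by
  obtain ⟨_, ⟨r, rfl⟩, hmax⟩ :=
    (wellFounded_gt (α := Submodule K V)).has_min (Set.range F.sub) (Set.range_nonempty _)
  refine ⟨r, eq_top_iff.2 fun x _ => ?_⟩
  obtain ⟨s, hs⟩ := hF.exists_mem x
  have h1 := F.anti (min_le_left r s)
  rw [h1.lt_or_eq.resolve_left (hmax _ ⟨_, rfl⟩)]
  exact F.anti (min_le_right r s) hs

open Classical in
theorem card_basis_mem_le [FiniteDimensional K V] (e : Module.Basis (Fin (Module.finrank K V)) K V)
    (W : Submodule K V) :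
    (Finset.univ.filter fun i => e i ∈ W).card ≤ Module.finrank K W := by
  have hli : LinearIndependent K fun i : {i // e i ∈ W} => (⟨e i, i.2⟩ : W) := by
    apply LinearIndependent.of_comp W.subtype
    exact e.linearIndependent.comp (fun i : {i // e i ∈ W} => i.1) Subtype.val_injective
  have := hli.fintype_card_le_finrank
  rwa [Fintype.card_subtype] at this

open Classical in
-- An adapted basis attains the upper bound `card_basis_mem_le` at every level at once, which yields
-- a maximal basis and the formula for its measure.
theorem exists_adapted_basis [FiniteDimensional K V] (F : RFiltration K V) :
    ∃ e : Module.Basis (Fin (Module.finrank K V)) K V, ∀ r,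
      (Finset.univ.filter fun i => e i ∈ F.sub r).card = Module.finrank K (F.sub r) := by
  have hchain : IsChain (· ≤ ·) (insert ⊤ (Set.range F.sub)) := by
    refine IsChain.insert ?_ fun W _ _ => Or.inr le_top
    rintro _ ⟨r, rfl⟩ _ ⟨s, rfl⟩ _
    rcases le_total r s with h | h
    · exact Or.inr (F.anti h)
    · exact Or.inl (F.anti h)
  obtain ⟨s, -, hli, hsp⟩ := exists_linearIndepOn_adapted hchain (Set.mem_insert _ _)
  have hspan : Submodule.span K s = ⊤ := by
    simpa using hsp ⊤ (Set.mem_insert _ _) le_rfl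
  let b : Module.Basis s K V := Module.Basis.mk hli (by simpa using hspan.ge)
  have : Fintype s := FiniteDimensional.fintypeBasisIndex b
  let ε : s ≃ Fin (Module.finrank K V) :=
    Fintype.equivFinOfCardEq (Module.finrank_eq_card_basis b).symm
  refine ⟨b.reindex ε, fun r => le_antisymm (card_basis_mem_le _ _) ?_⟩
  have h1 : Submodule.span K ((Finset.univ.filter fun i => b.reindex ε i ∈ F.sub r).image
      (b.reindex ε) : Set V) = F.sub r := by
    refine Eq.trans ?_ (hsp (F.sub r) (Set.mem_insert_of_mem _ ⟨r, rfl⟩) le_top)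
    congr 1
    ext x
    simp only [Finset.coe_image, Set.mem_image, Finset.coe_filter, Set.mem_ofPred_eq,
      Finset.mem_univ, true_and, Set.mem_inter_iff, SetLike.mem_coe, Module.Basis.reindex_apply]
    constructor
    · rintro ⟨i, hi, rfl⟩
      exact ⟨by simp [b], hi⟩
    · rintro ⟨hx, hxr⟩
      refine ⟨ε ⟨x, hx⟩, ?_, by simp [b]⟩
      simpa [b] using hxr
  have h2 := finrank_span_finset_le_card (R := K)
    ((Finset.univ.filter fun i => b.reindex ε i ∈ F.sub r).image (b.reindex ε))
  rw [Set.finrank, h1] at h2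
  exact h2.trans Finset.card_image_le

theorem basisMeasure_Ici [FiniteDimensional K V] (hs : F.IsSeparated) (he : F.IsExhaustive)
    (hl : F.IsLeftContinuous) (e : Module.Basis (Fin (Module.finrank K V)) K V) (r : ℝ) :
    F.basisMeasure e (Set.Ici r) = (Module.finrank K V : ℝ≥0∞)⁻¹ *
      (open Classical in (Finset.univ.filter fun i => e i ∈ F.sub r).card) := by
  classical
  rw [basisMeasure, Measure.smul_apply, smul_eq_mul, Measure.finsetSum_apply]
  congr 1
  rw [Finset.card_filter]
  push_cast
  refine Finset.sum_congr rfl fun i _ => ?_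
  rw [Measure.dirac_apply' _ measurableSet_Ici, Set.indicator_apply]
  simp [mem_sub_iff hs he hl (e.ne_zero i)]

theorem measure_eq_basisMeasure [FiniteDimensional K V] (hs : F.IsSeparated) (he : F.IsExhaustive)
    (hl : F.IsLeftContinuous) :
    ∃ e : Module.Basis (Fin (Module.finrank K V)) K V, F.measure = F.basisMeasure e ∧
      F.IsMaximalBasis e := by
  classical
  obtain ⟨e, he'⟩ := F.exists_adapted_basis
  have hmax : F.IsMaximalBasis e := by
    intro e' r
    rw [basisMeasure_Ici hs he hl, basisMeasure_Ici hs he hl, he' r]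
    gcongr
    exact card_basis_mem_le e' _
  have hex : ∃ e : Module.Basis (Fin (Module.finrank K V)) K V, F.IsMaximalBasis e := ⟨e, hmax⟩
  exact ⟨hex.choose, dif_pos hex, hex.choose_spec⟩

theorem measure_Ici [FiniteDimensional K V] (hs : F.IsSeparated) (he : F.IsExhaustive)
    (hl : F.IsLeftContinuous) (r : ℝ) :
    F.measure (Set.Ici r) =
      (Module.finrank K V : ℝ≥0∞)⁻¹ * Module.finrank K (F.sub r) := by
  classical
  obtain ⟨e, heq, hmax⟩ := measure_eq_basisMeasure hs he hl
  obtain ⟨e', he'⟩ := F.exists_adapted_basis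
  rw [heq]
  refine le_antisymm ?_ ?_
  · rw [basisMeasure_Ici hs he hl]
    gcongr
    exact card_basis_mem_le e _
  · have := hmax e' r
    rwa [basisMeasure_Ici hs he hl e', he' r] at this

theorem isProbabilityMeasure_measure [FiniteDimensional K V] [Nontrivial V] (hs : F.IsSeparated)
    (he : F.IsExhaustive) (hl : F.IsLeftContinuous) : IsProbabilityMeasure F.measure := by
  obtain ⟨e, heq, -⟩ := measure_eq_basisMeasure hs he hl
  refine ⟨?_⟩
  rw [heq, basisMeasure, Measure.smul_apply, smul_eq_mul, Measure.finsetSum_apply]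
  simp only [measure_univ, Finset.sum_const, Finset.card_univ, Fintype.card_fin, nsmul_eq_mul,
    mul_one]
  refine ENNReal.inv_mul_cancel ?_ (ENNReal.natCast_ne_top _)
  exact_mod_cast Module.finrank_pos.ne'

end RFiltration

/-! ### Dilated measures, tail functions and quantiles -/

theorem dilate_Ici {ν : Measure ℝ} {n : ℕ} (hn : 0 < n) (t : ℝ) :
    dilate (1 / (n : ℝ)) ν (Set.Ici t) = ν (Set.Ici (t * n)) := by
  have hn' : (0 : ℝ) < n := by positivity
  rw [dilate, Measure.map_apply (by fun_prop) measurableSet_Ici]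
  congr 1
  ext x
  simp only [Set.mem_preimage, Set.mem_Ici]
  rw [one_div, inv_mul_eq_div, le_div_iff₀ hn']

instance isProbabilityMeasure_dilate {ν : Measure ℝ} [IsProbabilityMeasure ν] (ε : ℝ) :
    IsProbabilityMeasure (dilate ε ν) :=
  Measure.isProbabilityMeasure_map (by fun_prop)

/-- A nonincreasing function equal to `1` before `-M` and to `0` after `M`. -/
structure IsTailFunction (τ : ℝ → ℝ) (M : ℝ) : Prop where
  anti : Antitone τ
  eq_one : ∀ x < -M, τ x = 1
  eq_zero : ∀ x, M < x → τ x = 0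

namespace IsTailFunction

variable {τ : ℝ → ℝ} {M : ℝ} (h : IsTailFunction τ M)
include h

theorem bddAbove {s : ℝ} (hs : 0 < s) : BddAbove {x | s < τ x} := by
  refine ⟨M, fun x hx => ?_⟩
  by_contra hlt
  have : s < τ x := hx
  rw [h.eq_zero x (not_le.1 hlt)] at this
  exact lt_asymm hs this

theorem mem_of_lt {s x : ℝ} (hs : s < 1) (hx : x < -M) : x ∈ {x | s < τ x} := by
  change s < τ x
  rwa [h.eq_one x hx]

theorem nonempty {s : ℝ} (hs : s < 1) : {x | s < τ x}.Nonempty :=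
  ⟨-M - 1, h.mem_of_lt hs (by linarith)⟩

theorem le_quasiInverse {s x : ℝ} (hs : 0 < s) (hx : s < τ x) : x ≤ quasiInverse τ s :=
  le_csSup (h.bddAbove hs) hx

theorem lt_of_lt_quasiInverse {s x : ℝ} (hs : s < 1) (hx : x < quasiInverse τ s) : s < τ x := by
  obtain ⟨y, hy, hxy⟩ := exists_lt_of_lt_csSup (h.nonempty hs) hx
  exact lt_of_lt_of_le hy (h.anti hxy.le)

theorem quasiInverse_le {s y : ℝ} (hs : s < 1) (hy : τ y ≤ s) : quasiInverse τ s ≤ y := by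
  by_contra hlt
  exact (h.lt_of_lt_quasiInverse hs (not_le.1 hlt)).not_ge hy

theorem abs_quasiInverse_le {s : ℝ} (hs : s ∈ Set.Ioo (0 : ℝ) 1) : |quasiInverse τ s| ≤ M := by
  rw [abs_le]
  constructor
  · refine le_of_forall_lt fun x hx => ?_
    obtain ⟨y, hxy, hy⟩ := exists_between hx
    exact hxy.trans_le (le_csSup (h.bddAbove hs.1) (h.mem_of_lt hs.2 hy))
  · refine le_of_forall_gt_imp_ge_of_dense fun y hy => ?_
    exact h.quasiInverse_le hs.2 (by rw [h.eq_zero y hy]; exact hs.1.le)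

theorem antitoneOn : AntitoneOn (quasiInverse τ) (Set.Ioo 0 1) := fun _ hs _ ht hst =>
  csSup_le_csSup (h.bddAbove hs.1) (h.nonempty ht.2) fun _ hx => lt_of_le_of_lt hst hx

theorem aemeasurable :
    AEMeasurable (quasiInverse τ) (volume.restrict (Set.Ioo (0 : ℝ) 1)) :=
  aemeasurable_restrict_of_antitoneOn measurableSet_Ioo h.antitoneOn

theorem integrableOn : IntegrableOn (quasiInverse τ) (Set.Ioo (0 : ℝ) 1) := by
  refine Integrable.of_bound h.aemeasurable.aestronglyMeasurable M ?_
  filter_upwards [ae_restrict_mem measurableSet_Ioo] with s hs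
  exact h.abs_quasiInverse_le hs

theorem intervalIntegrable {a b : ℝ} (ha : a ∈ Set.Icc (0 : ℝ) 1) (hb : b ∈ Set.Icc (0 : ℝ) 1) :
    IntervalIntegrable (quasiInverse τ) volume a b := by
  have h1 : IntegrableOn (quasiInverse τ) (Set.Icc (0 : ℝ) 1) :=
    (integrableOn_Icc_iff_integrableOn_Ioo (by simp) (by simp)).2 h.integrableOn
  refine (h1.mono_set ?_).intervalIntegrable
  exact Set.uIcc_subset_Icc ha hb

/-- The integrand is nonincreasing on the open interval, so its value at the middle point separates
adjacent slopes. Values at the endpoints may be junk and do not matter. -/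
theorem concaveOn_integral :
    ConcaveOn ℝ (Set.Icc 0 1) fun t => ∫ s in (0 : ℝ)..t, quasiInverse τ s := by
  refine concaveOn_of_slope_anti_adjacent (convex_Icc 0 1) ?_
  intro x y z hx hz hxy hyz
  have h0 : (0 : ℝ) ∈ Set.Icc (0 : ℝ) 1 := ⟨le_rfl, zero_le_one⟩
  have hy : y ∈ Set.Icc (0 : ℝ) 1 := ⟨hx.1.trans hxy.le, hyz.le.trans hz.2⟩
  have hy' : y ∈ Set.Ioo (0 : ℝ) 1 := ⟨hx.1.trans_lt hxy, hyz.trans_le hz.2⟩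
  rw [intervalIntegral.integral_interval_sub_left (h.intervalIntegrable h0 hz)
    (h.intervalIntegrable h0 hy), intervalIntegral.integral_interval_sub_left
    (h.intervalIntegrable h0 hy) (h.intervalIntegrable h0 hx)]
  have h1 : ∫ s in y..z, quasiInverse τ s ≤ ∫ s in y..z, quasiInverse τ y :=
    intervalIntegral.integral_mono_on_of_le_Ioo hyz.le (h.intervalIntegrable hy hz)
      intervalIntegrable_const fun s hs =>
        h.antitoneOn hy' ⟨hy'.1.trans hs.1, hs.2.trans_le hz.2⟩ hs.1.le
  have h2 : ∫ s in x..y, quasiInverse τ y ≤ ∫ s in x..y, quasiInverse τ s :=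
    intervalIntegral.integral_mono_on_of_le_Ioo hxy.le intervalIntegrable_const
      (h.intervalIntegrable hx hy) fun s hs =>
        h.antitoneOn ⟨hx.1.trans_lt hs.1, hs.2.trans hy'.2⟩ hy' hs.2.le
  rw [intervalIntegral.integral_const, smul_eq_mul] at h1 h2
  refine le_trans (b := quasiInverse τ y) ?_ ?_
  · rw [div_le_iff₀ (by linarith)]; linarith
  · rw [le_div_iff₀ (by linarith)]; linarith

theorem ae_continuousAt :
    ∀ᵐ s ∂(volume.restrict (Set.Ioo (0 : ℝ) 1)), ContinuousAt (quasiInverse τ) s := by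
  have hc := h.antitoneOn.countable_not_continuousWithinAt
  rw [ae_restrict_iff' measurableSet_Ioo]
  filter_upwards [hc.ae_notMem volume] with s hs hs01
  by_contra hcon
  exact hs ⟨hs01, fun hw => hcon (hw.continuousAt (Ioo_mem_nhds hs01.1 hs01.2))⟩

end IsTailFunction

theorem isTailFunction_measure {ν : Measure ℝ} [IsProbabilityMeasure ν] {M : ℝ}
    (h1 : ∀ x < -M, ν (Set.Ici x) = 1) (h0 : ∀ x, M < x → ν (Set.Ici x) = 0) :
    IsTailFunction (fun x => ν.real (Set.Ioi x)) M where
  anti := fun x y hxy => measureReal_mono (Set.Ioi_subset_Ioi hxy)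
  eq_one := fun x hx => by
    obtain ⟨y, hxy, hy⟩ := exists_between hx
    refine le_antisymm measureReal_le_one ?_
    have := measureReal_mono (μ := ν) (Set.Ici_subset_Ioi.2 hxy)
    rwa [measureReal_def, h1 y hy, ENNReal.toReal_one] at this
  eq_zero := fun x hx => by
    refine le_antisymm ?_ measureReal_nonneg
    have := measureReal_mono (μ := ν) (Set.Ioi_subset_Ici_self (a := x))
    rwa [measureReal_def (s := Set.Ici x), h0 x hx, ENNReal.toReal_zero] at this

instance isProbabilityMeasure_restrict_Ioo :
    IsProbabilityMeasure (volume.restrict (Set.Ioo (0 : ℝ) 1)) := ⟨by simp⟩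

/-- Quantile representation of `ν`. By right continuity of the tail, the quantile exceeds `x`
exactly on the interval from `0` to the mass of `(x, ∞)`. -/
theorem map_quasiInverse_eq {ν : Measure ℝ} [IsProbabilityMeasure ν] {M : ℝ}
    (h : IsTailFunction (fun x => ν.real (Set.Ioi x)) M) :
    (volume.restrict (Set.Ioo (0 : ℝ) 1)).map (quasiInverse fun x => ν.real (Set.Ioi x)) = ν := by
  have : IsProbabilityMeasure ((volume.restrict (Set.Ioo (0 : ℝ) 1)).map
      (quasiInverse fun x => ν.real (Set.Ioi x))) :=
    Measure.isProbabilityMeasure_map h.aemeasurable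
  refine Measure.ext_of_Iic _ _ fun x => ?_
  rw [← Set.compl_Ioi, prob_compl_eq_one_sub measurableSet_Ioi, prob_compl_eq_one_sub
    measurableSet_Ioi, Measure.map_apply_of_aemeasurable h.aemeasurable measurableSet_Ioi]
  congr 1
  rw [Measure.restrict_apply₀' measurableSet_Ioo.nullMeasurableSet]
  have hset : quasiInverse (fun x => ν.real (Set.Ioi x)) ⁻¹' Set.Ioi x ∩ Set.Ioo 0 1 =
      Set.Ioo 0 (ν.real (Set.Ioi x)) := by
    ext s
    constructor
    · rintro ⟨hs, hs01⟩
      exact ⟨hs01.1, h.lt_of_lt_quasiInverse hs01.2 hs⟩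
    · rintro ⟨hs0, hs⟩
      refine ⟨?_, hs0, hs.trans_le measureReal_le_one⟩
      have hlim : Tendsto (fun n : ℕ => ν.real (Set.Ioi (x + 1 / (n + 1 : ℝ)))) atTop
          (𝓝 (ν.real (Set.Ioi x))) := by
        have hunion : Set.Ioi x = ⋃ n : ℕ, Set.Ioi (x + 1 / (n + 1 : ℝ)) := by
          ext y
          simp only [Set.mem_Ioi, Set.mem_iUnion]
          constructor
          · intro hy
            obtain ⟨n, hn⟩ := exists_nat_one_div_lt (sub_pos.2 hy)
            exact ⟨n, by linarith⟩
          · rintro ⟨n, hn⟩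
            have : (0 : ℝ) < 1 / (n + 1 : ℝ) := by positivity
            linarith
        have := tendsto_measure_iUnion_atTop (μ := ν)
          (s := fun n : ℕ => Set.Ioi (x + 1 / (n + 1 : ℝ))) (fun a b hab =>
            Set.Ioi_subset_Ioi (by gcongr))
        rw [← hunion] at this
        exact (ENNReal.tendsto_toReal (measure_ne_top _ _)).comp this
      obtain ⟨n, hn⟩ := (hlim.eventually_const_lt hs).exists
      have hpos : (0 : ℝ) < 1 / (n + 1 : ℝ) := by positivity
      exact lt_of_lt_of_le (by linarith) (h.le_quasiInverse hs0 hn)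
  rw [hset, Real.volume_Ioo, sub_zero, measureReal_def, ENNReal.ofReal_toReal (measure_ne_top _ _)]

/-! ### Passage to the limit through quantiles -/

section Limit

variable {Ψ : ℝ → ℝ} {M : ℝ} (hΨ : IsTailFunction Ψ M)
include hΨ

theorem isTailFunction_map_quasiInverse :
    IsTailFunction (fun x => ((volume.restrict (Set.Ioo (0 : ℝ) 1)).map (quasiInverse Ψ)).real
      (Set.Ioi x)) M := by
  have := Measure.isProbabilityMeasure_map hΨ.aemeasurable
  have hval : ∀ x, ((volume.restrict (Set.Ioo (0 : ℝ) 1)).map (quasiInverse Ψ)) (Set.Ici x) =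
      volume (quasiInverse Ψ ⁻¹' Set.Ici x ∩ Set.Ioo 0 1) := fun x => by
    rw [Measure.map_apply_of_aemeasurable hΨ.aemeasurable measurableSet_Ici,
      Measure.restrict_apply₀' measurableSet_Ioo.nullMeasurableSet]
  refine isTailFunction_measure (fun x hx => ?_) fun x hx => ?_
  · rw [hval, Set.inter_eq_right.2]
    · simp
    · intro s hs
      exact hx.le.trans (abs_le.1 (hΨ.abs_quasiInverse_le hs)).1
  · have hempty : quasiInverse Ψ ⁻¹' Set.Ici x ∩ Set.Ioo 0 1 = ∅ := by
      refine Set.eq_empty_of_forall_notMem ?_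
      rintro s ⟨hs, hs01⟩
      exact (hx.trans_le hs).not_ge (abs_le.1 (hΨ.abs_quasiInverse_le hs01)).2
    rw [hval, hempty, measure_empty]

/-- `Ψ` need not be right continuous, so it may differ from the tail of the measure it defines. The
two quantiles nevertheless agree wherever that of `Ψ` is continuous, which excludes only countably
many points. -/
theorem quasiInverse_map_quasiInverse :
    ∀ᵐ s ∂(volume.restrict (Set.Ioo (0 : ℝ) 1)),
      quasiInverse (fun x => ((volume.restrict (Set.Ioo (0 : ℝ) 1)).map (quasiInverse Ψ)).real
        (Set.Ioi x)) s = quasiInverse Ψ s := by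
  have hμ := isTailFunction_map_quasiInverse hΨ
  have hval : ∀ x, ((volume.restrict (Set.Ioo (0 : ℝ) 1)).map (quasiInverse Ψ)).real (Set.Ioi x) =
      volume.real (quasiInverse Ψ ⁻¹' Set.Ioi x ∩ Set.Ioo 0 1) := fun x => by
    rw [measureReal_def, measureReal_def,
      Measure.map_apply_of_aemeasurable hΨ.aemeasurable measurableSet_Ioi,
      Measure.restrict_apply₀' measurableSet_Ioo.nullMeasurableSet]
  filter_upwards [hΨ.ae_continuousAt, ae_restrict_mem measurableSet_Ioo] with s hs hs01
  have hfin : ∀ x, volume (quasiInverse Ψ ⁻¹' Set.Ioi x ∩ Set.Ioo 0 1) ≠ ⊤ := fun x =>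
    ((measure_mono Set.inter_subset_right).trans_lt (by simp)).ne
  refine le_antisymm ?_ ?_
  · refine hμ.quasiInverse_le hs01.2 ?_
    rw [hval]
    have hsub : quasiInverse Ψ ⁻¹' Set.Ioi (quasiInverse Ψ s) ∩ Set.Ioo 0 1 ⊆ Set.Ioo 0 s := by
      rintro s' ⟨h1, h2⟩
      refine ⟨h2.1, ?_⟩
      by_contra hle
      exact (hΨ.antitoneOn hs01 h2 (not_lt.1 hle)).not_gt h1
    have := measureReal_mono (μ := volume) hsub (by simp)
    simpa [hs01.1.le] using this
  · refine le_of_forall_lt fun y hy => ?_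
    obtain ⟨y', hyy', hy'⟩ := exists_between hy
    refine hyy'.trans_le (hμ.le_quasiInverse hs01.1 ?_)
    have hnhds : ∀ᶠ s' in 𝓝[>] s, y' < quasiInverse Ψ s' ∧ s' < 1 :=
      nhdsWithin_le_nhds ((hs.eventually_const_lt hy').and (gt_mem_nhds hs01.2))
    obtain ⟨s', ⟨h1, h2⟩, h3⟩ := (hnhds.and self_mem_nhdsWithin).exists
    rw [hval]
    have h3' : s < s' := h3
    have hsub : Set.Ioo 0 s' ⊆ quasiInverse Ψ ⁻¹' Set.Ioi y' ∩ Set.Ioo 0 1 := by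
      intro r hr
      exact ⟨h1.trans_le (hΨ.antitoneOn ⟨hr.1, hr.2.trans h2⟩ ⟨hs01.1.trans h3', h2⟩ hr.2.le),
        hr.1, hr.2.trans h2⟩
    have := measureReal_mono (μ := volume) hsub (hfin y')
    have h5 : volume.real (Set.Ioo 0 s') = s' := by simp [(hs01.1.trans h3').le]
    linarith

variable {ν : ℕ → Measure ℝ} (hν : ∀ n, 1 ≤ n → IsProbabilityMeasure (ν n))
  (hτ : ∀ n, 1 ≤ n → IsTailFunction (fun x => (ν n).real (Set.Ioi x)) M)
  (hsup : ∀ s t ε : ℝ, s < t → 0 < ε → ∀ᶠ n in atTop, (ν n).real (Set.Ici t) < Ψ s + ε)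
  (hinf : ∀ s t ε : ℝ, s < t → 0 < ε → ∀ᶠ n in atTop, Ψ t - ε < (ν n).real (Set.Ici s))
include hν hτ hsup hinf

/-- The bounds compare tails only across a strict gap of levels; continuity of the limiting quantile
at `s` supplies the room for such gaps. -/
theorem ae_tendsto_quasiInverse :
    ∀ᵐ s ∂(volume.restrict (Set.Ioo (0 : ℝ) 1)),
      Tendsto (fun n => quasiInverse (fun x => (ν n).real (Set.Ioi x)) s) atTop
        (𝓝 (quasiInverse Ψ s)) := by
  filter_upwards [hΨ.ae_continuousAt, ae_restrict_mem measurableSet_Ioo] with s hs hs01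
  refine tendsto_order.2 ⟨fun y hy => ?_, fun y hy => ?_⟩
  · obtain ⟨x₂, hyx₂, hx₂⟩ := exists_between hy
    obtain ⟨x₁, hyx₁, hx₁⟩ := exists_between hyx₂
    obtain ⟨y₁, hyy₁, hy₁⟩ := exists_between hyx₁
    have hs₂ := hΨ.lt_of_lt_quasiInverse hs01.2 hx₂
    filter_upwards [hinf x₁ x₂ _ hx₁ (sub_pos.2 hs₂), eventually_ge_atTop 1] with n hn hn1
    have := hν n hn1
    refine hyy₁.trans_le ((hτ n hn1).le_quasiInverse hs01.1 ?_)
    rw [sub_sub_cancel] at hn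
    exact hn.trans_le (measureReal_mono (Set.Ici_subset_Ioi.2 hy₁))
  · have hnhds : ∀ᶠ s' in 𝓝[<] s, quasiInverse Ψ s' < y ∧ 0 < s' :=
      nhdsWithin_le_nhds ((hs.eventually_lt_const hy).and (lt_mem_nhds hs01.1))
    obtain ⟨s', ⟨h1, h2⟩, h3⟩ := (hnhds.and self_mem_nhdsWithin).exists
    have h3' : s' < s := h3
    obtain ⟨x₁, hx₁, hx₁y⟩ := exists_between h1
    obtain ⟨x₂, hx₁₂, hx₂⟩ := exists_between hx₁y
    have hΨx : Ψ x₁ ≤ s' := by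
      by_contra hlt
      exact (hΨ.le_quasiInverse h2 (not_le.1 hlt)).not_gt hx₁
    filter_upwards [hsup x₁ x₂ _ hx₁₂ (sub_pos.2 h3'), eventually_ge_atTop 1] with n hn hn1
    have := hν n hn1
    refine lt_of_le_of_lt ((hτ n hn1).quasiInverse_le hs01.2 ?_) hx₂
    refine (measureReal_mono Set.Ioi_subset_Ici_self).trans (hn.le.trans ?_)
    linarith

theorem tendstoVaguely_map_quasiInverse :
    TendstoVaguely ν ((volume.restrict (Set.Ioo (0 : ℝ) 1)).map (quasiInverse Ψ)) := by
  intro g hg hgc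
  obtain ⟨C, hC⟩ := hgc.exists_bound_of_continuous hg
  rw [integral_map hΨ.aemeasurable hg.aestronglyMeasurable]
  have key : Tendsto (fun n => ∫ s in Set.Ioo (0 : ℝ) 1,
      g (quasiInverse (fun x => (ν n).real (Set.Ioi x)) s)) atTop
      (𝓝 (∫ s in Set.Ioo (0 : ℝ) 1, g (quasiInverse Ψ s))) := by
    refine tendsto_integral_filter_of_dominated_convergence (fun _ => C) ?_ ?_
      (integrable_const C) ?_
    · filter_upwards [eventually_ge_atTop 1] with n hn
      exact (hg.measurable.comp_aemeasurable (hτ n hn).aemeasurable).aestronglyMeasurable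
    · exact Eventually.of_forall fun n => Eventually.of_forall fun s => hC _
    · filter_upwards [ae_tendsto_quasiInverse hΨ hν hτ hsup hinf] with s hs
      exact (hg.tendsto _).comp hs
  refine key.congr' ?_
  filter_upwards [eventually_ge_atTop 1] with n hn
  have := hν n hn
  conv_rhs => rw [← map_quasiInverse_eq (hτ n hn)]
  rw [integral_map (hτ n hn).aemeasurable hg.aestronglyMeasurable]

/-- On `[0, 1]` the difference of two polygons is at most the `L¹` distance of their quantiles, a
bound independent of `t`. -/
theorem tendstoUniformlyOn_polygon :
    TendstoUniformlyOn (fun n => polygon (ν n))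
      (polygon ((volume.restrict (Set.Ioo (0 : ℝ) 1)).map (quasiInverse Ψ))) atTop
      (Set.Icc 0 1) := by
  set μ := (volume.restrict (Set.Ioo (0 : ℝ) 1)).map (quasiInverse Ψ) with hμdef
  have hμ := isTailFunction_map_quasiInverse hΨ
  rw [← hμdef] at hμ
  set q : ℝ → ℝ := quasiInverse fun x => μ.real (Set.Ioi x) with hq
  let qn : ℕ → ℝ → ℝ := fun n => quasiInverse fun x => (ν n).real (Set.Ioi x)
  have hlim : Tendsto (fun n => ∫ s in Set.Ioo (0 : ℝ) 1, |qn n s - q s|) atTop (𝓝 0) := by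
    have := tendsto_integral_filter_of_dominated_convergence
      (μ := volume.restrict (Set.Ioo (0 : ℝ) 1)) (l := atTop)
      (F := fun n s => |qn n s - q s|) (f := fun _ => 0) (fun _ => M + M) ?_ ?_
      (integrable_const _) ?_
    · simpa using this
    · filter_upwards [eventually_ge_atTop 1] with n hn
      exact ((hτ n hn).aemeasurable.sub hμ.aemeasurable).aestronglyMeasurable.norm
    · filter_upwards [eventually_ge_atTop 1] with n hn
      filter_upwards [ae_restrict_mem measurableSet_Ioo] with s hs
      rw [Real.norm_eq_abs, abs_abs]
      exact (abs_sub _ _).trans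
        (add_le_add ((hτ n hn).abs_quasiInverse_le hs) (hμ.abs_quasiInverse_le hs))
    · filter_upwards [ae_tendsto_quasiInverse hΨ hν hτ hsup hinf,
        quasiInverse_map_quasiInverse hΨ] with s hs hs'
      have h1 : q s = quasiInverse Ψ s := hs'
      rw [h1]
      simpa using (hs.sub_const (quasiInverse Ψ s)).abs
  rw [Metric.tendstoUniformlyOn_iff]
  intro ε hε
  filter_upwards [hlim.eventually_lt_const hε, eventually_ge_atTop 1] with n hn hn1 t ht
  refine lt_of_le_of_lt ?_ hn
  have h0 : (0 : ℝ) ∈ Set.Icc (0 : ℝ) 1 := ⟨le_rfl, zero_le_one⟩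
  rw [dist_comm, Real.dist_eq, polygon, polygon, ← intervalIntegral.integral_sub
    ((hτ n hn1).intervalIntegrable h0 ht) (hμ.intervalIntegrable h0 ht)]
  have hint : IntegrableOn (fun s => |qn n s - q s|) (Set.Ioo (0 : ℝ) 1) :=
    ((hτ n hn1).integrableOn.sub hμ.integrableOn).abs
  refine (intervalIntegral.abs_integral_le_integral_abs ht.1).trans ?_
  rw [intervalIntegral.integral_of_le ht.1, ← integral_Ioc_eq_integral_Ioo]
  refine setIntegral_mono_set ((integrableOn_Ioc_iff_integrableOn_Ioo (by simp)).2 hint) ?_ ?_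
  · exact Eventually.of_forall fun s => abs_nonneg _
  · exact (Set.Ioc_subset_Ioc_right ht.2).eventuallyLE

end Limit

/-! ### The asymptotic dimension profile -/

section AsymptoticDimension

universe u v

variable {K : Type v} {B : Type u} [Field K] [CommRing B] [IsDomain B] [Algebra K B]
  (𝓑 : ℕ → Submodule K B) [GradedAlgebra 𝓑]

/-- Eventual bounds on a sequence of profiles pass to its quotient by a sequence with positive
limit. -/
theorem eventually_bounds_div {b : ℕ → ℝ → ℝ} {D : ℕ → ℝ} {Φ : ℝ → ℝ} {V : ℝ} (hV : 0 < V)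
    (hD : Tendsto D atTop (𝓝 V))
    (hup : ∀ s t ε : ℝ, s < t → 0 < ε → ∀ᶠ n in atTop, b n t < Φ s + ε)
    (hlow : ∀ s t ε : ℝ, s < t → 0 < ε → ∀ᶠ n in atTop, Φ t - ε < b n s) :
    (∀ s t ε : ℝ, s < t → 0 < ε → ∀ᶠ n in atTop, b n t / D n < Φ s / V + ε) ∧
      ∀ s t ε : ℝ, s < t → 0 < ε → ∀ᶠ n in atTop, Φ t / V - ε < b n s / D n := by
  refine ⟨fun s t ε hst hε => ?_, fun s t ε hst hε => ?_⟩
  · have hε' : 0 < ε * V / 2 := by positivity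
    have hlim : Tendsto (fun n => (Φ s + ε * V / 2) / D n) atTop (𝓝 ((Φ s + ε * V / 2) / V)) :=
      tendsto_const_nhds.div hD hV.ne'
    have hlt : (Φ s + ε * V / 2) / V < Φ s / V + ε := by
      rw [add_div, mul_div_right_comm, mul_div_cancel_right₀ _ hV.ne']; linarith
    filter_upwards [hup s t _ hst hε', hlim.eventually_lt_const hlt, hD.eventually_const_lt hV]
      with n h1 h2 h3
    exact (div_lt_div_of_pos_right h1 h3).trans h2
  · have hε' : 0 < ε * V / 2 := by positivity
    have hlim : Tendsto (fun n => (Φ t - ε * V / 2) / D n) atTop (𝓝 ((Φ t - ε * V / 2) / V)) :=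
      tendsto_const_nhds.div hD hV.ne'
    have hlt : Φ t / V - ε < (Φ t - ε * V / 2) / V := by
      rw [sub_div, mul_div_right_comm, mul_div_cancel_right₀ _ hV.ne']; linarith
    filter_upwards [hlow s t _ hst hε', hlim.eventually_const_lt hlt, hD.eventually_const_lt hV]
      with n h1 h2 h3
    exact h2.trans (div_lt_div_of_pos_right h1 h3)

/-- A bounded superadditive filtration of a graded domain has an asymptotic dimension profile. -/
theorem exists_isTailFunction_finrank (hft : Algebra.FiniteType K B)
    (hgen : Algebra.adjoin K (𝓑 1 : Set B) = ⊤) {x : B} (hx : x ∈ 𝓑 1) (hx0 : x ≠ 0)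
    (W : ℕ → ℝ → Submodule K B) {N : ℕ} (hN : 1 ≤ N) {f : ℕ → ℝ≥0} (hf : Monotone f)
    (hsum : Summable fun i : ℕ => f (2 ^ i) / 2 ^ i) (hW : ∀ n t, W n t ≤ 𝓑 n)
    (hanti : ∀ n, Antitone (W n))
    (hmul : ∀ n m, N ≤ n → N ≤ m → ∀ s t, ∀ a ∈ W n s, ∀ b ∈ W m t,
      a * b ∈ W (n + m) (s + t - f n - f m)) {A : ℝ}
    (htop : ∀ n, N ≤ n → W n (-(A * n)) = 𝓑 n)
    (hbot : ∀ n, N ≤ n → ∀ t, A * n < t → W n t = ⊥) :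
    ∃ (Ψ : ℝ → ℝ) (M : ℝ), IsTailFunction Ψ M ∧
      (∀ s t ε : ℝ, s < t → 0 < ε → ∀ᶠ n : ℕ in atTop,
        (Module.finrank K (W n (t * n)) : ℝ) / Module.finrank K (𝓑 n) < Ψ s + ε) ∧
      ∀ s t ε : ℝ, s < t → 0 < ε → ∀ᶠ n : ℕ in atTop,
        Ψ t - ε < (Module.finrank K (W n (s * n)) : ℝ) / Module.finrank K (𝓑 n) := by
  obtain ⟨d, T, c, E, n₀, u₀, hE, hn₀, -, hTanti, hadd, hbox, hdiff, hsucc, hzero, hTle, hTbot,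
    hle, hge⟩ := exists_lattice_index 𝓑 hft hgen hx hx0 W N f hW hanti hmul
      fun n hn => ⟨_, htop n hn⟩
  have h : IsSuperadditiveFamily T f N c A :=
    { one_le := hN
      monotone := hf
      summable := hsum
      anti := hTanti
      add := hadd
      box := hbox
      gen := hdiff
      succ := hsucc
      zero := hzero
      full := fun n hn t => hTle n _ _ ((hW n t).trans (htop n hn).ge)
      empty := fun n hn t ht => hTbot n t (hbot n hn t ht) }
  obtain ⟨t₀, V, ht₀A, hV, hconst⟩ := h.exists_hullVolume_const
  set Φ := IsSuperadditiveFamily.hullVolume T f N with hΦ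
  have hE' : (0 : ℝ) < E := by exact_mod_cast hE
  have hfd : ∀ n, Module.Finite K (𝓑 n) := finite_graded 𝓑 hft hgen
  have hfdW : ∀ n t, Module.Finite K (W n t) := fun n t =>
    Submodule.finiteDimensional_of_le (hW n t)
  let b : ℕ → ℝ → ℝ := fun n t => (Module.finrank K (W n (t * n)) : ℝ) / (E * n ^ d)
  have hup : ∀ s t ε : ℝ, s < t → 0 < ε → ∀ᶠ n in atTop, b n t < Φ s + ε := by
    intro s t ε hst hε
    filter_upwards [h.eventually_ncard_lt hst hε, eventually_gt_atTop 0] with n hn hn0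
    have hn' : (0 : ℝ) < n := by exact_mod_cast hn0
    refine lt_of_le_of_lt ?_ hn
    have h1 : (Module.finrank K (W n (t * n)) : ℝ) ≤ E * (T n (t * n)).ncard := by
      exact_mod_cast hle n (t * n)
    change (Module.finrank K (W n (t * n)) : ℝ) / (E * n ^ d) ≤ _
    rw [div_le_div_iff₀ (by positivity) (by positivity)]
    nlinarith [pow_pos hn' d]
  have hratio : Tendsto (fun m : ℕ => ((m : ℝ) / (m + n₀ : ℕ)) ^ d) atTop (𝓝 1) := by
    have := (tendsto_natCast_div_add_atTop (n₀ : ℝ)).pow d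
    simpa using this
  have hlow : ∀ s t ε : ℝ, s < t → 0 < ε → ∀ᶠ n in atTop, Φ t - ε < b n s := by
    intro s t ε hst hε
    obtain ⟨r, hsr, hrt⟩ := exists_between hst
    -- The intermediate level `r` absorbs the loss caused by the shift of degree by `n₀`.
    have hgap : ∀ᶠ m : ℕ in atTop,
        s * (m + n₀ : ℕ) ≤ r * m + u₀ - f m - f n₀ := by
      have h1 : Tendsto (fun m : ℕ => (f m : ℝ) / m + (s * n₀ - u₀ + f n₀) / m) atTop
          (𝓝 (0 + 0)) :=
        (tendsto_div_self_of_dyadic hf hsum).add (tendsto_const_div_atTop_nhds_zero_nat _)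
      rw [add_zero] at h1
      filter_upwards [h1.eventually_lt_const (sub_pos.2 hsr), eventually_gt_atTop 0] with m hm hm0
      have hm' : (0 : ℝ) < m := by exact_mod_cast hm0
      rw [← add_div, div_lt_iff₀ hm'] at hm
      push_cast
      linarith
    have hlim : Tendsto (fun m : ℕ => (Φ t - ε / 2) * ((m : ℝ) / (m + n₀ : ℕ)) ^ d) atTop
        (𝓝 ((Φ t - ε / 2) * 1)) := hratio.const_mul _
    rw [mul_one] at hlim
    have hlt : Φ t - ε < Φ t - ε / 2 := by linarith
    rw [← map_add_atTop_eq_nat n₀, eventually_map]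
    filter_upwards [h.eventually_lt_ncard hrt (half_pos hε), hgap,
      hlim.eventually_const_lt hlt, eventually_gt_atTop 0, eventually_ge_atTop N]
      with m h1 h2 h3 hm0 hmN
    have hm' : (0 : ℝ) < m := by exact_mod_cast hm0
    have hmn : (0 : ℝ) < (m + n₀ : ℕ) := by exact_mod_cast Nat.add_pos_left hm0 n₀
    have h4 : E * (T m (r * m)).ncard ≤ Module.finrank K (W (m + n₀) (s * (m + n₀ : ℕ))) :=
      (hge m (r * m) hmN).trans (Submodule.finrank_mono (hanti _ h2))
    have h5 : (E : ℝ) * (T m (r * m)).ncard ≤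
        Module.finrank K (W (m + n₀) (s * (m + n₀ : ℕ))) := by exact_mod_cast h4
    have h6 : (Φ t - ε / 2) * ((m : ℝ) / (m + n₀ : ℕ)) ^ d ≤
        ((T m (r * m)).ncard : ℝ) / m ^ d * ((m : ℝ) / (m + n₀ : ℕ)) ^ d :=
      mul_le_mul_of_nonneg_right h1.le (by positivity)
    refine h3.trans_le (h6.trans ?_)
    change _ ≤ (Module.finrank K (W (m + n₀) (s * (m + n₀ : ℕ))) : ℝ) / (E * (m + n₀ : ℕ) ^ d)
    rw [div_pow, div_mul_div_cancel₀ (by positivity), div_le_div_iff₀ (by positivity)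
      (by positivity)]
    nlinarith [pow_pos hmn d]
  -- The total dimension is read off at a level so low that `W n` is all of `𝓑 n` and the hull
  -- volume is constant; the unit offsets provide the strict gaps of `hup` and `hlow`.
  have hD : Tendsto (fun n : ℕ => (Module.finrank K (𝓑 n) : ℝ) / (E * n ^ d)) atTop (𝓝 V) := by
    have hb : Tendsto (fun n => b n (min t₀ (-A) - 1)) atTop (𝓝 V) := by
      have hm := min_le_left t₀ (-A)
      refine tendsto_order.2 ⟨fun y hy => ?_, fun y hy => ?_⟩
      · filter_upwards [hlow (min t₀ (-A) - 1) (min t₀ (-A)) (V - y) (by linarith)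
          (sub_pos.2 hy)] with n hn
        rwa [hconst _ hm, sub_sub_cancel] at hn
      · filter_upwards [hup (min t₀ (-A) - 2) (min t₀ (-A) - 1) (y - V) (by linarith)
          (sub_pos.2 hy)] with n hn
        rwa [hconst _ (by linarith), add_sub_cancel] at hn
    refine hb.congr' ?_
    filter_upwards [eventually_ge_atTop N] with n hn
    have h1 : W n ((min t₀ (-A) - 1) * n) = 𝓑 n := by
      refine le_antisymm (hW _ _) ((htop n hn).ge.trans (hanti n ?_))
      have h2 : min t₀ (-A) - 1 ≤ -A := by linarith [min_le_right t₀ (-A)]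
      calc (min t₀ (-A) - 1) * n ≤ -A * n := by gcongr
        _ = -(A * n) := by ring
    change (Module.finrank K (W n ((min t₀ (-A) - 1) * n)) : ℝ) / (E * n ^ d) = _
    rw [h1]
  obtain ⟨h1, h2⟩ := eventually_bounds_div hV hD hup hlow
  have hdiv : ∀ t, ∀ᶠ n : ℕ in atTop, b n t / ((Module.finrank K (𝓑 n) : ℝ) / (E * n ^ d)) =
      (Module.finrank K (W n (t * n)) : ℝ) / Module.finrank K (𝓑 n) := by
    intro t
    filter_upwards [eventually_gt_atTop 0] with n hn
    have hn' : (0 : ℝ) < n := by exact_mod_cast hn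
    exact div_div_div_cancel_right₀ (by positivity) _ _
  refine ⟨fun t => Φ t / V, max A (-t₀), ⟨fun s t hst => ?_, fun t ht => ?_, fun t ht => ?_⟩,
    fun s t ε hst hε => ?_, fun s t ε hst hε => ?_⟩
  · exact div_le_div_of_nonneg_right (h.hullVolume_anti hst) hV.le
  · have : t ≤ t₀ := by linarith [le_max_right A (-t₀)]
    change Φ t / V = 1
    rw [hconst t this, div_self hV.ne']
  · rw [hΦ, h.hullVolume_eq_zero (lt_of_le_of_lt (le_max_left _ _) ht), zero_div]
  · filter_upwards [h1 s t ε hst hε, hdiv t] with n hn hn'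
    rwa [hn'] at hn
  · filter_upwards [h2 s t ε hst hε, hdiv s] with n hn hn'
    rwa [hn'] at hn

end AsymptoticDimension

/-! ### Bounds on supports -/

theorem IsTailFunction.mono {τ : ℝ → ℝ} {M M' : ℝ} (h : IsTailFunction τ M) (hM : M ≤ M') :
    IsTailFunction τ M' where
  anti := h.anti
  eq_one := fun x hx => h.eq_one x (by linarith)
  eq_zero := fun x hx => h.eq_zero x (by linarith)

theorem support_subset_Icc {ν : Measure ℝ} [IsProbabilityMeasure ν] {M : ℝ}
    (h1 : ∀ x < -M, ν (Set.Ici x) = 1) (h0 : ∀ x, M < x → ν (Set.Ici x) = 0) :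
    ν.support ⊆ Set.Icc (-M) M := by
  intro x hx
  by_contra hcon
  refine Measure.notMem_support_iff_exists.2 ?_ hx
  rw [Set.mem_Icc, not_and_or, not_le, not_le] at hcon
  rcases hcon with hlt | hlt
  · obtain ⟨y, hxy, hy⟩ := exists_between hlt
    refine ⟨Set.Iio y, Iio_mem_nhds hxy, ?_⟩
    rw [← Set.compl_Ici, prob_compl_eq_one_sub measurableSet_Ici, h1 y hy, tsub_self]
  · obtain ⟨y, hy, hyx⟩ := exists_between hlt
    exact ⟨Set.Ici y, Ici_mem_nhds hyx, h0 y hy⟩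

/-! ### Linear bounds on the indices, and nonvanishing in degree one -/

section LinearBounds

variable {K B : Type*} [Field K] [CommRing B] [Algebra K B]

/-- A superadditive exhaustive filtration of a graded algebra generated in degree one is bounded
below linearly in the degree. -/
theorem exists_linear_lower_bound {𝓑 : ℕ → Submodule K B}
    (hadd : ∀ n m, 𝓑 (n + m) = 𝓑 n * 𝓑 m) {W : ℕ → ℝ → Submodule K B}
    {N : ℕ} (hN : 1 ≤ N) {f : ℕ → ℝ≥0} (hf : Monotone f)
    (hsum : Summable fun i : ℕ => f (2 ^ i) / 2 ^ i) (hanti : ∀ n, Antitone (W n))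
    (hmul : ∀ n m, N ≤ n → N ≤ m → ∀ s t, ∀ a ∈ W n s, ∀ b ∈ W m t,
      a * b ∈ W (n + m) (s + t - f n - f m))
    (hex : ∀ n, N ≤ n → ∃ t, 𝓑 n ≤ W n t) :
    ∃ A : ℝ, ∀ n, N ≤ n → 𝓑 n ≤ W n (-(A * n)) := by
  have hmul' : ∀ n m, N ≤ n → N ≤ m → ∀ s t, 𝓑 n ≤ W n s → 𝓑 m ≤ W m t →
      𝓑 (n + m) ≤ W (n + m) (s + t - f n - f m) := by
    intro n m hn hm s t hs ht
    rw [hadd, Submodule.mul_le]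
    exact fun a ha b hb => hmul n m hn hm s t a (hs ha) b (ht hb)
  choose! t ht using hex
  obtain ⟨m, hm⟩ : ∃ m : ℝ, ∀ r, r < 2 * N → m ≤ t r := by
    obtain ⟨m, hm⟩ := ((Finset.range (2 * N)).image t).bddBelow
    exact ⟨m, fun r hr => hm (Finset.mem_coe.2 (Finset.mem_image_of_mem _ (Finset.mem_range.2 hr)))⟩
  obtain ⟨C, hC⟩ := (tendsto_div_self_of_dyadic hf hsum).bddAbove_range
  have hfC : ∀ n : ℕ, 1 ≤ n → (f n : ℝ) ≤ C * n := fun n hn => by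
    have hn' : (0 : ℝ) < n := by exact_mod_cast hn
    exact (div_le_iff₀ hn').1 (hC ⟨n, rfl⟩)
  have hC0 : 0 ≤ C := le_trans (by positivity) (hC ⟨1, rfl⟩)
  set s := t N - N * dyadicDefect f N with hs
  -- The three terms pay for the `k` blocks of degree `N`, the remaining block, and the two values
  -- of `f` in the last product.
  refine ⟨|s| + |m| + 2 * C, fun n hn => ?_⟩
  have hn1 : (1 : ℝ) ≤ n := by exact_mod_cast hN.trans hn
  have hmn : -(|m| * n) ≤ m := by nlinarith [abs_nonneg m, neg_abs_le m]
  rcases lt_or_ge n (2 * N) with hlt | hge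
  · refine (ht n hn).trans (hanti n (le_trans ?_ (hm n hlt)))
    nlinarith [mul_nonneg (abs_nonneg s) (zero_le_one.trans hn1),
      mul_nonneg hC0 (zero_le_one.trans hn1)]
  -- The remainder is taken in `[N, 2 * N)` rather than `[0, N)`, so that both factors have degree
  -- at least `N`, where the multiplication rule holds.
  · obtain ⟨k, r, hk, hrN, hr, rfl⟩ : ∃ k r, 0 < k ∧ N ≤ r ∧ r < 2 * N ∧ n = k * N + r := by
      have h1 : 2 ≤ n / N := (Nat.le_div_iff_mul_le hN).2 hge
      have h2 := Nat.mod_lt n hN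
      refine ⟨n / N - 1, N + n % N, by omega, by omega, by omega, ?_⟩
      obtain ⟨q, hq⟩ := Nat.exists_eq_add_of_le h1
      have h3 := Nat.div_add_mod n N
      rw [hq] at h3 ⊢
      have h4 : 2 + q - 1 = 1 + q := by omega
      rw [h4]
      linarith
    have hkN : N ≤ k * N := Nat.le_mul_of_pos_left N hk
    have h1 : 𝓑 (k * N) ≤ W (k * N) (k * s) := by
      refine dyadic_superadditive hf hsum hN (Q := fun k t => 𝓑 (k * N) ≤ W (k * N) t)
        (fun k s t hst h => h.trans (hanti _ hst)) (fun k l hk hl s t h h' => ?_) ?_ hk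
      · rw [add_mul]
        exact hmul' _ _ (Nat.le_mul_of_pos_left N hk) (Nat.le_mul_of_pos_left N hl) s t h h'
      · rw [one_mul]; exact ht N le_rfl
    refine (hmul' _ _ hkN hrN _ _ h1 (ht r hrN)).trans (hanti _ ?_)
    have hkle : (k : ℝ) ≤ (k * N + r : ℕ) := by
      exact_mod_cast (Nat.le_mul_of_pos_right k hN).trans (Nat.le_add_right _ _)
    have h2 : (f (k * N) : ℝ) ≤ C * (k * N + r : ℕ) :=
      (NNReal.coe_le_coe.2 (hf (Nat.le_add_right _ _))).trans (hfC _ (hN.trans hn))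
    have h3 : (f r : ℝ) ≤ C * (k * N + r : ℕ) :=
      (NNReal.coe_le_coe.2 (hf (Nat.le_add_left _ _))).trans (hfC _ (hN.trans hn))
    have h4 : -(|s| * (k * N + r : ℕ)) ≤ k * s := by
      have h5 : |s| * k ≤ |s| * (k * N + r : ℕ) := by gcongr
      nlinarith [neg_abs_le s, (Nat.cast_nonneg k : (0 : ℝ) ≤ k)]
    have := hm r hr
    linarith

end LinearBounds

theorem RFiltration.eventually_sub_eq_bot {K : Type*} {V : ℕ → Type*} [Field K]
    [∀ n, AddCommGroup (V n)] [∀ n, Module K (V n)] (F : ∀ n, RFiltration K (V n))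
    (hlim : limsup (fun n : ℕ => ⨆ (a : V n) (_ : a ≠ 0), (F n).index a / (n : EReal)) atTop < ⊤) :
    ∃ C : ℝ, ∀ᶠ n : ℕ in atTop, ∀ t, C * n < t → (F n).sub t = ⊥ := by
  obtain ⟨C, hC, -⟩ := EReal.lt_iff_exists_real_btwn.1 hlim
  refine ⟨C, ?_⟩
  filter_upwards [eventually_lt_of_limsup_lt hC, eventually_gt_atTop 0] with n hn hn0 t ht
  have hn' : (0 : ℝ) < n := by exact_mod_cast hn0
  rw [Submodule.eq_bot_iff]
  intro a ha
  by_contra ha0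
  have h1 : (t : EReal) ≤ (F n).index a := le_sSup ⟨t, ha, rfl⟩
  have h2 : (F n).index a / (n : EReal) < C := (le_iSup₂ (f := fun (a : V n) (_ : a ≠ 0) =>
    (F n).index a / (n : EReal)) a ha0).trans_lt hn
  have h3 : ((t / n : ℝ) : EReal) < C :=
    (EReal.div_le_div_right_of_nonneg (by exact_mod_cast hn'.le) h1).trans_lt h2
  rw [EReal.coe_lt_coe_iff, div_lt_iff₀ hn'] at h3
  exact lt_asymm h3 ht

/-- Without such an element the algebra would be `K` itself, of Krull dimension zero. -/
theorem exists_ne_zero_mem_graded_one {K B : Type*} [Field K] [CommRing B] [IsDomain B]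
    [Algebra K B] {V : Submodule K B} (hgen : Algebra.adjoin K (V : Set B) = ⊤)
    (hdim : 0 < ringKrullDim B) : ∃ x ∈ V, x ≠ 0 := by
  by_contra! h
  have hV : (V : Set B) ⊆ (⊥ : Subalgebra K B) := fun x hx => by
    rw [h x hx]; exact zero_mem _
  have hbot : (⊥ : Subalgebra K B) = ⊤ := top_le_iff.1 (hgen ▸ Algebra.adjoin_le hV)
  have e : K ≃+* B := ((Algebra.botEquiv K B).symm.trans
    ((Subalgebra.equivOfEq _ _ hbot).trans Subalgebra.topEquiv)).toRingEquiv
  rw [← ringKrullDim_eq_of_ringEquiv e, ringKrullDim_eq_zero_of_field] at hdim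
  exact lt_irrefl _ hdim

/-! ### The convergence theorem -/

theorem mainTheorem11 {K B : Type*} [Field K] [CommRing B] [IsDomain B] [Algebra K B]
    (𝓑 : ℕ → Submodule K B) [GradedAlgebra 𝓑]
    (hft : Algebra.FiniteType K B)
    (hgen : Algebra.adjoin K (𝓑 1 : Set B) = ⊤)
    (hdim : 0 < ringKrullDim B)
    (f : ℕ → ℝ≥0) (hf : Monotone f)
    (hsum : Summable (fun α : ℕ => f (2 ^ α) / 2 ^ α))
    (F : ∀ n : ℕ, RFiltration K (𝓑 n))
    (hF : ∀ n : ℕ, 1 ≤ n →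
      (F n).IsSeparated ∧ (F n).IsExhaustive ∧ (F n).IsLeftContinuous)
    (hpf : IsPseudoFiltered 𝓑 f F)
    (hlim : limsup (fun n : ℕ => ⨆ (a : 𝓑 n) (_ : a ≠ 0), (F n).index a / (n : EReal)) atTop < ⊤)
    (ν : ℕ → Measure ℝ)
    (hν : ∀ n : ℕ, 1 ≤ n → ν n = dilate (1 / (n : ℝ)) (F n).measure) :
    (∀ n : ℕ, 1 ≤ n → IsProbabilityMeasure (ν n)) ∧
    (∃ a b : ℝ, ∀ n : ℕ, 1 ≤ n → (ν n).support ⊆ Set.Icc a b) ∧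
    ∃ μ : Measure ℝ, IsProbabilityMeasure μ ∧
      TendstoVaguely ν μ ∧
      ConcaveOn ℝ (Set.Icc 0 1) (polygon μ) ∧
      TendstoUniformlyOn (fun n : ℕ => polygon (ν n)) (polygon μ) atTop (Set.Icc 0 1) := by
  obtain ⟨x, hx, hx0⟩ := exists_ne_zero_mem_graded_one hgen hdim
  have hfin : ∀ n, Module.Finite K (𝓑 n) := finite_graded 𝓑 hft hgen
  have hpow : ∀ n, 𝓑 n = 𝓑 1 ^ n := graded_eq_pow 𝓑 le_rfl hgen
  have hxn : ∀ n, x ^ n ∈ 𝓑 n := fun n => by simpa using SetLike.pow_mem_graded n hx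
  have hnt : ∀ n, Nontrivial (𝓑 n) := fun n =>
    ⟨⟨x ^ n, hxn n⟩, 0, fun h => pow_ne_zero n hx0 (congrArg Subtype.val h)⟩
  have hprob : ∀ n, 1 ≤ n → IsProbabilityMeasure (ν n) := fun n hn => by
    obtain ⟨h1, h2, h3⟩ := hF n hn
    have := RFiltration.isProbabilityMeasure_measure h1 h2 h3
    rw [hν n hn]
    infer_instance
  have hIci : ∀ n, 1 ≤ n → ∀ t, ν n (Set.Ici t) =
      (Module.finrank K (𝓑 n) : ℝ≥0∞)⁻¹ * Module.finrank K ((F n).sub (t * n)) := fun n hn t => by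
    obtain ⟨h1, h2, h3⟩ := hF n hn
    rw [hν n hn, dilate_Ici hn, RFiltration.measure_Ici h1 h2 h3]
  have hone : ∀ n, 1 ≤ n → ∀ t, (F n).sub (t * n) = ⊤ → ν n (Set.Ici t) = 1 := fun n hn t h => by
    rw [hIci n hn, h, finrank_top]
    refine ENNReal.inv_mul_cancel ?_ (ENNReal.natCast_ne_top _)
    exact_mod_cast Module.finrank_pos.ne'
  have hzero : ∀ n, 1 ≤ n → ∀ t, (F n).sub (t * n) = ⊥ → ν n (Set.Ici t) = 0 := fun n hn t h => by
    rw [hIci n hn, h, finrank_bot, Nat.cast_zero, mul_zero]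
  obtain ⟨N₁, hN₁⟩ := hpf
  obtain ⟨C, hC⟩ := RFiltration.eventually_sub_eq_bot F hlim
  obtain ⟨N₂, hN₂⟩ := eventually_atTop.1 hC
  let N := max 1 (max N₁ N₂)
  have hN : 1 ≤ N := le_max_left _ _
  have hNN₁ : N₁ ≤ N := (le_max_left _ _).trans (le_max_right _ _)
  have hNN₂ : N₂ ≤ N := (le_max_right _ _).trans (le_max_right _ _)
  let W : ℕ → ℝ → Submodule K B := fun n t => ((F n).sub t).map (𝓑 n).subtype
  have hW : ∀ n t, W n t ≤ 𝓑 n := fun n t => Submodule.map_subtype_le _ _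
  have hanti : ∀ n, Antitone (W n) := fun n s t hst => Submodule.map_mono ((F n).anti hst)
  have hmul : ∀ n m, N ≤ n → N ≤ m → ∀ s t, ∀ a ∈ W n s, ∀ b ∈ W m t,
      a * b ∈ W (n + m) (s + t - f n - f m) := by
    rintro n m hn hm s t _ ⟨a, ha, rfl⟩ _ ⟨b, hb, rfl⟩
    exact ⟨_, hN₁ n m (hNN₁.trans hn) (hNN₁.trans hm) s t a ha b hb, rfl⟩
  have hWtop : ∀ n t, 𝓑 n ≤ W n t ↔ (F n).sub t = ⊤ := by
    refine fun n t => ⟨fun h => eq_top_iff.2 fun a _ => ?_, fun h => ?_⟩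
    · obtain ⟨a', ha', haa'⟩ := h a.2
      rwa [← Subtype.ext haa']
    · change 𝓑 n ≤ ((F n).sub t).map (𝓑 n).subtype
      rw [h, Submodule.map_subtype_top]
  obtain ⟨A₀, hA₀⟩ := exists_linear_lower_bound (𝓑 := 𝓑)
    (fun n m => by rw [hpow (n + m), hpow n, hpow m, pow_add]) hN hf hsum hanti hmul
    fun n hn => by
      obtain ⟨t, ht⟩ := (hF n (hN.trans hn)).2.1.exists_sub_eq_top
      exact ⟨t, (hWtop n t).2 ht⟩
  -- One constant for both sides: `A₀` comes from superadditivity and generation in degree one, `C`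
  -- from the limsup hypothesis.
  set A := max A₀ C with hA
  have htop : ∀ n, N ≤ n → W n (-(A * n)) = 𝓑 n := fun n hn =>
    le_antisymm (hW _ _) ((hA₀ n hn).trans (hanti n (by gcongr; exact le_max_left _ _)))
  have hbot : ∀ n, N ≤ n → ∀ t, A * n < t → (F n).sub t = ⊥ := fun n hn t ht =>
    hN₂ n (hNN₂.trans hn) t (lt_of_le_of_lt (by gcongr; exact le_max_right _ _) ht)
  obtain ⟨Ψ, M₀, hΨ, hsup, hinf⟩ := exists_isTailFunction_finrank 𝓑 hft hgen hx hx0 W hN hf hsum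
    hW hanti hmul htop fun n hn t ht => by
      change ((F n).sub t).map (𝓑 n).subtype = ⊥
      rw [hbot n hn t ht, Submodule.map_bot]
  -- The linear bounds hold only from degree `N` on; the finitely many smaller positive degrees are
  -- bounded one at a time, by finite dimension.
  have hex : ∀ n, ∃ M, 1 ≤ n → (∀ x < -M, (F n).sub (x * n) = ⊤) ∧
      ∀ x, M < x → (F n).sub (x * n) = ⊥ := by
    intro n
    by_cases hn : 1 ≤ n
    · obtain ⟨h1, h2, -⟩ := hF n hn
      obtain ⟨r, hr⟩ := h1.exists_sub_eq_bot
      obtain ⟨s, hs⟩ := h2.exists_sub_eq_top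
      have hn' : (0 : ℝ) < n := by exact_mod_cast hn
      refine ⟨max (r / n) (-(s / n)), fun _ => ⟨fun x hx => ?_, fun x hx => ?_⟩⟩
      · refine top_le_iff.1 (hs ▸ (F n).anti ?_)
        have : x < s / n := by linarith [le_max_right (r / n) (-(s / n))]
        exact ((lt_div_iff₀ hn').1 this).le
      · refine le_bot_iff.1 (hr ▸ (F n).anti ?_)
        have : r / n < x := (le_max_left _ _).trans_lt hx
        exact ((div_lt_iff₀ hn').1 this).le
    · exact ⟨0, fun h => absurd h hn⟩
  choose Mn hMn using hex
  obtain ⟨M₁, hM₁⟩ := ((Finset.range N).image Mn).bddAbove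
  set M := max M₀ (max A M₁) with hM
  have hMtop : ∀ n, 1 ≤ n → ∀ x < -M, ν n (Set.Ici x) = 1 := by
    intro n hn x hx
    refine hone n hn x ?_
    rcases lt_or_ge n N with hlt | hge
    · have := hM₁ (Finset.mem_coe.2 (Finset.mem_image_of_mem Mn (Finset.mem_range.2 hlt)))
      refine (hMn n hn).1 x ?_
      linarith [(le_max_right A M₁).trans (le_max_right M₀ _)]
    · refine (hWtop n _).1 ((htop n hge).ge.trans (hanti n ?_))
      rw [← neg_mul]
      gcongr
      linarith [(le_max_left A M₁).trans (le_max_right M₀ _)]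
  have hMbot : ∀ n, 1 ≤ n → ∀ x, M < x → ν n (Set.Ici x) = 0 := by
    intro n hn x hx
    refine hzero n hn x ?_
    rcases lt_or_ge n N with hlt | hge
    · have := hM₁ (Finset.mem_coe.2 (Finset.mem_image_of_mem Mn (Finset.mem_range.2 hlt)))
      refine (hMn n hn).2 x ?_
      linarith [(le_max_right A M₁).trans (le_max_right M₀ _)]
    · have hn' : (0 : ℝ) < n := by exact_mod_cast hn
      refine hbot n hge _ ?_
      gcongr
      linarith [(le_max_left A M₁).trans (le_max_right M₀ _)]
  have hΨ' : IsTailFunction Ψ M := hΨ.mono (le_max_left _ _)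
  have hτ : ∀ n, 1 ≤ n → IsTailFunction (fun x => (ν n).real (Set.Ioi x)) M := fun n hn => by
    have := hprob n hn
    exact isTailFunction_measure (hMtop n hn) (hMbot n hn)
  have hreal : ∀ n, 1 ≤ n → ∀ t, (ν n).real (Set.Ici t) =
      (Module.finrank K (W n (t * n)) : ℝ) / Module.finrank K (𝓑 n) := fun n hn t => by
    rw [measureReal_def, hIci n hn, Submodule.finrank_map_subtype_eq, ENNReal.toReal_mul,
      ENNReal.toReal_inv, ENNReal.toReal_natCast, ENNReal.toReal_natCast, inv_mul_eq_div]
  have hsup' : ∀ s t ε : ℝ, s < t → 0 < ε → ∀ᶠ n in atTop, (ν n).real (Set.Ici t) < Ψ s + ε := by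
    intro s t ε hst hε
    filter_upwards [hsup s t ε hst hε, eventually_ge_atTop 1] with n hn hn1
    rwa [hreal n hn1]
  have hinf' : ∀ s t ε : ℝ, s < t → 0 < ε → ∀ᶠ n in atTop, Ψ t - ε < (ν n).real (Set.Ici s) := by
    intro s t ε hst hε
    filter_upwards [hinf s t ε hst hε, eventually_ge_atTop 1] with n hn hn1
    rwa [hreal n hn1]
  refine ⟨hprob, ⟨-M, M, fun n hn => ?_⟩,
    (volume.restrict (Set.Ioo (0 : ℝ) 1)).map (quasiInverse Ψ),
    Measure.isProbabilityMeasure_map hΨ'.aemeasurable,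
    tendstoVaguely_map_quasiInverse hΨ' hprob hτ hsup' hinf',
    (isTailFunction_map_quasiInverse hΨ').concaveOn_integral,
    tendstoUniformlyOn_polygon hΨ' hprob hτ hsup' hinf'⟩
  have := hprob n hn
  exact support_subset_Icc (hMtop n hn) (hMbot n hn)
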